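/- **Setting.** Let $\Omega\subset\mathbb R^n$ be a bounded open set, $E\subset\subset\Omega$ open, $\Gamma=\partial E$, $d=\operatorname{dist}(\cdot,\Omega\setminus E)-\operatorname{dist}(\cdot,E)$, and $\delta\in(0,1)$. Put $\omega=\{x\in\Omega:|d(x)|<5\delta\}$. Assume that the $5\delta$-neighbourhood of $\Gamma$ lies in $\Omega$, that $d\in C^4(\omega)$ (so $\Gamma$ is a $C^4$ hypersurface with inner unit normal $\nu=\nabla d$), that each $x\in\omega$ has a unique nearest point $\Pi(x)\in\Gamma$, and that $\tfrac12\le\det(I+s\,D\nu(y))\le 2$ for $y\in\Gamma$, $|s|<5\delta$. On $\Gamma$ let $H=\Delta d=\operatorname{tr}D\nu$ be the scalar mean curvature (thus negative for convex $E$) and $|\mathrm{II}|^2=|D\nu|^2$ the sum of the squared principal curvatures. Let $\phi_1\in C^\infty(\mathbb R)$ be odd and increasing (not necessarily strictly), with $\phi_1'(0)=0$, $0<\phi_1(z)\le\frac9{10}z$ and $0\le\phi_1'(z)\le1$ for $z>0$, $\phi_1(z)=z-\frac14$ on $(\frac12,2)$, $\phi_1=2$ on $(\frac52,\infty)$. Let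 $\eta_1\in C^\infty(\mathbb R)$ be even, decreasing on $(0,\infty)$, $0\le\eta_1\le1$, $|\eta_1'|\le2$, $\eta_1=1$ on $[0,3]$, $\eta_1=0$ on $[4,\infty)$. Put $d_\delta=\delta\phi_1(d/\delta)$, $\eta_\delta=\eta_1(d/\delta)$. Let $X_\delta^{\mu,\Lambda}(\Omega)$ be the set of $w\in L^\infty(\Omega)$ with $\operatorname{ess\,sup}_\Omega|e^{\mu|d_\delta|}w|\le\Lambda$. Call $w\in L^\infty(\mathbb R\times\omega)$ *$(\mu,\Lambda)$-decaying* if $\operatorname{ess\,sup}_{(z,x)\in\mathbb R\times\omega}|e^{\mu|z|}w(z,x)|\le\Lambda$, and *exponentially decaying* if this holds for some $\mu,\Lambda>0$. Let $X^{\mu,\Lambda}(\mathbb R;\Gamma)$ be the set of $(\mu,\Lambda)$-decaying $w$ that are constant in normal direction, $w(z,x)=w(z,\Pi(x))$, and $X(\mathbb R;\Gamma)=\bigcup_{\mu,\Lambda>0}X^{\mu,\Lambda}(\mathbb R;\Gamma)$. For a function $w(z,x)$ we write $w'=\partial_z w$, and $\nabla,\Delta,D^k$ denote derivatives in $x$.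 For $u\in L^2(\Omega)$ let $\mathscr A_\varepsilon u=v\in H^1(\Omega)$ be the weak solution of $-\varepsilon^2\Delta v+v=u$ in $\Omega$, $\nabla v\cdot\nu_\Omega=0$ on $\partial\Omega$. Let $\boldsymbol{\mathscr A}_0w=J*w$ (convolution in $z$), $J(z)=\frac12e^{-|z|}$. **Hypotheses.** Let $K\in\{0,1,2\}$, $\varepsilon_0,\Lambda>0$, $\mu\in(0,1)$, and let $(u_\varepsilon)_{0<\varepsilon<\varepsilon_0}$ be given by $$u_\varepsilon(x)=\eta_\delta(x)\sum_{j=0}^K\varepsilon^ju_j\Big(\frac{d(x)}\varepsilon,\Pi(x)\Big)+(1-\eta_\delta(x))\operatorname{sgn}(d(x))+\varepsilon^{K+1}R^u_\varepsilon(x)\quad\text{for a.e. }x\in\Omega,$$ with $R^u_\varepsilon\in X_\delta^{\mu/\varepsilon,\Lambda}(\Omega)$ for all $0<\varepsilon<\varepsilon_0$, where the profiles $u_0,\dots,u_K$ are continuous on $\mathbb R\times\omega$, of class $C^4$ in $x$ for each $z$, with $|D^2u_j|\le\Lambda$ on $\mathbb R\times\omega$, and such that $u_0-\operatorname{sgn}\in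 X^{\mu,\Lambda}(\mathbb R;\Gamma)$, $u_j\in X^{\mu,\Lambda}(\mathbb R;\Gamma)$ for $1\le j\le K$, and $|\nabla u_j|$, $\Delta u_j$ are $(\mu,\Lambda)$-decaying for $0\le j\le K$. If $K=2$, assume in addition that $|D^ku_0|$ is $(\mu,\Lambda)$-decaying for $1\le k\le4$. **Conclusion.** Let $v_\varepsilon=\mathscr A_\varepsilon u_\varepsilon$. Then there are $\tilde\Lambda>0$ and profiles $v_0,\dots,v_K\in C^2(\mathbb R\times\omega)$ such that, for all $0<\varepsilon<\varepsilon_0$, $$v_\varepsilon(x)=\eta_\delta(x)\sum_{j=0}^K\varepsilon^jv_j\Big(\frac{d(x)}\varepsilon,\Pi(x)\Big)+(1-\eta_\delta(x))\operatorname{sgn}(d(x))+\varepsilon^{K+1}R^v_\varepsilon(x)\quad\text{for a.e. }x\in\Omega,$$ with $R^v_\varepsilon\in X_\delta^{\mu/\varepsilon,\tilde\Lambda}(\Omega)$ (the same $\mu$). For $z\in\mathbb R$, $x\in\omega$, $y=\Pi(x)$ the profiles are given (for indices at most $K$) by $$v_0(z,x)=\boldsymbol{\mathscr A}_0u_0(z,x),\qquad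 v_1(z,x)=\boldsymbol{\mathscr A}_0\big(u_1(z,x)+H(y)v_0'(z,x)\big),$$ $$v_2(z,x)=\boldsymbol{\mathscr A}_0\big(u_2(z,x)+H(y)v_1'(z,x)+(\Delta v_0)(z,y)-z|\mathrm{II}|^2(y)v_0'(z,x)\big).$$ Moreover $v_0-\operatorname{sgn}\in X(\mathbb R;\Gamma)$, $v_j\in X(\mathbb R;\Gamma)$ for $1\le j\le K$, $\partial_zv_j\in X(\mathbb R;\Gamma)$ for $0\le j\le K$, and $|\nabla v_j|$, $\Delta v_j$ are exponentially decaying on $\mathbb R\times\omega$ for $0\le j\le K$. -/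

import Mathlib

open MeasureTheory Metric Set
open scoped ContDiff Laplacian InnerProductSpace

namespace PhaseField

noncomputable section

/-- Euclidean space `ℝⁿ`. -/
abbrev Space (n : ℕ) : Type := EuclideanSpace ℝ (Fin n)

/-! ### The Neumann problem `-ε² Δ v + v = u` in `Ω`, `∇v · ν = 0` on `∂Ω` -/

/-- `G` is the weak gradient of `v` in `Ω`. -/
def HasWeakGradient {n : ℕ} (Ω : Set (Space n)) (v : Space n → ℝ) (G : Space n → Space n) :
    Prop :=
  ∀ φ : Space n → ℝ, ContDiff ℝ ∞ φ → HasCompactSupport φ → tsupport φ ⊆ Ω →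
    ∀ e : Space n, ∫ x in Ω, v x * fderiv ℝ φ x e = - ∫ x in Ω, ⟪G x, e⟫_ℝ * φ x

/-- `v ∈ H¹(Ω)` with weak gradient `G`. -/
def IsSobolev {n : ℕ} (Ω : Set (Space n)) (v : Space n → ℝ) (G : Space n → Space n) : Prop :=
  MemLp v 2 (volume.restrict Ω) ∧ MemLp G 2 (volume.restrict Ω) ∧ HasWeakGradient Ω v G

/-- `v = 𝒜_ε u`, i.e. `v ∈ H¹(Ω)` is the weak solution of `-ε² Δ v + v = u` in `Ω` with the
homogeneous Neumann condition on `∂Ω`. -/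
def IsNeumannSolution {n : ℕ} (Ω : Set (Space n)) (ε : ℝ) (u v : Space n → ℝ) : Prop :=
  ∃ G : Space n → Space n, IsSobolev Ω v G ∧
    ∀ (φ : Space n → ℝ) (Φ : Space n → Space n), IsSobolev Ω φ Φ →
      ε ^ 2 * (∫ x in Ω, ⟪G x, Φ x⟫_ℝ) + ∫ x in Ω, v x * φ x = ∫ x in Ω, u x * φ x

/-! ### Geometry of the interface `Γ = ∂E` -/

/-- The signed distance function `d = dist(·, Ω ∖ E) - dist(·, E)`, positive inside `E`. -/
def sdist {n : ℕ} (Ω E : Set (Space n)) (x : Space n) : ℝ :=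
  infDist x (Ω \ E) - infDist x E

/-- The tube `ω = {x ∈ Ω : |d(x)| < 5δ}`. -/
def tube {n : ℕ} (Ω E : Set (Space n)) (δ : ℝ) : Set (Space n) :=
  {x | x ∈ Ω ∧ |sdist Ω E x| < 5 * δ}

/-- The nearest point projection onto `Γ = ∂E` (used only where the nearest point exists and is
unique). -/
def proj {n : ℕ} (E : Set (Space n)) (x : Space n) : Space n :=
  Classical.epsilon fun y => y ∈ frontier E ∧ dist x y = infDist x (frontier E)

/-- The differential `Dν(y)` of the unit normal field `ν = ∇d`. It vanishes on the normal line
and its other eigenvalues are, up to the sign, the principal curvatures of `Γ` at `y`. -/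
def normalDeriv {n : ℕ} (Ω E : Set (Space n)) (y : Space n) : Space n →L[ℝ] Space n :=
  fderiv ℝ (gradient (sdist Ω E)) y

/-- The scalar mean curvature `H = div ν = Δd` on `Γ`. -/
def meanCurv {n : ℕ} (Ω E : Set (Space n)) (y : Space n) : ℝ :=
  LinearMap.trace ℝ (Space n) (normalDeriv Ω E y : Space n →ₗ[ℝ] Space n)

/-- `|II|²`, the sum of the squared principal curvatures. -/
def sqSecondFF {n : ℕ} (Ω E : Set (Space n)) (y : Space n) : ℝ :=
  ∑ i : Fin n, ‖normalDeriv Ω E y (EuclideanSpace.single i 1)‖ ^ 2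

/-- `E` is compactly contained in the bounded open set `Ω`, and `δ ∈ (0,1)` is such that the
`5δ`-neighbourhood of `Γ = ∂E` lies in `Ω`, `d` is of class `C⁴` in `ω` (so that `Γ` is a
hypersurface of class `C⁴` with inner unit normal `ν = ∇d`), the projection to `Γ` is well defined
in `ω`, and the Jacobian of `(s, y) ↦ y + s ν(y)` on `(-5δ, 5δ) × Γ` is between `1/2` and `2`. -/
structure IsInterface {n : ℕ} (Ω E : Set (Space n)) (δ : ℝ) : Prop where
  isOpen_domain : IsOpen Ω
  isBounded_domain : Bornology.IsBounded Ω
  isOpen_phase : IsOpen E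
  closure_phase_subset : closure E ⊆ Ω
  pos : 0 < δ
  lt_one : δ < 1
  tube_subset : thickening (5 * δ) (frontier E) ⊆ Ω
  contDiffOn_sdist : ContDiffOn ℝ 4 (sdist Ω E) (tube Ω E δ)
  existsUnique_proj : ∀ x ∈ tube Ω E δ,
    ∃! y, y ∈ frontier E ∧ dist x y = infDist x (frontier E)
  jacobian_mem : ∀ y ∈ frontier E, ∀ s ∈ Ioo (-(5 * δ)) (5 * δ),
    (ContinuousLinearMap.id ℝ (Space n) + s • normalDeriv Ω E y).det ∈ Icc (1 / 2 : ℝ) 2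

/-! ### Modified distance and cut-off functions -/

/-- Admissible functions `φ₁` in the definition of the modified distance. -/
structure IsDistModifier (φ₁ : ℝ → ℝ) : Prop where
  smooth : ContDiff ℝ ∞ φ₁
  odd : ∀ z, φ₁ (-z) = -φ₁ z
  monotone : Monotone φ₁
  deriv_zero : deriv φ₁ 0 = 0
  pos : ∀ z, 0 < z → 0 < φ₁ z
  le : ∀ z, 0 < z → φ₁ z ≤ 9 / 10 * z
  deriv_mem : ∀ z, 0 < z → deriv φ₁ z ∈ Icc (0 : ℝ) 1
  eq_sub : ∀ z ∈ Ioo (1 / 2 : ℝ) 2, φ₁ z = z - 1 / 4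
  eq_two : ∀ z ∈ Ioi (5 / 2 : ℝ), φ₁ z = 2

/-- Admissible cut-off functions `η₁`. -/
structure IsCutoff (η₁ : ℝ → ℝ) : Prop where
  smooth : ContDiff ℝ ∞ η₁
  even : ∀ z, η₁ (-z) = η₁ z
  antitone : AntitoneOn η₁ (Ioi 0)
  mem : ∀ z, η₁ z ∈ Icc (0 : ℝ) 1
  abs_deriv_le : ∀ z, |deriv η₁ z| ≤ 2
  eq_one : ∀ z ∈ Icc (0 : ℝ) 3, η₁ z = 1
  eq_zero : ∀ z ∈ Ici (4 : ℝ), η₁ z = 0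

/-- The modified distance `d_δ = δ φ₁(d / δ)`. -/
def modDist {n : ℕ} (Ω E : Set (Space n)) (δ : ℝ) (φ₁ : ℝ → ℝ) (x : Space n) : ℝ :=
  δ * φ₁ (sdist Ω E x / δ)

/-- The cut-off function `η_δ = η₁(d / δ)`. -/
def cutoff {n : ℕ} (Ω E : Set (Space n)) (δ : ℝ) (η₁ : ℝ → ℝ) (x : Space n) : ℝ :=
  η₁ (sdist Ω E x / δ)

/-! ### Exponentially decaying functions -/

/-- `w ∈ L^∞(Ω)` and `ess sup_Ω |e^{μ |ρ|} w| ≤ Λ`; with `ρ = d_δ` this is the space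
`X_δ^{μ,Λ}(Ω)`. -/
def MemXOuter {n : ℕ} (Ω : Set (Space n)) (ρ : Space n → ℝ) (μ Λ : ℝ) (w : Space n → ℝ) :
    Prop :=
  AEStronglyMeasurable w (volume.restrict Ω) ∧
    ∀ᵐ x ∂(volume.restrict Ω), |Real.exp (μ * |ρ x|) * w x| ≤ Λ

/-- `w ∈ L^∞(ℝ × S)` and `ess sup_{ℝ × S} |e^{μ |z|} w(z,x)| ≤ Λ`. -/
def ExpDecay {n : ℕ} (S : Set (Space n)) (μ Λ : ℝ) (w : ℝ → Space n → ℝ) : Prop :=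
  AEStronglyMeasurable (fun q : ℝ × Space n => w q.1 q.2) (volume.restrict (univ ×ˢ S)) ∧
    ∀ᵐ q : ℝ × Space n ∂(volume.restrict (univ ×ˢ S)), |Real.exp (μ * |q.1|) * w q.1 q.2| ≤ Λ

/-- `w(z,·)` is constant in normal direction. -/
def NormalConst {n : ℕ} (Ω E : Set (Space n)) (δ : ℝ) (w : ℝ → Space n → ℝ) : Prop :=
  ∀ z : ℝ, ∀ x ∈ tube Ω E δ, w z x = w z (proj E x)

/-- The space `X^{μ,Λ}(ℝ; Γ)`. -/
def MemXInner {n : ℕ} (Ω E : Set (Space n)) (δ μ Λ : ℝ) (w : ℝ → Space n → ℝ) : Prop :=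
  ExpDecay (tube Ω E δ) μ Λ w ∧ NormalConst Ω E δ w

/-! ### Expansions -/

/-- `η_δ · (∑_{j ≤ K} ε^j p_j) ∘ Ψ_ε⁻¹ + (1 - η_δ) sgn(d)`, where
`Ψ_ε⁻¹(x) = (d(x)/ε, Π_Γ(x))`. Note that `η_δ` vanishes for `|d| ≥ 4δ`. -/
def composite {n : ℕ} (Ω E : Set (Space n)) (δ : ℝ) (η₁ : ℝ → ℝ) (K : ℕ)
    (p : ℕ → ℝ → Space n → ℝ) (ε : ℝ) (x : Space n) : ℝ :=
  cutoff Ω E δ η₁ x *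
      (∑ j ∈ Finset.range (K + 1), ε ^ j * p j (sdist Ω E x / ε) (proj E x)) +
    (1 - cutoff Ω E δ η₁ x) * Real.sign (sdist Ω E x)

/-- The family `w_ε`, `0 < ε < ε₀`, is represented by the profiles `p_0, …, p_K` up to a remainder
`ε^{K+1} R_ε` with `R_ε ∈ X_δ^{μ/ε,Λ}(Ω)`. -/
def IsRepresented {n : ℕ} (Ω E : Set (Space n)) (δ : ℝ) (φ₁ η₁ : ℝ → ℝ) (K : ℕ)
    (ε₀ μ Λ : ℝ) (p : ℕ → ℝ → Space n → ℝ) (w : ℝ → Space n → ℝ) : Prop :=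
  ∀ ε ∈ Ioo 0 ε₀, ∃ R : Space n → ℝ,
    MemXOuter Ω (modDist Ω E δ φ₁) (μ / ε) Λ R ∧
      ∀ᵐ x ∂(volume.restrict Ω),
        w ε x = composite Ω E δ η₁ K p ε x + ε ^ (K + 1) * R x

/-- Phase fields with an expansion of order `K`, with profiles `u_j = p j`. -/
structure HasExpansion {n : ℕ} (Ω E : Set (Space n)) (δ : ℝ) (φ₁ η₁ : ℝ → ℝ) (K : ℕ)
    (ε₀ μ Λ : ℝ) (p : ℕ → ℝ → Space n → ℝ) (u : ℝ → Space n → ℝ) : Prop where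
  represented : IsRepresented Ω E δ φ₁ η₁ K ε₀ μ Λ p u
  continuousOn : ∀ j ≤ K,
    ContinuousOn (fun q : ℝ × Space n => p j q.1 q.2) (univ ×ˢ tube Ω E δ)
  contDiffOn : ∀ j ≤ K, ∀ z, ContDiffOn ℝ 4 (p j z) (tube Ω E δ)
  hessian_le : ∀ j ≤ K, ∀ z, ∀ x ∈ tube Ω E δ, ‖iteratedFDeriv ℝ 2 (p j z) x‖ ≤ Λ
  decay_zero : MemXInner Ω E δ μ Λ (fun z x => p 0 z x - Real.sign z)
  decay : ∀ j ≤ K, 1 ≤ j → MemXInner Ω E δ μ Λ (p j)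
  decay_grad : ∀ j ≤ K, ExpDecay (tube Ω E δ) μ Λ (fun z x => ‖gradient (p j z) x‖)
  decay_laplacian : ∀ j ≤ K, ExpDecay (tube Ω E δ) μ Λ (fun z x => (Δ (p j z)) x)
  decay_higher : K = 2 → ∀ k ∈ Finset.Icc 1 4,
    ExpDecay (tube Ω E δ) μ Λ (fun z x => ‖iteratedFDeriv ℝ k (p 0 z) x‖)

/-- The one-dimensional solution operator `A₀ w = J ∗ w`, `J(z) = e^{-|z|} / 2`. -/
def opA₀ (w : ℝ → ℝ) (z : ℝ) : ℝ :=
  ∫ ζ : ℝ, (1 / 2 * Real.exp (-|z - ζ|)) * w ζ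

/-- The `z`-derivative of a profile. -/
def dz {n : ℕ} (w : ℝ → Space n → ℝ) (z : ℝ) (x : Space n) : ℝ :=
  deriv (fun s => w s x) z

end

end PhaseField

/-!
The leading order equation in the inner variable `z = d / ε` is `-v'' + v = u`, which `J ∗ u`
solves. Writing `v_ε` as a function of `(z, x)` that is constant in the normal direction turns
`-ε² Δ + 1` into `-∂_z² + 1 - ε Δd ∂_z - ε² Δ_x` (`laplacian_comp_sdist`; the mixed term drops out
because `∇_x` is tangential). Expanding `Δd = H - d |II|² + O(d²)` in the distance
(`IsInterface.exists_laplacian_sdist_expansion`, a consequence of the Riccati equation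
`IsInterface.normalDeriv_riccati` for the curvature of the parallel surfaces) and collecting powers
of `ε` gives a source for every order (`source`), and the profile of order `j` is `J ∗ source j`
(`profile`). What is left over is of order `ε^{K+1}` and decays exponentially in `z`
(`exists_residual`).

The profiles inherit the decay of the sources, since convolution with `J` and `J'` preserves every
exponential rate below `1` (`IsSource.isProfile_cv`, `exists_profile_bound`). A factor `z` in front
of a source and the nested derivatives cost an arbitrarily small part of the rate. This loss is
harmless in the inner variable, and for the remainder it is absorbed by `|d_δ| ≤ 9 |d| / 10`: a
residual decaying like `e^{-9 μ |z| / 10}` is dominated by `e^{-μ |d_δ| / ε}` with the original `μ`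
(`exists_residual_bound`). The cut-off `η_δ` creates errors only where `|d| ≥ 3δ` while
`|d_δ| ≤ 2δ`, so that they are smaller than any power of `ε` relative to the weight.

The remainder is estimated by a comparison principle for weak solutions of the Neumann problem
(`IsNeumannSolution.le_of_supersolution`), proved by testing with `β (v - U)`, where `β` is a smooth,
bounded, nondecreasing function that is positive exactly on the positive half-line. All
comparison functions are constant near `∂Ω`, so no regularity of the boundary is needed. The barrier
`1 / cosh (μ d_δ / ε)` is a supersolution comparable to the weight, because `μ < 1`
(`IsInterface.exists_barrier`), and a multiple of it bounds the distance of `v_ε` to the ansatz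
(`isRepresented_of_residual`).
-/

namespace PhaseField

open Filter Topology ContinuousLinearMap
open scoped Convolution

/-! ### Mollification -/

/-- A bump function at the origin with support of radius `1 / (k + 1)`. -/
noncomputable def bump (n k : ℕ) : ContDiffBump (0 : Space n) where
  rIn := 1 / (2 * ((k : ℝ) + 1))
  rOut := 1 / ((k : ℝ) + 1)
  rIn_pos := by positivity
  rIn_lt_rOut := by
    apply one_div_lt_one_div_of_lt <;> linarith [(Nat.cast_nonneg k : (0 : ℝ) ≤ k)]

/-- Mollification at scale `1 / (k + 1)`. -/
noncomputable def moll {n : ℕ} (k : ℕ) (g : Space n → ℝ) : Space n → ℝ :=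
  (bump n k).normed volume ⋆[lsmul ℝ ℝ, volume] g

variable {n : ℕ}

lemma bump_rOut (k : ℕ) : (bump n k).rOut = 1 / ((k : ℝ) + 1) := rfl

lemma tendsto_bump_rOut : Tendsto (fun k => (bump n k).rOut) atTop (𝓝 0) := by
  simpa only [bump_rOut] using tendsto_one_div_add_atTop_nhds_zero_nat (𝕜 := ℝ)

lemma contDiff_moll (k : ℕ) {g : Space n → ℝ} (hg : LocallyIntegrable g) :
    ContDiff ℝ ∞ (moll k g) :=
  (bump n k).hasCompactSupport_normed.contDiff_convolution_left _ (bump n k).contDiff_normed hg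

lemma tendsto_moll {g : Space n → ℝ} (hg : Continuous g) (x : Space n) :
    Tendsto (fun k => moll k g x) atTop (𝓝 (g x)) :=
  ContDiffBump.convolution_tendsto_right_of_continuous tendsto_bump_rOut hg x

lemma ae_tendsto_moll {g : Space n → ℝ} (hg : LocallyIntegrable g) :
    ∀ᵐ x, Tendsto (fun k => moll k g x) atTop (𝓝 (g x)) := by
  refine ContDiffBump.ae_convolution_tendsto_right_of_locallyIntegrable (K := 2)
    tendsto_bump_rOut (Eventually.of_forall fun k => ?_) hg
  change 1 / ((k : ℝ) + 1) ≤ 2 * (1 / (2 * ((k : ℝ) + 1)))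
  apply le_of_eq; field_simp

lemma dist_moll_le (k : ℕ) {g : Space n → ℝ} (hg : AEStronglyMeasurable g) {x : Space n}
    {a C : ℝ} (hC : 0 ≤ C) (h : ∀ y ∈ ball x (bump n k).rOut, |g y - a| ≤ C) :
    |moll k g x - a| ≤ C := by
  have := dist_convolution_le (x₀ := x) (z₀ := a) hC (bump n k).support_normed_eq.subset
    (bump n k).nonneg_normed (bump n k).integral_normed hg (by simpa [Real.dist_eq] using h)
  simpa [moll, Real.dist_eq] using this

lemma abs_moll_le (k : ℕ) {g : Space n → ℝ} (hg : AEStronglyMeasurable g)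
    {C : ℝ} (h : ∀ y, |g y| ≤ C) (x : Space n) : |moll k g x| ≤ C := by
  have hC : 0 ≤ C := (abs_nonneg _).trans (h x)
  simpa using dist_moll_le k hg (x := x) (a := 0) hC (fun y _ => by simpa using h y)

lemma tsupport_moll_subset (k : ℕ) {g : Space n → ℝ} :
    tsupport (moll k g) ⊆ cthickening (bump n k).rOut (tsupport g) := by
  refine closure_minimal ?_ isClosed_cthickening
  intro x hx
  have := support_convolution_subset (lsmul ℝ ℝ) hx
  rw [ContDiffBump.support_normed_eq] at this
  obtain ⟨a, ha, b, hb, rfl⟩ := this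
  refine mem_cthickening_of_dist_le _ b _ _ (subset_tsupport _ hb) ?_
  simp only [mem_ball, dist_zero_right] at ha
  simpa using ha.le

lemma hasCompactSupport_moll (k : ℕ) {g : Space n → ℝ} (hg : HasCompactSupport g) :
    HasCompactSupport (moll k g) :=
  IsCompact.of_isClosed_subset hg.cthickening (isClosed_tsupport _)
    (tsupport_moll_subset k)

/-- Mollification commutes with differentiation of `C¹` functions. -/
lemma fderiv_moll_apply (k : ℕ) {g : Space n → ℝ} (hg : ContDiff ℝ 1 g) (hc : HasCompactSupport g)
    (x e : Space n) : fderiv ℝ (moll k g) x e = moll k (fun y => fderiv ℝ g y e) x := by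
  have h := hc.hasFDerivAt_convolution_right (lsmul ℝ ℝ) (μ := volume)
    ((bump n k).continuous_normed (μ := volume)).locallyIntegrable hg x
  rw [moll, h.fderiv]
  rw [convolution_precompR_apply]
  · rfl
  · exact ((bump n k).continuous_normed (μ := volume)).locallyIntegrable
  · exact hc.fderiv ℝ
  · exact hg.continuous_fderiv one_ne_zero

lemma integrable_moll (k : ℕ) {g : Space n → ℝ} (hg : Integrable g) : Integrable (moll k g) :=
  ((bump n k).continuous_normed.integrable_of_hasCompactSupport
    (bump n k).hasCompactSupport_normed).integrable_convolution _ hg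

lemma integral_abs_moll_le (k : ℕ) {g : Space n → ℝ} (hg : Integrable g) :
    ∫ x, |moll k g x| ≤ ∫ x, |g x| := by
  have hρ : Integrable ((bump n k).normed (volume : Measure (Space n))) :=
    (bump n k).continuous_normed.integrable_of_hasCompactSupport
      (bump n k).hasCompactSupport_normed
  have h1 : ∫ x, moll k (fun y => |g y|) x = ∫ x, |g x| := by
    have := integral_convolution (lsmul ℝ ℝ) hρ hg.abs (μ := volume) (ν := volume)
    rw [moll, this, (bump n k).integral_normed]
    simp
  rw [← h1]
  refine integral_mono (integrable_moll k hg).abs (integrable_moll k hg.abs) fun x => ?_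
  simp only [moll, convolution_def, lsmul_apply]
  refine (abs_integral_le_integral_abs).trans (le_of_eq ?_)
  refine integral_congr_ae (Eventually.of_forall fun t => ?_)
  simp [abs_mul, abs_of_nonneg ((bump n k).nonneg_normed t)]

/-- Mollifications of an integrable function converge in `L¹`: continuous compactly supported
functions are dense, and mollification does not increase the `L¹` norm. -/
lemma tendsto_integral_abs_moll_sub {g : Space n → ℝ} (hg : Integrable g) :
    Tendsto (fun k => ∫ x, |moll k g x - g x|) atTop (𝓝 0) := by
  have key : ∀ c : Space n → ℝ, Continuous c → HasCompactSupport c →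
      Tendsto (fun k => ∫ x, |moll k c x - c x|) atTop (𝓝 0) := by
    intro c hc hcs
    obtain ⟨C, hC⟩ := hc.bounded_above_of_compact_support hcs
    have hK : IsCompact (cthickening 1 (tsupport c)) := hcs.cthickening
    have : Tendsto (fun k => ∫ x, |moll k c x - c x|) atTop (𝓝 (∫ _ : Space n, (0 : ℝ))) := by
      refine tendsto_integral_of_dominated_convergence
        ((cthickening 1 (tsupport c)).indicator fun _ => 2 * C) ?_ ?_ ?_ ?_
      · intro k
        exact ((contDiff_moll k hc.locallyIntegrable).continuous.sub hc).abs.aestronglyMeasurable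
      · rw [integrable_indicator_iff hK.measurableSet]
        exact integrableOn_const hK.measure_lt_top.ne
      · intro k
        refine Eventually.of_forall fun x => ?_
        by_cases hx : x ∈ cthickening 1 (tsupport c)
        · rw [indicator_of_mem hx, Real.norm_eq_abs, abs_abs]
          have h1 := abs_moll_le k hc.aestronglyMeasurable (by simpa using hC) x
          have h2 := hC x
          rw [Real.norm_eq_abs] at h2
          rw [abs_le] at h1 h2 ⊢
          constructor <;> linarith
        · rw [indicator_of_notMem hx]
          have h1 : x ∉ tsupport c := fun h => hx (self_subset_cthickening _ h)
          have h2 : x ∉ tsupport (moll k c) := fun h => hx <| by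
            refine cthickening_mono ?_ _ (tsupport_moll_subset k h)
            rw [bump_rOut, div_le_one (by positivity)]
            linarith [(Nat.cast_nonneg k : (0 : ℝ) ≤ k)]
          simp [image_eq_zero_of_notMem_tsupport h1, image_eq_zero_of_notMem_tsupport h2]
      · refine Eventually.of_forall fun x => ?_
        have := ((tendsto_moll hc x).sub_const (c x)).abs
        simpa using this
    simpa using this
  rw [Metric.tendsto_atTop]
  intro ε hε
  obtain ⟨c, hcs, hgc, hc, hci⟩ :=
    hg.exists_hasCompactSupport_integral_sub_le (ε := ε / 4) (by positivity)
  obtain ⟨N, hN⟩ := (Metric.tendsto_atTop.1 (key c hc hcs)) (ε / 4) (by positivity)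
  refine ⟨N, fun k hk => ?_⟩
  have h1 := hN k hk
  rw [Real.dist_eq, sub_zero, abs_of_nonneg (integral_nonneg fun x => abs_nonneg _)] at h1 ⊢
  have hd : Integrable (fun x => g x - c x) := hg.sub hci
  have hsub : ∀ x, moll k g x = moll k (fun y => g y - c y) x + moll k c x := by
    intro x
    have h1 : ConvolutionExistsAt ((bump n k).normed volume) (fun y => g y - c y) x
        (lsmul ℝ ℝ) volume :=
      (bump n k).hasCompactSupport_normed.convolutionExists_left _
        (bump n k).continuous_normed hd.locallyIntegrable x
    have h2 : ConvolutionExistsAt ((bump n k).normed volume) c x (lsmul ℝ ℝ) volume :=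
      (bump n k).hasCompactSupport_normed.convolutionExists_left _
        (bump n k).continuous_normed hci.locallyIntegrable x
    have := h1.distrib_add h2
    simp only [moll]
    rw [← this]
    congr 1
    ext y; simp
  calc ∫ x, |moll k g x - g x|
      ≤ ∫ x, (|moll k (fun y => g y - c y) x| + |moll k c x - c x|) + |g x - c x| := by
        refine integral_mono ((integrable_moll k hg).sub hg).abs
          (((integrable_moll k hd).abs.add ((integrable_moll k hci).sub hci).abs).add hd.abs)
          fun x => ?_
        simp only
        rw [hsub x]
        have e1 := abs_add_le (moll k (fun y => g y - c y) x) (moll k c x - c x)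
        have e2 := abs_sub (moll k (fun y => g y - c y) x + (moll k c x - c x)) (g x - c x)
        refine le_trans (le_of_eq ?_) (e2.trans (by linarith))
        congr 1; ring
    _ = (∫ x, |moll k (fun y => g y - c y) x|) + (∫ x, |moll k c x - c x|)
          + ∫ x, |g x - c x| := by
        rw [integral_add, integral_add]
        · exact (integrable_moll k hd).abs
        · exact ((integrable_moll k hci).sub hci).abs
        · exact (integrable_moll k hd).abs.add ((integrable_moll k hci).sub hci).abs
        · exact hd.abs
    _ < ε := by
        have := integral_abs_moll_le k hd
        simp only [Real.norm_eq_abs] at hgc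
        linarith

/-! ### Weak gradients -/

lemma exists_cthickening_bump_subset {K Ω : Set (Space n)} (hK : IsCompact K) (hΩ : IsOpen Ω)
    (h : K ⊆ Ω) : ∀ᶠ k in atTop, cthickening (bump n k).rOut K ⊆ Ω := by
  obtain ⟨r, hr, hr'⟩ := hK.exists_cthickening_subset_open hΩ h
  filter_upwards [(tendsto_order.1 (tendsto_bump_rOut (n := n))).2 r hr] with k hk
  exact (cthickening_mono hk.le _).trans hr'

/-- The defining identity of the weak gradient extends to test functions of class `C¹`. -/
lemma HasWeakGradient.integral_of_contDiff_one {Ω : Set (Space n)} (hΩ : IsOpen Ω)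
    {v : Space n → ℝ} {G : Space n → Space n} (h : HasWeakGradient Ω v G)
    (hv : IntegrableOn v Ω) (hG : IntegrableOn G Ω)
    {ψ : Space n → ℝ} (hψ : ContDiff ℝ 1 ψ) (hc : HasCompactSupport ψ) (hs : tsupport ψ ⊆ Ω)
    (e : Space n) : ∫ x in Ω, v x * fderiv ℝ ψ x e = - ∫ x in Ω, ⟪G x, e⟫_ℝ * ψ x := by
  have hd : Continuous fun y => fderiv ℝ ψ y e :=
    (hψ.continuous_fderiv one_ne_zero).clm_apply continuous_const
  have hdc : HasCompactSupport fun y => fderiv ℝ ψ y e := by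
    refine (hc.fderiv ℝ).mono ?_
    intro y hy; contrapose! hy
    simp only [Function.mem_support, not_not] at hy ⊢; simp [hy]
  obtain ⟨C₁, hC₁⟩ := hd.bounded_above_of_compact_support hdc
  obtain ⟨C₂, hC₂⟩ := hψ.continuous.bounded_above_of_compact_support hc
  have hGe : IntegrableOn (fun x => ⟪G x, e⟫_ℝ) Ω := hG.inner_const e
  have hL : Tendsto (fun k => ∫ x in Ω, v x * fderiv ℝ (moll k ψ) x e) atTop
      (𝓝 (∫ x in Ω, v x * fderiv ℝ ψ x e)) := by
    refine tendsto_integral_of_dominated_convergence (fun x => |v x| * C₁) ?_ ?_ ?_ ?_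
    · intro k
      refine hv.aestronglyMeasurable.mul (Continuous.aestronglyMeasurable ?_)
      exact ((contDiff_moll k hψ.continuous.locallyIntegrable).continuous_fderiv
        (by simp)).clm_apply continuous_const
    · exact hv.abs.mul_const _
    · intro k
      refine Eventually.of_forall fun x => ?_
      rw [fderiv_moll_apply k hψ hc, Real.norm_eq_abs, abs_mul]
      exact mul_le_mul_of_nonneg_left
        (abs_moll_le k hd.aestronglyMeasurable (by simpa using hC₁) x) (abs_nonneg _)
    · refine Eventually.of_forall fun x => ?_
      simp only [fderiv_moll_apply _ hψ hc]
      exact (tendsto_moll hd x).const_mul _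
  have hR : Tendsto (fun k => - ∫ x in Ω, ⟪G x, e⟫_ℝ * moll k ψ x) atTop
      (𝓝 (- ∫ x in Ω, ⟪G x, e⟫_ℝ * ψ x)) := by
    refine Tendsto.neg ?_
    refine tendsto_integral_of_dominated_convergence (fun x => |⟪G x, e⟫_ℝ| * C₂) ?_ ?_ ?_ ?_
    · intro k
      exact hGe.aestronglyMeasurable.mul
        (contDiff_moll k hψ.continuous.locallyIntegrable).continuous.aestronglyMeasurable
    · exact hGe.abs.mul_const _
    · intro k
      refine Eventually.of_forall fun x => ?_
      rw [Real.norm_eq_abs, abs_mul]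
      exact mul_le_mul_of_nonneg_left
        (abs_moll_le k hψ.continuous.aestronglyMeasurable (by simpa using hC₂) x) (abs_nonneg _)
    · exact Eventually.of_forall fun x => (tendsto_moll hψ.continuous x).const_mul _
  refine tendsto_nhds_unique_of_eventuallyEq hL hR ?_
  filter_upwards [exists_cthickening_bump_subset hc hΩ hs] with k hk
  exact h _ (contDiff_moll k hψ.continuous.locallyIntegrable) (hasCompactSupport_moll k hc)
    ((tsupport_moll_subset k).trans hk) e

/-- Away from the boundary, the derivative of the mollified function is the mollified weak
gradient. -/
lemma HasWeakGradient.fderiv_moll_indicator {Ω : Set (Space n)} (hΩ : IsOpen Ω)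
    {v : Space n → ℝ} {G : Space n → Space n} (h : HasWeakGradient Ω v G)
    (hv : IntegrableOn v Ω) (k : ℕ) {x : Space n} (hx : closedBall x (bump n k).rOut ⊆ Ω)
    (e : Space n) :
    fderiv ℝ (moll k (Ω.indicator v)) x e = moll k (Ω.indicator fun y => ⟪G y, e⟫_ℝ) x := by
  have hvi : Integrable (Ω.indicator v) := (integrable_indicator_iff hΩ.measurableSet).2 hv
  set ρ := (bump n k).normed (volume : Measure (Space n)) with hρ
  have hρs : ContDiff ℝ ∞ ρ := (bump n k).contDiff_normed
  have hρc : HasCompactSupport ρ := (bump n k).hasCompactSupport_normed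
  have h1 := hρc.hasFDerivAt_convolution_left (lsmul ℝ ℝ) (μ := volume)
    (hρs.of_le (by simp)) hvi.locallyIntegrable x
  have h1' : fderiv ℝ (moll k (Ω.indicator v)) x e
      = ∫ y, fderiv ℝ ρ (x - y) e * Ω.indicator v y := by
    rw [moll, h1.fderiv, convolution_eq_swap, ContinuousLinearMap.integral_apply]
    · rfl
    · have := ((hρc.fderiv ℝ).convolutionExists_left ((lsmul ℝ ℝ).precompL (Space n))
        (hρs.continuous_fderiv (by simp)) hvi.locallyIntegrable x).integrable_swap
      exact this
  set φ : Space n → ℝ := fun y => ρ (x - y) with hφ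
  have hφd : ∀ y, fderiv ℝ φ y e = - fderiv ℝ ρ (x - y) e := by
    intro y
    have h2 : HasFDerivAt (fun y : Space n => x - y) (-ContinuousLinearMap.id ℝ (Space n)) y :=
      (hasFDerivAt_id y).const_sub x
    have h3 := ((hρs.differentiable (by simp)) (x - y)).hasFDerivAt.comp y h2
    have : fderiv ℝ φ y = _ := h3.fderiv
    rw [this]; simp
  have hφs : tsupport φ ⊆ closedBall x (bump n k).rOut := by
    refine closure_minimal ?_ isClosed_closedBall
    intro y hy
    have : x - y ∈ Function.support ρ := hy
    rw [hρ, ContDiffBump.support_normed_eq, mem_ball_zero_iff, ← dist_eq_norm] at this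
    rw [mem_closedBall, dist_comm]; exact this.le
  have h4 := h φ (hρs.comp (contDiff_const.sub contDiff_id))
    (IsCompact.of_isClosed_subset (isCompact_closedBall _ _) (isClosed_tsupport _) hφs)
    (hφs.trans hx) e
  rw [h1', moll, convolution_eq_swap]
  have e1 : ∫ y, fderiv ℝ ρ (x - y) e * Ω.indicator v y = - ∫ y in Ω, v y * fderiv ℝ φ y e := by
    rw [← integral_indicator hΩ.measurableSet, ← integral_neg]
    refine integral_congr_ae (Eventually.of_forall fun y => ?_)
    by_cases hy : y ∈ Ω <;> simp [hy, hφd, mul_comm]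
  have e2 : ∫ y, (lsmul ℝ ℝ (ρ (x - y))) (Ω.indicator (fun y => ⟪G y, e⟫_ℝ) y)
      = ∫ y in Ω, ⟪G y, e⟫_ℝ * φ y := by
    rw [← integral_indicator hΩ.measurableSet]
    refine integral_congr_ae (Eventually.of_forall fun y => ?_)
    by_cases hy : y ∈ Ω <;> simp [hy, hφ, mul_comm]
  rw [e1, e2, h4, neg_neg]

/-- Chain rule for weak gradients and bounded smooth functions with bounded derivative. -/
lemma HasWeakGradient.comp_smooth {Ω : Set (Space n)} (hΩ : IsOpen Ω)
    {v : Space n → ℝ} {G : Space n → Space n} (h : HasWeakGradient Ω v G)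
    (hv : IntegrableOn v Ω) (hG : IntegrableOn G Ω) {β : ℝ → ℝ} (hβ : ContDiff ℝ ∞ β)
    {C : ℝ} (hβ₀ : ∀ t, |β t| ≤ C) (hβ₁ : ∀ t, |deriv β t| ≤ C) :
    HasWeakGradient Ω (fun x => β (v x)) (fun x => deriv β (v x) • G x) := by
  intro φ hφ hc hs e
  have hvi : Integrable (Ω.indicator v) := (integrable_indicator_iff hΩ.measurableSet).2 hv
  set g : Space n → ℝ := Ω.indicator fun y => ⟪G y, e⟫_ℝ with hg
  have hgi : Integrable g := (integrable_indicator_iff hΩ.measurableSet).2 (hG.inner_const e)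
  have hd : Continuous fun y => fderiv ℝ φ y e :=
    (hφ.continuous_fderiv (by simp)).clm_apply continuous_const
  have hdc : HasCompactSupport fun y => fderiv ℝ φ y e := by
    refine (hc.fderiv ℝ).mono ?_
    intro y hy; contrapose! hy
    simp only [Function.mem_support, not_not] at hy ⊢; simp [hy]
  have hdi : Integrable fun y => fderiv ℝ φ y e := hd.integrable_of_hasCompactSupport hdc
  obtain ⟨M, hM⟩ := hφ.continuous.bounded_above_of_compact_support hc
  have hM0 : 0 ≤ M := (norm_nonneg _).trans (hM 0)
  have hβ' : Continuous (deriv β) := hβ.continuous_deriv (by simp)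
  have hC0 : 0 ≤ C := (abs_nonneg _).trans (hβ₀ 0)
  set w : ℕ → Space n → ℝ := fun k => moll k (Ω.indicator v) with hw
  have hws : ∀ k, ContDiff ℝ ∞ (w k) := fun k => contDiff_moll k hvi.locallyIntegrable
  have hwlim : ∀ᵐ x, Tendsto (fun k => w k x) atTop (𝓝 (Ω.indicator v x)) :=
    ae_tendsto_moll hvi.locallyIntegrable
  have hφi : Integrable φ := hφ.continuous.integrable_of_hasCompactSupport hc
  have hL : Tendsto (fun k => ∫ x, β (w k x) * fderiv ℝ φ x e) atTop
      (𝓝 (∫ x, β (Ω.indicator v x) * fderiv ℝ φ x e)) := by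
    refine tendsto_integral_of_dominated_convergence (fun x => C * |fderiv ℝ φ x e|) ?_ ?_ ?_ ?_
    · exact fun k => ((hβ.continuous.comp (hws k).continuous).mul hd).aestronglyMeasurable
    · exact hdi.abs.const_mul _
    · refine fun k => Eventually.of_forall fun x => ?_
      rw [Real.norm_eq_abs, abs_mul]
      exact mul_le_mul_of_nonneg_right (hβ₀ _) (abs_nonneg _)
    · filter_upwards [hwlim] with x hx
      exact ((hβ.continuous.tendsto _).comp hx).mul_const _
  have hR₁ : Tendsto (fun k => ∫ x, deriv β (w k x) * g x * φ x) atTop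
      (𝓝 (∫ x, deriv β (Ω.indicator v x) * g x * φ x)) := by
    refine tendsto_integral_of_dominated_convergence (fun x => C * |g x| * M) ?_ ?_ ?_ ?_
    · exact fun k => ((hβ'.comp (hws k).continuous).aestronglyMeasurable.mul
        hgi.aestronglyMeasurable).mul hφ.continuous.aestronglyMeasurable
    · exact (hgi.abs.const_mul _).mul_const _
    · refine fun k => Eventually.of_forall fun x => ?_
      rw [Real.norm_eq_abs, abs_mul, abs_mul]
      exact mul_le_mul (mul_le_mul_of_nonneg_right (hβ₁ _) (abs_nonneg _)) (hM x)
        (abs_nonneg _) (by positivity)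
    · filter_upwards [hwlim] with x hx
      exact (((hβ'.tendsto _).comp hx).mul_const _).mul_const _
  -- `moll k g` has no pointwise majorant, but it converges in `L¹`
  have hR₂ : Tendsto (fun k => ∫ x, deriv β (w k x) * (moll k g x - g x) * φ x) atTop
      (𝓝 0) := by
    refine squeeze_zero_norm (a := fun k => (C * M) * ∫ x, |moll k g x - g x|) (fun k => ?_) ?_
    · rw [← integral_const_mul]
      refine norm_integral_le_of_norm_le
        ((((integrable_moll k hgi).sub hgi).abs).const_mul _) (Eventually.of_forall fun x => ?_)
      rw [Real.norm_eq_abs, abs_mul, abs_mul]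
      calc |deriv β (w k x)| * |moll k g x - g x| * |φ x|
          ≤ C * |moll k g x - g x| * M := by
            refine mul_le_mul (mul_le_mul_of_nonneg_right (hβ₁ _) (abs_nonneg _)) (hM x)
              (abs_nonneg _) (by positivity)
        _ = _ := by ring
    · simpa using (tendsto_integral_abs_moll_sub hgi).const_mul (C * M)
  have hR : Tendsto (fun k => - ∫ x, deriv β (w k x) * moll k g x * φ x) atTop
      (𝓝 (- ∫ x, deriv β (Ω.indicator v x) * g x * φ x)) := by
    refine Tendsto.neg ?_
    have := hR₁.add hR₂
    rw [add_zero] at this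
    refine this.congr fun k => ?_
    have hb : ∀ f : Space n → ℝ, Integrable f →
        Integrable fun x => deriv β (w k x) * f x * φ x := by
      intro f hf
      refine Integrable.mul_bdd (c := M) ?_ hφ.continuous.aestronglyMeasurable
        (Eventually.of_forall hM)
      exact hf.bdd_mul (hβ'.comp (hws k).continuous).aestronglyMeasurable
        (Eventually.of_forall fun x => hβ₁ _)
    rw [← integral_add (hb g hgi)
      (hb (fun x => moll k g x - g x) ((integrable_moll k hgi).sub hgi))]
    refine integral_congr_ae (Eventually.of_forall fun x => ?_)
    ring
  have hlim : ∫ x, β (Ω.indicator v x) * fderiv ℝ φ x e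
      = - ∫ x, deriv β (Ω.indicator v x) * g x * φ x := by
    -- for the mollified function the identity is the classical integration by parts
    refine tendsto_nhds_unique_of_eventuallyEq hL hR ?_
    filter_upwards [exists_cthickening_bump_subset hc hΩ hs] with k hk
    have hβw : ContDiff ℝ ∞ fun x => β (w k x) := hβ.comp (hws k)
    have hβd : ∀ x, fderiv ℝ (fun x => β (w k x)) x e = deriv β (w k x) * fderiv ℝ (w k) x e := by
      intro x
      have := ((hβ.differentiable (by simp)) (w k x)).hasDerivAt.comp_hasFDerivAt x
        ((hws k).differentiable (by simp) x).hasFDerivAt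
      have h' : fderiv ℝ (fun x => β (w k x)) x = _ := this.fderiv
      rw [h']; simp
    have hcont : Continuous fun x => fderiv ℝ (fun x => β (w k x)) x e :=
      (hβw.continuous_fderiv (by simp)).clm_apply continuous_const
    rw [integral_mul_fderiv_eq_neg_fderiv_mul_of_integrable]
    · congr 1
      refine integral_congr_ae (Eventually.of_forall fun x => ?_)
      by_cases hx : x ∈ tsupport φ
      · simp only
        rw [hβd, h.fderiv_moll_indicator hΩ hv k
          ((closedBall_subset_cthickening hx _).trans hk)]
      · simp [image_eq_zero_of_notMem_tsupport hx]
    · exact (hcont.mul hφ.continuous).integrable_of_hasCompactSupport hc.mul_left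
    · exact (hβw.continuous.mul hd).integrable_of_hasCompactSupport hdc.mul_left
    · exact (hβw.continuous.mul hφ.continuous).integrable_of_hasCompactSupport hc.mul_left
    · exact fun x _ => hβw.differentiable (by simp) x
    · exact fun x _ => hφ.differentiable (by simp) x
  have hz : ∀ x ∉ Ω, φ x = 0 := fun x hx =>
    image_eq_zero_of_notMem_tsupport fun hx' => hx (hs hx')
  have hz' : ∀ x ∉ Ω, fderiv ℝ φ x e = 0 := fun x hx => by
    rw [image_eq_zero_of_notMem_tsupport fun hx' => hx (hs (tsupport_fderiv_subset ℝ hx'))]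
    simp
  have e1 : ∫ x in Ω, β (v x) * fderiv ℝ φ x e = ∫ x, β (Ω.indicator v x) * fderiv ℝ φ x e := by
    rw [← integral_indicator hΩ.measurableSet]
    refine integral_congr_ae (Eventually.of_forall fun x => ?_)
    by_cases hx : x ∈ Ω
    · simp [hx]
    · simp [hx, hz' x hx]
  have e2 : ∫ x in Ω, ⟪deriv β (v x) • G x, e⟫_ℝ * φ x
      = ∫ x, deriv β (Ω.indicator v x) * g x * φ x := by
    rw [← integral_indicator hΩ.measurableSet]
    refine integral_congr_ae (Eventually.of_forall fun x => ?_)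
    by_cases hx : x ∈ Ω
    · simp [hx, hg, real_inner_smul_left]
    · simp [hx, hz x hx]
  simp only
  rw [e1, e2, hlim]

/-! ### Comparison principle for the Neumann problem -/

lemma laplacian_eq_sum (f : Space n → ℝ) (x : Space n) :
    (Δ f) x = ∑ i, fderiv ℝ (fderiv ℝ f) x (EuclideanSpace.single i 1)
      (EuclideanSpace.single i 1) := by
  rw [InnerProductSpace.laplacian_eq_iteratedFDeriv_orthonormalBasis f
    (EuclideanSpace.basisFun (Fin n) ℝ)]
  simp [iteratedFDeriv_two_apply]

lemma inner_gradient_eq (f : Space n → ℝ) (x e : Space n) :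
    ⟪gradient f x, e⟫_ℝ = fderiv ℝ f x e := by
  simp [gradient]

lemma continuous_gradient {f : Space n → ℝ} (hf : ContDiff ℝ 1 f) : Continuous (gradient f) :=
  (InnerProductSpace.toDual ℝ (Space n)).symm.continuous.comp
    (hf.continuous_fderiv one_ne_zero)

/-- Green's formula: the first factor is compactly supported in the domain, so that there is no
boundary term. -/
lemma HasWeakGradient.integral_inner_gradient {Ω : Set (Space n)} (hΩ : IsOpen Ω)
    {φ : Space n → ℝ} {Φ : Space n → Space n} (h : HasWeakGradient Ω φ Φ)
    (hφ : IntegrableOn φ Ω) (hΦ : IntegrableOn Φ Ω)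
    {ψ : Space n → ℝ} (hψ : ContDiff ℝ 2 ψ) (hc : HasCompactSupport ψ) (hs : tsupport ψ ⊆ Ω) :
    ∫ x in Ω, ⟪gradient ψ x, Φ x⟫_ℝ = - ∫ x in Ω, (Δ ψ) x * φ x := by
  have hd : ∀ e, ContDiff ℝ 1 fun y => fderiv ℝ ψ y e := fun e =>
    (hψ.fderiv_right (m := 1) (by norm_num)).clm_apply contDiff_const
  have hsd : ∀ e, tsupport (fun y => fderiv ℝ ψ y e) ⊆ tsupport ψ := fun e =>
    tsupport_fderiv_apply_subset ℝ e
  have hdc : ∀ e, HasCompactSupport fun y => fderiv ℝ ψ y e := fun e =>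
    IsCompact.of_isClosed_subset hc (isClosed_tsupport _) (hsd e)
  have h1 : ∀ e, ∫ x in Ω, φ x * fderiv ℝ (fderiv ℝ ψ) x e e
      = - ∫ x in Ω, ⟪Φ x, e⟫_ℝ * fderiv ℝ ψ x e := by
    intro e
    rw [← h.integral_of_contDiff_one hΩ hφ hΦ (hd e) (hdc e) ((hsd e).trans hs) e]
    congr 1; ext x; congr 1
    have := ((hψ.fderiv_right (m := 1) (by norm_num)).differentiable one_ne_zero x).hasFDerivAt
    have h2 := this.clm_apply (hasFDerivAt_const e x)
    rw [h2.fderiv]; simp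
  have hi1 : ∀ e, IntegrableOn (fun x => ⟪Φ x, e⟫_ℝ * fderiv ℝ ψ x e) Ω := by
    intro e
    obtain ⟨C, hC⟩ := (hd e).continuous.bounded_above_of_compact_support (hdc e)
    exact (hΦ.inner_const e).mul_bdd (c := C)
      (hd e).continuous.aestronglyMeasurable (Eventually.of_forall hC)
  have hi2 : ∀ e, IntegrableOn (fun x => φ x * fderiv ℝ (fderiv ℝ ψ) x e e) Ω := by
    intro e
    have hcont : Continuous fun x => fderiv ℝ (fderiv ℝ ψ) x e e :=
      (((hψ.fderiv_right (m := 1) (by norm_num)).continuous_fderiv one_ne_zero).clm_apply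
        continuous_const).clm_apply continuous_const
    have hcs : HasCompactSupport fun x => fderiv ℝ (fderiv ℝ ψ) x e e := by
      refine ((hc.fderiv ℝ).fderiv ℝ).mono ?_
      intro y hy; contrapose! hy
      simp only [Function.mem_support, not_not] at hy ⊢; simp [hy]
    obtain ⟨C, hC⟩ := hcont.bounded_above_of_compact_support hcs
    exact hφ.mul_bdd (c := C) hcont.aestronglyMeasurable (Eventually.of_forall hC)
  have e1 : ∀ x, ⟪gradient ψ x, Φ x⟫_ℝ = ∑ i, ⟪Φ x, EuclideanSpace.single i 1⟫_ℝ *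
      fderiv ℝ ψ x (EuclideanSpace.single i 1) := by
    intro x
    rw [← (EuclideanSpace.basisFun (Fin n) ℝ).sum_inner_mul_inner (gradient ψ x) (Φ x)]
    refine Finset.sum_congr rfl fun i _ => ?_
    rw [EuclideanSpace.basisFun_apply, inner_gradient_eq, real_inner_comm, mul_comm]
  have e2 : ∀ x, (Δ ψ) x * φ x = ∑ i, φ x * fderiv ℝ (fderiv ℝ ψ) x (EuclideanSpace.single i 1)
      (EuclideanSpace.single i 1) := by
    intro x
    rw [laplacian_eq_sum, Finset.sum_mul]
    exact Finset.sum_congr rfl fun i _ => mul_comm _ _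
  simp only [e1, e2]
  rw [integral_finsetSum _ fun i _ => hi1 _, integral_finsetSum _ fun i _ => hi2 _,
    ← Finset.sum_neg_distrib]
  exact Finset.sum_congr rfl fun i _ => by rw [h1, neg_neg]

lemma hasWeakGradient_gradient {Ω : Set (Space n)} {U : Space n → ℝ}
    (hU : ContDiff ℝ 1 U) : HasWeakGradient Ω U (gradient U) := by
  intro φ hφ hc hs e
  have hd : Continuous fun y => fderiv ℝ φ y e :=
    (hφ.continuous_fderiv (by simp)).clm_apply continuous_const
  have hdc : HasCompactSupport fun y => fderiv ℝ φ y e :=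
    IsCompact.of_isClosed_subset hc (isClosed_tsupport _) (tsupport_fderiv_apply_subset ℝ e)
  have hUd : Continuous fun y => fderiv ℝ U y e :=
    (hU.continuous_fderiv one_ne_zero).clm_apply continuous_const
  have key := integral_mul_fderiv_eq_neg_fderiv_mul_of_integrable (μ := volume) (f := U) (g := φ)
    (v := e) ((hUd.mul hφ.continuous).integrable_of_hasCompactSupport hc.mul_left)
    ((hU.continuous.mul hd).integrable_of_hasCompactSupport hdc.mul_left)
    ((hU.continuous.mul hφ.continuous).integrable_of_hasCompactSupport hc.mul_left)
    (fun x _ => hU.differentiable one_ne_zero x) (fun x _ => hφ.differentiable (by simp) x)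
  rw [setIntegral_eq_integral_of_forall_compl_eq_zero,
    setIntegral_eq_integral_of_forall_compl_eq_zero, key]
  · simp only [inner_gradient_eq]
  · intro x hx
    rw [image_eq_zero_of_notMem_tsupport fun hx' => hx (hs hx'), mul_zero]
  · intro x hx
    rw [image_eq_zero_of_notMem_tsupport fun hx' => hx (hs (tsupport_fderiv_subset ℝ hx'))]
    simp

lemma IsSobolev.sub {Ω : Set (Space n)} (hΩ' : volume Ω ≠ ⊤)
    {v w : Space n → ℝ} {G F : Space n → Space n}
    (hv : IsSobolev Ω v G) (hw : IsSobolev Ω w F) :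
    IsSobolev Ω (fun x => v x - w x) (fun x => G x - F x) := by
  refine ⟨hv.1.sub hw.1, hv.2.1.sub hw.2.1, ?_⟩
  intro φ hφ hc hs e
  have : IsFiniteMeasure (volume.restrict Ω) := ⟨by simpa using hΩ'.lt_top⟩
  have hd : Continuous fun y => fderiv ℝ φ y e :=
    (hφ.continuous_fderiv (by simp)).clm_apply continuous_const
  have hdc : HasCompactSupport fun y => fderiv ℝ φ y e :=
    IsCompact.of_isClosed_subset hc (isClosed_tsupport _) (tsupport_fderiv_apply_subset ℝ e)
  obtain ⟨C, hC⟩ := hd.bounded_above_of_compact_support hdc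
  obtain ⟨M, hM⟩ := hφ.continuous.bounded_above_of_compact_support hc
  have i1 : ∀ f : Space n → ℝ, MemLp f 2 (volume.restrict Ω) →
      IntegrableOn (fun x => f x * fderiv ℝ φ x e) Ω := fun f hf =>
    (hf.integrable (by norm_num)).mul_bdd (c := C) hd.aestronglyMeasurable
      (Eventually.of_forall hC)
  have i2 : ∀ f : Space n → Space n, MemLp f 2 (volume.restrict Ω) →
      IntegrableOn (fun x => ⟪f x, e⟫_ℝ * φ x) Ω := fun f hf =>
    ((hf.integrable (by norm_num)).inner_const e).mul_bdd (c := M)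
      hφ.continuous.aestronglyMeasurable (Eventually.of_forall hM)
  simp only [sub_mul, inner_sub_left]
  rw [integral_sub (i1 v hv.1) (i1 w hw.1), integral_sub (i2 G hv.2.1) (i2 F hw.2.1),
    hv.2.2 φ hφ hc hs e, hw.2.2 φ hφ hc hs e]
  ring

/-- `U` is of class `C²` and constant outside a compact subset of `Ω`; such functions satisfy the
homogeneous Neumann condition in every sense. -/
structure IsInteriorC2 (Ω : Set (Space n)) (U : Space n → ℝ) : Prop where
  contDiff : ContDiff ℝ 2 U
  exists_const : ∃ c, HasCompactSupport (fun x => U x - c) ∧ tsupport (fun x => U x - c) ⊆ Ω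

lemma IsInteriorC2.add {Ω : Set (Space n)} {U V : Space n → ℝ} (hU : IsInteriorC2 Ω U)
    (hV : IsInteriorC2 Ω V) : IsInteriorC2 Ω (fun x => U x + V x) := by
  obtain ⟨c, hc, hs⟩ := hU.exists_const
  obtain ⟨d, hd, hs'⟩ := hV.exists_const
  have he : (fun x => U x + V x - (c + d)) = fun x => (U x - c) + (V x - d) := by ext x; ring
  refine ⟨hU.contDiff.add hV.contDiff, c + d, ?_, ?_⟩
  · rw [he]; exact hc.add hd
  · rw [he]; exact (tsupport_add _ _).trans (union_subset hs hs')

lemma IsInteriorC2.const_mul {Ω : Set (Space n)} {U : Space n → ℝ} (hU : IsInteriorC2 Ω U)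
    (a : ℝ) : IsInteriorC2 Ω (fun x => a * U x) := by
  obtain ⟨c, hc, hs⟩ := hU.exists_const
  have he : (fun x => a * U x - a * c) = fun x => a * (U x - c) := by ext x; ring
  refine ⟨contDiff_const.mul hU.contDiff, a * c, ?_, ?_⟩
  · rw [he]; exact hc.mul_left
  · rw [he]; exact (tsupport_mul_subset_right).trans hs

lemma isInteriorC2_const (Ω : Set (Space n)) (c : ℝ) : IsInteriorC2 Ω (fun _ => c) :=
  ⟨contDiff_const, c, by simp only [sub_self]; exact HasCompactSupport.zero, by simp⟩

lemma gradient_sub_const (U : Space n → ℝ) (c : ℝ) : gradient (fun x => U x - c) = gradient U := by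
  ext1 x; simp only [gradient, fderiv_sub_const]

lemma laplacian_sub_const (U : Space n → ℝ) (c : ℝ) : (Δ fun x => U x - c) = Δ U := by
  ext x
  have : fderiv ℝ (fun x => U x - c) = fderiv ℝ U := by ext1 y; exact fderiv_sub_const c
  rw [laplacian_eq_sum, laplacian_eq_sum, this]

lemma IsInteriorC2.exists_bound {Ω : Set (Space n)} {U : Space n → ℝ} (hU : IsInteriorC2 Ω U) :
    ∃ C, (∀ x, |U x| ≤ C) ∧ (∀ x, ‖gradient U x‖ ≤ C) ∧ ∀ x, |(Δ U) x| ≤ C := by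
  obtain ⟨c, hc, hs⟩ := hU.exists_const
  have hψ : ContDiff ℝ 2 fun x => U x - c := hU.contDiff.sub contDiff_const
  obtain ⟨C₀, h₀⟩ := hψ.continuous.bounded_above_of_compact_support hc
  have hg : HasCompactSupport (gradient fun x => U x - c) := by
    refine (hc.fderiv ℝ).mono ?_
    intro y hy; contrapose! hy
    simp only [Function.mem_support, not_not] at hy ⊢; simp [gradient, hy]
  obtain ⟨C₁, h₁⟩ := (continuous_gradient (hψ.of_le (by norm_num))).bounded_above_of_compact_support
    hg
  have hL : Continuous (Δ fun x => U x - c) := by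
    have : (Δ fun x => U x - c) = fun x => ∑ i, fderiv ℝ (fderiv ℝ fun x => U x - c) x
      (EuclideanSpace.single i 1) (EuclideanSpace.single i 1) := by
      ext x; exact laplacian_eq_sum _ x
    rw [this]
    refine continuous_finsetSum _ fun i _ => ?_
    exact (((hψ.fderiv_right (m := 1) (by norm_num)).continuous_fderiv one_ne_zero).clm_apply
        continuous_const).clm_apply continuous_const
  have hLc : HasCompactSupport (Δ fun x => U x - c) := by
    refine ((hc.fderiv ℝ).fderiv ℝ).mono ?_
    intro y hy; contrapose! hy
    simp only [Function.mem_support, not_not] at hy ⊢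
    rw [laplacian_eq_sum, hy]; simp
  obtain ⟨C₂, h₂⟩ := hL.bounded_above_of_compact_support hLc
  rw [gradient_sub_const] at h₁
  rw [laplacian_sub_const] at h₂
  refine ⟨max (C₀ + |c|) (max C₁ C₂), fun x => ?_, fun x => ?_, fun x => ?_⟩
  · refine le_trans ?_ (le_max_left _ _)
    have := abs_add_le (U x - c) c
    have h3 := h₀ x
    rw [Real.norm_eq_abs] at h3
    rw [sub_add_cancel] at this; linarith
  · exact (h₁ x).trans ((le_max_left _ _).trans (le_max_right _ _))
  · exact (h₂ x).trans ((le_max_right _ _).trans (le_max_right _ _))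

lemma IsInteriorC2.continuous_laplacian {Ω : Set (Space n)} {U : Space n → ℝ}
    (hU : IsInteriorC2 Ω U) : Continuous (Δ U) := by
  have : (Δ U) = fun x => ∑ i, fderiv ℝ (fderiv ℝ U) x
      (EuclideanSpace.single i 1) (EuclideanSpace.single i 1) := by
    ext x; exact laplacian_eq_sum _ x
  rw [this]
  refine continuous_finsetSum _ fun i _ => ?_
  exact (((hU.contDiff.fderiv_right (m := 1) (by norm_num)).continuous_fderiv
    one_ne_zero).clm_apply continuous_const).clm_apply continuous_const

lemma IsInteriorC2.isSobolev {Ω : Set (Space n)} (hΩ' : volume Ω ≠ ⊤)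
    {U : Space n → ℝ} (hU : IsInteriorC2 Ω U) : IsSobolev Ω U (gradient U) := by
  have : IsFiniteMeasure (volume.restrict Ω) := ⟨by simpa using hΩ'.lt_top⟩
  obtain ⟨C, h0, h1, -⟩ := hU.exists_bound
  exact ⟨MemLp.of_bound hU.contDiff.continuous.aestronglyMeasurable C (Eventually.of_forall h0),
    MemLp.of_bound (continuous_gradient (hU.contDiff.of_le (by norm_num))).aestronglyMeasurable C
      (Eventually.of_forall h1),
    hasWeakGradient_gradient (hU.contDiff.of_le (by norm_num))⟩

lemma exists_bound_smoothTransition_deriv : ∃ C, ∀ t, |deriv Real.smoothTransition t| ≤ C := by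
  have hc : HasCompactSupport (deriv Real.smoothTransition) := by
    refine HasCompactSupport.intro (isCompact_Icc (a := (0 : ℝ)) (b := 1)) fun t ht => ?_
    rw [mem_Icc, not_and_or, not_le, not_le] at ht
    rcases ht with ht | ht
    · have : Real.smoothTransition =ᶠ[𝓝 t] fun _ => 0 := by
        filter_upwards [Iio_mem_nhds ht] with s hs
        exact Real.smoothTransition.zero_of_nonpos (le_of_lt hs)
      rw [this.deriv_eq]; simp
    · have : Real.smoothTransition =ᶠ[𝓝 t] fun _ => 1 := by
        filter_upwards [Ioi_mem_nhds ht] with s hs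
        exact Real.smoothTransition.one_of_one_le (le_of_lt hs)
      rw [this.deriv_eq]; simp
  obtain ⟨C, hC⟩ := (Real.smoothTransition.contDiff (n := 1)).continuous_deriv
    le_rfl |>.bounded_above_of_compact_support hc
  exact ⟨C, hC⟩

/-- Weak maximum principle: a `C²` supersolution with Neumann boundary condition lies above the
weak solution. The equation is tested with `β (v - U)` for a smooth approximation `β` of the
Heaviside function. -/
theorem IsNeumannSolution.le_of_supersolution {Ω : Set (Space n)} (hΩ : IsOpen Ω)
    (hΩ' : volume Ω ≠ ⊤) {ε : ℝ} {u v : Space n → ℝ} (hv : IsNeumannSolution Ω ε u v)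
    (hu : MemLp u 2 (volume.restrict Ω)) {U : Space n → ℝ} (hU : IsInteriorC2 Ω U)
    (hle : ∀ᵐ x ∂(volume.restrict Ω), u x ≤ -ε ^ 2 * (Δ U) x + U x) :
    ∀ᵐ x ∂(volume.restrict Ω), v x ≤ U x := by
  have : IsFiniteMeasure (volume.restrict Ω) := ⟨by simpa using hΩ'.lt_top⟩
  obtain ⟨G, hvG, heq⟩ := hv
  have hUs := hU.isSobolev hΩ'
  have hh := hvG.sub hΩ' hUs
  obtain ⟨C, hC⟩ := exists_bound_smoothTransition_deriv
  set β := Real.smoothTransition with hβ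
  have hβ0 : ∀ t, 0 ≤ β t := Real.smoothTransition.nonneg
  have hβ1 : ∀ t, β t ≤ 1 := Real.smoothTransition.le_one
  have hβs : ContDiff ℝ ∞ β := Real.smoothTransition.contDiff
  have hβm : Monotone β := Real.smoothTransition.monotone
  have hβ' : Continuous (deriv β) := hβs.continuous_deriv (by simp)
  have hβd : ∀ t, 0 ≤ deriv β t := fun t => hβm.deriv_nonneg
  set h : Space n → ℝ := fun x => v x - U x with hhdef
  set H : Space n → Space n := fun x => G x - gradient U x with hHdef
  set φ : Space n → ℝ := fun x => β (h x) with hφ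
  set Φ : Space n → Space n := fun x => deriv β (h x) • H x with hΦ
  have hφm : AEStronglyMeasurable φ (volume.restrict Ω) :=
    hβs.continuous.comp_aestronglyMeasurable hh.1.aestronglyMeasurable
  have hφb : ∀ x, ‖φ x‖ ≤ 1 := fun x => by
    rw [Real.norm_eq_abs, abs_of_nonneg (hβ0 _)]; exact hβ1 _
  have hβhm : AEStronglyMeasurable (fun x => deriv β (h x)) (volume.restrict Ω) :=
    hβ'.comp_aestronglyMeasurable hh.1.aestronglyMeasurable
  have hφL : MemLp φ 2 (volume.restrict Ω) := MemLp.of_bound hφm 1 (Eventually.of_forall hφb)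
  have hΦL : MemLp Φ 2 (volume.restrict Ω) := by
    refine MemLp.of_le_mul (c := C) hh.2.1 (hβhm.smul hh.2.1.aestronglyMeasurable) ?_
    refine Eventually.of_forall fun x => ?_
    rw [hΦ, norm_smul]
    exact mul_le_mul_of_nonneg_right (hC _) (norm_nonneg _)
  have hi : ∀ {f : Space n → ℝ}, MemLp f 2 (volume.restrict Ω) → IntegrableOn f Ω :=
    fun hf => hf.integrable (by norm_num)
  have hi' : ∀ {f : Space n → Space n}, MemLp f 2 (volume.restrict Ω) → IntegrableOn f Ω :=
    fun hf => hf.integrable (by norm_num)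
  have hS : IsSobolev Ω φ Φ := by
    refine ⟨hφL, hΦL, ?_⟩
    refine hh.2.2.comp_smooth hΩ (hi hh.1) (hi' hh.2.1) hβs (C := max 1 C) (fun t => ?_)
      (fun t => (hC t).trans (le_max_right _ _))
    rw [abs_of_nonneg (hβ0 _)]; exact (hβ1 _).trans (le_max_left _ _)
  have e1 := heq φ Φ hS
  obtain ⟨c, hc, hs⟩ := hU.exists_const
  have e2 := hS.2.2.integral_inner_gradient hΩ (hi hφL) (hi' hΦL)
    (hU.contDiff.sub contDiff_const) hc hs
  rw [gradient_sub_const, laplacian_sub_const] at e2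
  obtain ⟨M, hM0, hM1, hM2⟩ := hU.exists_bound
  have hmulφ : ∀ {f : Space n → ℝ}, IntegrableOn f Ω → IntegrableOn (fun x => f x * φ x) Ω :=
    fun hf => Integrable.mul_bdd (c := 1) hf hφm (Eventually.of_forall hφb)
  have hUi : IntegrableOn U Ω := hi hUs.1
  have hLi : IntegrableOn (Δ U) Ω :=
    hi (MemLp.of_bound hU.continuous_laplacian.aestronglyMeasurable M (Eventually.of_forall hM2))
  have hin : ∀ {F : Space n → Space n}, MemLp F 2 (volume.restrict Ω) →
      IntegrableOn (fun x => ⟪F x, Φ x⟫_ℝ) Ω := fun hF =>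
    (hF.norm.integrable_mul hΦL.norm).mono (hF.1.inner hΦL.1) (Eventually.of_forall fun x => by
      simpa using norm_inner_le_norm (𝕜 := ℝ) _ _)
  -- the difference of the weak equations for `v` and for `U`, tested with `φ = β (v - U)`
  have e3 : ε ^ 2 * (∫ x in Ω, ⟪H x, Φ x⟫_ℝ) + ∫ x in Ω, h x * φ x
      = ∫ x in Ω, (u x - (-ε ^ 2 * (Δ U) x + U x)) * φ x := by
    have a1 : ∫ x in Ω, ⟪H x, Φ x⟫_ℝ
        = (∫ x in Ω, ⟪G x, Φ x⟫_ℝ) - ∫ x in Ω, ⟪gradient U x, Φ x⟫_ℝ := by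
      rw [← integral_sub (hin hvG.2.1) (hin hUs.2.1)]
      simp only [hHdef, inner_sub_left]
    have a2 : ∫ x in Ω, h x * φ x = (∫ x in Ω, v x * φ x) - ∫ x in Ω, U x * φ x := by
      rw [← integral_sub (hmulφ (hi hvG.1)) (hmulφ hUi)]
      simp only [hhdef, sub_mul]
    have a3 : ∫ x in Ω, (u x - (-ε ^ 2 * (Δ U) x + U x)) * φ x
        = (∫ x in Ω, u x * φ x) + ε ^ 2 * (∫ x in Ω, (Δ U) x * φ x) - ∫ x in Ω, U x * φ x := by
      have i1 : IntegrableOn (fun x => u x * φ x) Ω := hmulφ (hi hu)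
      have i2 : IntegrableOn (fun x => ε ^ 2 * ((Δ U) x * φ x)) Ω := (hmulφ hLi).const_mul _
      have i3 : IntegrableOn (fun x => u x * φ x + ε ^ 2 * ((Δ U) x * φ x)) Ω := i1.add i2
      rw [← integral_const_mul, ← integral_add i1 i2, ← integral_sub i3 (hmulφ hUi)]
      congr 1; ext x; ring
    rw [a1, a2, a3, ← e1, e2]; ring
  have hR : ∫ x in Ω, (u x - (-ε ^ 2 * (Δ U) x + U x)) * φ x ≤ 0 := by
    refine integral_nonpos_of_ae ?_
    filter_upwards [hle] with x hx
    exact mul_nonpos_of_nonpos_of_nonneg (by linarith) (hβ0 _)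
  have hE : 0 ≤ ∫ x in Ω, ⟪H x, Φ x⟫_ℝ := by
    refine integral_nonneg fun x => ?_
    simp only [hΦ, real_inner_smul_right, Pi.zero_apply]
    exact mul_nonneg (hβd _) real_inner_self_nonneg
  have hnn : ∀ x, 0 ≤ h x * φ x := by
    intro x
    rcases le_total (h x) 0 with hx | hx
    · have : φ x = 0 := Real.smoothTransition.zero_of_nonpos hx
      simp [this]
    · exact mul_nonneg hx (hβ0 _)
  have hz : ∫ x in Ω, h x * φ x = 0 := by
    refine le_antisymm ?_ (integral_nonneg hnn)
    nlinarith [mul_nonneg (sq_nonneg ε) hE]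
  -- `β` is positive on the positive half-line, so `v - U` cannot be positive
  rw [integral_eq_zero_iff_of_nonneg hnn (hmulφ (hi hh.1))] at hz
  filter_upwards [hz] with x hx
  by_contra! hlt
  have h1 : 0 < h x := sub_pos.2 hlt
  have h2 : 0 < φ x := Real.smoothTransition.pos_of_pos h1
  have h3 : h x * φ x = 0 := hx
  exact (mul_pos h1 h2).ne' h3

lemma IsNeumannSolution.neg {Ω : Set (Space n)} {ε : ℝ} {u v : Space n → ℝ}
    (hv : IsNeumannSolution Ω ε u v) :
    IsNeumannSolution Ω ε (fun x => - u x) (fun x => - v x) := by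
  obtain ⟨G, hG, h⟩ := hv
  refine ⟨fun x => - G x, ⟨hG.1.neg, hG.2.1.neg, ?_⟩, ?_⟩
  · intro φ hφ hc hs e
    have := hG.2.2 φ hφ hc hs e
    simp only [neg_mul, inner_neg_left, integral_neg, this]
  · intro φ Φ hφ
    have := h φ Φ hφ
    simp only [neg_mul, inner_neg_left, integral_neg]
    linarith

/-- Comparison: if `A` solves the equation up to an error controlled by a supersolution `B`, then
`A` approximates the weak solution up to `B`. -/
theorem IsNeumannSolution.abs_sub_le {Ω : Set (Space n)} (hΩ : IsOpen Ω)
    (hΩ' : volume Ω ≠ ⊤) {ε : ℝ} {u v : Space n → ℝ} (hv : IsNeumannSolution Ω ε u v)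
    (hu : MemLp u 2 (volume.restrict Ω)) {A B : Space n → ℝ} (hA : IsInteriorC2 Ω A)
    (hB : IsInteriorC2 Ω B)
    (hle : ∀ᵐ x ∂(volume.restrict Ω),
      |u x - (-ε ^ 2 * (Δ A) x + A x)| ≤ -ε ^ 2 * (Δ B) x + B x) :
    ∀ᵐ x ∂(volume.restrict Ω), |v x - A x| ≤ B x := by
  have hneg := hA.const_mul (-1)
  have l1 : ∀ x, (Δ fun y => A y + B y) x = (Δ A) x + (Δ B) x := fun x =>
    hA.contDiff.contDiffAt.laplacian_add hB.contDiff.contDiffAt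
  have l2 : ∀ x, (Δ fun y => -1 * A y) x = - (Δ A) x := fun x => by
    have : (Δ ((-1 : ℝ) • A)) x = (-1 : ℝ) • (Δ A) x :=
      InnerProductSpace.laplacian_smul (-1 : ℝ) hA.contDiff.contDiffAt
    rw [smul_eq_mul, neg_one_mul] at this
    exact this
  have l3 : ∀ x, (Δ fun y => -1 * A y + B y) x = - (Δ A) x + (Δ B) x := fun x => by
    rw [← l2]; exact hneg.contDiff.contDiffAt.laplacian_add hB.contDiff.contDiffAt
  have h1 := hv.le_of_supersolution hΩ hΩ' hu (hA.add hB) (by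
    filter_upwards [hle] with x hx
    rw [l1]; have := (abs_le.1 hx).2; linarith)
  have h2 := hv.neg.le_of_supersolution hΩ hΩ' hu.neg (hneg.add hB) (by
    filter_upwards [hle] with x hx
    rw [l3]; have := (abs_le.1 hx).1; linarith)
  filter_upwards [h1, h2] with x hx1 hx2
  rw [abs_le]; constructor <;> linarith

section vectorValued

variable {V : Type*} [NormedAddCommGroup V] [NormedSpace ℝ V]

/-! ### Convolution with exponentially decaying kernels on the line -/

/-- The Green function `J(t) = e^{-|t|} / 2` of `1 - ∂²` on the line. -/
noncomputable def kerJ (t : ℝ) : ℝ := 1 / 2 * Real.exp (-|t|)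

/-- The derivative of `kerJ`. -/
noncomputable def kerJ' (t : ℝ) : ℝ := -(1 / 2) * SignType.sign t * Real.exp (-|t|)

/-- Kernels dominated by `e^{-|t|}` with a possible jump at the origin. -/
structure IsKernel (κ : ℝ → ℝ) : Prop where
  measurable : Measurable κ
  abs_le : ∀ t, |κ t| ≤ Real.exp (-|t|)
  continuousAt : ∀ t, t ≠ 0 → ContinuousAt κ t

/-- The convolution `κ ∗ f`. -/
noncomputable def cv (κ : ℝ → ℝ) (f : ℝ → V) (z : ℝ) : V := ∫ ζ, κ (z - ζ) • f ζ

lemma isKernel_kerJ : IsKernel kerJ := by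
  have hc : Continuous kerJ := by unfold kerJ; fun_prop
  refine ⟨hc.measurable, fun t => ?_, fun t _ => hc.continuousAt⟩
  unfold kerJ
  rw [abs_of_nonneg (by positivity)]
  linarith [Real.exp_pos (-|t|)]

lemma kerJ'_of_pos {t : ℝ} (ht : 0 < t) : kerJ' t = -(1 / 2) * Real.exp (-t) := by
  simp [kerJ', sign_pos ht, abs_of_pos ht]

lemma kerJ'_of_neg {t : ℝ} (ht : t < 0) : kerJ' t = 1 / 2 * Real.exp t := by
  simp [kerJ', sign_neg ht, abs_of_neg ht]

lemma isKernel_kerJ' : IsKernel kerJ' := by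
  refine ⟨?_, fun t => ?_, fun t ht => ?_⟩
  · have : kerJ' = fun t => if 0 < t then -(1 / 2) * Real.exp (-t)
        else if t < 0 then 1 / 2 * Real.exp t else 0 := by
      ext t
      rcases lt_trichotomy t 0 with h | h | h
      · rw [kerJ'_of_neg h, if_neg h.not_gt, if_pos h]
      · simp [h, kerJ']
      · rw [kerJ'_of_pos h, if_pos h]
    rw [this]
    refine Measurable.ite measurableSet_Ioi (by fun_prop)
      (Measurable.ite measurableSet_Iio (by fun_prop) (by fun_prop))
  · have he := Real.exp_pos (-|t|)
    rcases lt_trichotomy t 0 with h | h | h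
    · rw [kerJ'_of_neg h, abs_of_neg h, neg_neg, abs_of_nonneg (by positivity)]
      linarith [Real.exp_pos t]
    · simp [h, kerJ']
    · rw [kerJ'_of_pos h, abs_of_pos h, abs_of_nonpos (by linarith [Real.exp_pos (-t)])]
      linarith [Real.exp_pos (-t)]
  · rcases ht.lt_or_gt with h | h
    · have : kerJ' =ᶠ[𝓝 t] fun s => 1 / 2 * Real.exp s := by
        filter_upwards [Iio_mem_nhds h] with s hs using kerJ'_of_neg hs
      exact (ContinuousAt.congr (by fun_prop) this.symm)
    · have : kerJ' =ᶠ[𝓝 t] fun s => -(1 / 2) * Real.exp (-s) := by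
        filter_upwards [Ioi_mem_nhds h] with s hs using kerJ'_of_pos hs
      exact (ContinuousAt.congr (by fun_prop) this.symm)

lemma hasDerivAt_kerJ {t : ℝ} (ht : t ≠ 0) : HasDerivAt kerJ (kerJ' t) t := by
  rcases ht.lt_or_gt with h | h
  · have : kerJ =ᶠ[𝓝 t] fun s => 1 / 2 * Real.exp s := by
      filter_upwards [Iio_mem_nhds h] with s hs
      simp [kerJ, abs_of_neg (show s < 0 from hs)]
    rw [kerJ'_of_neg h]
    exact ((Real.hasDerivAt_exp t).const_mul _).congr_of_eventuallyEq this
  · have : kerJ =ᶠ[𝓝 t] fun s => 1 / 2 * Real.exp (-s) := by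
      filter_upwards [Ioi_mem_nhds h] with s hs
      simp [kerJ, abs_of_pos (show 0 < s from hs)]
    rw [kerJ'_of_pos h]
    have h2 := ((hasDerivAt_neg t).exp.const_mul (1 / 2 : ℝ)).congr_of_eventuallyEq this
    refine h2.congr_deriv ?_
    ring

lemma integrable_exp_neg_abs {a : ℝ} (ha : 0 < a) :
    Integrable fun t : ℝ => Real.exp (-(a * |t|)) := by
  have h1 : IntegrableOn (fun t : ℝ => Real.exp (-(a * |t|))) (Ioi 0) :=
    (integrableOn_exp_mul_Ioi (neg_lt_zero.2 ha) 0).congr_fun (fun t ht => by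
      simp only [abs_of_pos (show 0 < t from ht), neg_mul]) measurableSet_Ioi
  have h2 : IntegrableOn (fun t : ℝ => Real.exp (-(a * |t|))) (Iic 0) :=
    (integrableOn_exp_mul_Iic ha 0).congr_fun (fun t ht => by
      simp only [abs_of_nonpos (show t ≤ 0 from ht), mul_neg, neg_neg]) measurableSet_Iic
  rw [← integrableOn_univ, ← Iic_union_Ioi (a := (0 : ℝ))]
  exact h2.union h1

lemma exp_weight_le (r z ζ : ℝ) : Real.exp (-|z - ζ|) * Real.exp (-(r * |ζ|)) ≤
    Real.exp (-(r * |z|)) * Real.exp (-((1 - |r|) * |z - ζ|)) := by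
  rw [← Real.exp_add, ← Real.exp_add, Real.exp_le_exp]
  have h1 : r * (|z| - |ζ|) ≤ |r| * |z - ζ| := by
    refine (le_abs_self _).trans ?_
    rw [abs_mul]
    exact mul_le_mul_of_nonneg_left (abs_abs_sub_abs_le_abs_sub z ζ) (abs_nonneg _)
  nlinarith

/-- The constant in the weighted estimate for the convolution. -/
noncomputable def cvConst (r : ℝ) : ℝ := ∫ t : ℝ, Real.exp (-((1 - |r|) * |t|))

lemma integrable_weight {r : ℝ} (hr : |r| < 1) (z : ℝ) :
    Integrable fun ζ : ℝ => Real.exp (-|z - ζ|) * Real.exp (-(r * |ζ|)) := by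
  have h := ((integrable_exp_neg_abs (sub_pos.2 hr)).comp_sub_left z).const_mul
    (Real.exp (-(r * |z|)))
  refine h.mono' (by fun_prop) (Eventually.of_forall fun ζ => ?_)
  rw [Real.norm_eq_abs, abs_of_nonneg (by positivity)]
  exact exp_weight_le r z ζ

lemma IsKernel.aestronglyMeasurable_smul {κ : ℝ → ℝ} (hκ : IsKernel κ) {f : ℝ → V}
    (hf : AEStronglyMeasurable f) (z : ℝ) :
    AEStronglyMeasurable fun ζ => κ (z - ζ) • f ζ :=
  (hκ.measurable.comp (measurable_const.sub measurable_id)).aestronglyMeasurable.smul hf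

lemma IsKernel.integrable_smul {κ : ℝ → ℝ} (hκ : IsKernel κ) {f : ℝ → V}
    (hf : AEStronglyMeasurable f) {C r : ℝ} (hr : |r| < 1)
    (hC : ∀ᵐ ζ, ‖f ζ‖ ≤ C * Real.exp (-(r * |ζ|))) (z : ℝ) :
    Integrable fun ζ => κ (z - ζ) • f ζ := by
  refine ((integrable_weight hr z).const_mul C).mono' (hκ.aestronglyMeasurable_smul hf z) ?_
  filter_upwards [hC] with ζ h
  rw [norm_smul, Real.norm_eq_abs]
  calc |κ (z - ζ)| * ‖f ζ‖ ≤ Real.exp (-|z - ζ|) * (C * Real.exp (-(r * |ζ|))) :=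
        mul_le_mul (hκ.abs_le _) h (norm_nonneg _) (Real.exp_pos _).le
    _ = _ := by ring

/-- Convolution preserves every exponential rate `r` with `|r| < 1`, also growing ones. -/
lemma IsKernel.norm_cv_le {κ : ℝ → ℝ} (hκ : IsKernel κ) {f : ℝ → V} {C r : ℝ} (hr : |r| < 1)
    (hC : ∀ᵐ ζ, ‖f ζ‖ ≤ C * Real.exp (-(r * |ζ|))) (z : ℝ) :
    ‖cv κ f z‖ ≤ C * cvConst r * Real.exp (-(r * |z|)) := by
  have hC0 : 0 ≤ C := by
    obtain ⟨ζ, h⟩ := hC.exists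
    exact nonneg_of_mul_nonneg_left ((norm_nonneg _).trans h) (Real.exp_pos _)
  have h := ((integrable_exp_neg_abs (sub_pos.2 hr)).comp_sub_left z).const_mul
    (C * Real.exp (-(r * |z|)))
  refine (norm_integral_le_of_norm_le h ?_).trans (le_of_eq ?_)
  · filter_upwards [hC] with ζ h
    rw [norm_smul, Real.norm_eq_abs]
    calc |κ (z - ζ)| * ‖f ζ‖ ≤ Real.exp (-|z - ζ|) * (C * Real.exp (-(r * |ζ|))) :=
          mul_le_mul (hκ.abs_le _) h (norm_nonneg _) (Real.exp_pos _).le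
      _ = C * (Real.exp (-|z - ζ|) * Real.exp (-(r * |ζ|))) := by ring
      _ ≤ C * (Real.exp (-(r * |z|)) * Real.exp (-((1 - |r|) * |z - ζ|))) :=
          mul_le_mul_of_nonneg_left (exp_weight_le r z ζ) hC0
      _ = _ := by ring
  · rw [integral_const_mul, integral_sub_left_eq_self (fun t => Real.exp (-((1 - |r|) * |t|)))]
    rw [cvConst]; ring

lemma exp_neg_abs_le_of_near {z z₀ ζ : ℝ} (h : |z - z₀| ≤ 1) :
    Real.exp (-|z - ζ|) ≤ Real.exp 1 * Real.exp (-|z₀ - ζ|) := by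
  rw [← Real.exp_add, Real.exp_le_exp]
  have := abs_add_le (z₀ - z) (z - ζ)
  rw [abs_sub_comm z₀ z] at this
  have e : z₀ - z + (z - ζ) = z₀ - ζ := by ring
  rw [e] at this; linarith

/-- Joint continuity of a convolution that depends on a parameter. -/
lemma IsKernel.continuousOn_cv {κ : ℝ → ℝ} (hκ : IsKernel κ)
    {S : Set (Space n)} (hS : IsOpen S) {f : ℝ → Space n → V}
    (hm : ∀ x ∈ S, AEStronglyMeasurable fun ζ => f ζ x)
    (hc : ∀ᵐ ζ, ContinuousOn (f ζ) S) {C r : ℝ} (hr : |r| < 1)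
    (hC : ∀ᵐ ζ, ∀ x ∈ S, ‖f ζ x‖ ≤ C * Real.exp (-(r * |ζ|))) :
    ContinuousOn (fun q : ℝ × Space n => cv κ (fun ζ => f ζ q.2) q.1) (univ ×ˢ S) := by
  rintro ⟨z₀, x₀⟩ ⟨-, hx₀⟩
  refine ContinuousAt.continuousWithinAt ?_
  have hnear : ∀ᶠ q : ℝ × Space n in 𝓝 (z₀, x₀), |q.1 - z₀| ≤ 1 ∧ q.2 ∈ S := by
    filter_upwards [prod_mem_nhds (closedBall_mem_nhds z₀ one_pos) (hS.mem_nhds hx₀)] with q hq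
    exact ⟨by simpa [Real.dist_eq] using hq.1, hq.2⟩
  refine continuousAt_of_dominated
    (bound := fun ζ => Real.exp 1 * C * (Real.exp (-|z₀ - ζ|) * Real.exp (-(r * |ζ|)))) ?_ ?_ ?_ ?_
  · filter_upwards [hnear] with q hq
    exact hκ.aestronglyMeasurable_smul (hm _ hq.2) _
  · filter_upwards [hnear] with q hq
    filter_upwards [hC] with ζ hζ
    rw [norm_smul, Real.norm_eq_abs]
    calc |κ (q.1 - ζ)| * ‖f ζ q.2‖
        ≤ (Real.exp 1 * Real.exp (-|z₀ - ζ|)) * (C * Real.exp (-(r * |ζ|))) :=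
          mul_le_mul ((hκ.abs_le _).trans (exp_neg_abs_le_of_near hq.1)) (hζ _ hq.2)
            (norm_nonneg _) (by positivity)
      _ = _ := by ring
  · exact (integrable_weight hr z₀).const_mul _
  · have hne : ∀ᵐ ζ : ℝ, ζ ≠ z₀ := by
      simp [ae_iff]
    filter_upwards [hc, hne] with ζ hζ hne
    have h1 : ContinuousAt (fun q : ℝ × Space n => κ (q.1 - ζ)) (z₀, x₀) :=
      ContinuousAt.comp (g := κ) (hκ.continuousAt _ (sub_ne_zero.2 hne.symm))
        (continuousAt_fst.sub continuousAt_const)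
    have h2 : ContinuousAt (fun q : ℝ × Space n => f ζ q.2) (z₀, x₀) :=
      ContinuousAt.comp (g := f ζ) (hζ.continuousAt (hS.mem_nhds hx₀)) continuousAt_snd
    exact h1.smul h2

/-- Differentiation of a convolution with respect to a parameter. -/
lemma IsKernel.hasFDerivAt_cv {κ : ℝ → ℝ} (hκ : IsKernel κ)
    {S : Set (Space n)} (hS : IsOpen S) {f : ℝ → Space n → V}
    {f' : ℝ → Space n → Space n →L[ℝ] V}
    (hm : ∀ x ∈ S, AEStronglyMeasurable fun ζ => f ζ x)
    (hm' : ∀ x ∈ S, AEStronglyMeasurable fun ζ => f' ζ x)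
    (hd : ∀ᵐ ζ, ∀ x ∈ S, HasFDerivAt (f ζ) (f' ζ x) x) {C r : ℝ} (hr : |r| < 1)
    (hC : ∀ᵐ ζ, ∀ x ∈ S, ‖f ζ x‖ ≤ C * Real.exp (-(r * |ζ|))) {C' r' : ℝ} (hr' : |r'| < 1)
    (hC' : ∀ᵐ ζ, ∀ x ∈ S, ‖f' ζ x‖ ≤ C' * Real.exp (-(r' * |ζ|)))
    (z : ℝ) {x : Space n} (hx : x ∈ S) :
    HasFDerivAt (fun x => cv κ (fun ζ => f ζ x) z) (cv κ (fun ζ => f' ζ x) z) x := by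
  refine hasFDerivAt_integral_of_dominated_of_fderiv_le (hS.mem_nhds hx)
    (bound := fun ζ => C' * (Real.exp (-|z - ζ|) * Real.exp (-(r' * |ζ|))))
    (F := fun x ζ => κ (z - ζ) • f ζ x) (F' := fun x ζ => κ (z - ζ) • f' ζ x) ?_ ?_ ?_ ?_ ?_ ?_
  · filter_upwards [hS.mem_nhds hx] with y hy
    exact hκ.aestronglyMeasurable_smul (hm _ hy) _
  · exact hκ.integrable_smul (hm x hx) hr (hC.mono fun ζ h => h x hx) z
  · exact hκ.aestronglyMeasurable_smul (hm' x hx) _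
  · filter_upwards [hC'] with ζ hζ y hy
    rw [norm_smul, Real.norm_eq_abs]
    calc |κ (z - ζ)| * ‖f' ζ y‖ ≤ Real.exp (-|z - ζ|) * (C' * Real.exp (-(r' * |ζ|))) :=
          mul_le_mul (hκ.abs_le _) (hζ y hy) (norm_nonneg _) (Real.exp_pos _).le
      _ = _ := by ring
  · exact (integrable_weight hr' z).const_mul _
  · filter_upwards [hd] with ζ hζ y hy
    exact (hζ y hy).const_smul _

lemma abs_kerJ_sub_le {a b : ℝ} (h : |a - b| ≤ 1) :
    |kerJ a - kerJ b| ≤ Real.exp (-|b|) * |a - b| := by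
  have h1 : |(|b| - |a|)| ≤ |a - b| := by
    rw [abs_sub_comm a b]; exact abs_abs_sub_abs_le_abs_sub b a
  have h2 : kerJ a - kerJ b = 1 / 2 * Real.exp (-|b|) * (Real.exp (|b| - |a|) - 1) := by
    unfold kerJ
    have : Real.exp (-|a|) = Real.exp (-|b|) * Real.exp (|b| - |a|) := by
      rw [← Real.exp_add]; congr 1; ring
    rw [this]; ring
  rw [h2, abs_mul, abs_of_nonneg (by positivity)]
  have h3 := Real.abs_exp_sub_one_le (h1.trans h)
  calc _ ≤ 1 / 2 * Real.exp (-|b|) * (2 * |a - b|) := by gcongr; linarith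
    _ = _ := by ring

/-- `(J ∗ f)' = J' ∗ f`. -/
lemma hasDerivAt_cv_kerJ [CompleteSpace V] {f : ℝ → V} (hf : AEStronglyMeasurable f) {C r : ℝ}
    (hr : |r| < 1) (hC : ∀ᵐ ζ, ‖f ζ‖ ≤ C * Real.exp (-(r * |ζ|))) (z : ℝ) :
    HasDerivAt (cv kerJ f) (cv kerJ' f z) z := by
  refine (hasDerivAt_integral_of_dominated_loc_of_lip (s := ball z (1 / 2))
    (F := fun z ζ => kerJ (z - ζ) • f ζ) (F' := fun ζ => kerJ' (z - ζ) • f ζ)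
    (bound := fun ζ => Real.exp 1 * C * (Real.exp (-|z - ζ|) * Real.exp (-(r * |ζ|))))
    (ball_mem_nhds z (by norm_num)) ?_ ?_ ?_ ?_ ?_ ?_).2
  · exact Eventually.of_forall fun y => isKernel_kerJ.aestronglyMeasurable_smul hf y
  · exact isKernel_kerJ.integrable_smul hf hr hC z
  · exact isKernel_kerJ'.aestronglyMeasurable_smul hf z
  · filter_upwards [hC] with ζ hζ
    refine LipschitzOnWith.of_dist_le_mul fun a ha b hb => ?_
    rw [dist_eq_norm, ← sub_smul, norm_smul, Real.norm_eq_abs]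
    have ha' : |a - z| < 1 / 2 := ha
    have hb' : |b - z| < 1 / 2 := hb
    have hab : |(a - ζ) - (b - ζ)| ≤ 1 := by
      rw [abs_lt] at ha' hb'; rw [abs_le]; constructor <;> linarith
    have h1 := abs_kerJ_sub_le hab
    have h2 := exp_neg_abs_le_of_near (ζ := ζ) (hb'.le.trans (by norm_num : (1 / 2 : ℝ) ≤ 1))
    have h3 : a - ζ - (b - ζ) = a - b := by ring
    rw [h3] at h1
    rw [Real.dist_eq]
    calc |kerJ (a - ζ) - kerJ (b - ζ)| * ‖f ζ‖
        ≤ (Real.exp 1 * Real.exp (-|z - ζ|) * |a - b|) * (C * Real.exp (-(r * |ζ|))) := by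
          refine mul_le_mul (h1.trans ?_) hζ (norm_nonneg _) (by positivity)
          exact mul_le_mul_of_nonneg_right h2 (abs_nonneg _)
      _ = (Real.exp 1 * C * (Real.exp (-|z - ζ|) * Real.exp (-(r * |ζ|)))) * |a - b| := by ring
      _ ≤ _ := mul_le_mul_of_nonneg_right (le_abs_self _) (abs_nonneg _)
  · exact (integrable_weight hr z).const_mul _
  · have hne : ∀ᵐ ζ : ℝ, ζ ≠ z := by simp [ae_iff]
    filter_upwards [hne] with ζ hζ
    have := (hasDerivAt_kerJ (sub_ne_zero.2 hζ.symm)).comp_sub_const z ζ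
    exact this.smul_const (f ζ)

/-- `(J' ∗ f)' = J ∗ f - f`, that is, `J ∗ f` solves `-q'' + q = f`. -/
lemma hasDerivAt_cv_kerJ' {f : ℝ → ℝ} (hf : Continuous f) {C r : ℝ}
    (hr : |r| < 1) (hC : ∀ᵐ ζ, ‖f ζ‖ ≤ C * Real.exp (-(r * |ζ|))) (z : ℝ) :
    HasDerivAt (cv kerJ' f) (cv kerJ f z - f z) z := by
  -- on either side of `z` the kernels factor: `e^{-|z - ζ|} = e^{∓z} e^{±ζ}`
  set a : ℝ → ℝ := fun ζ => Real.exp ζ * f ζ with ha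
  set b : ℝ → ℝ := fun ζ => Real.exp (-ζ) * f ζ with hb
  have hac : Continuous a := by fun_prop
  have hbc : Continuous b := by fun_prop
  have hint : ∀ {κ : ℝ → ℝ}, IsKernel κ → ∀ z, Integrable fun ζ => κ (z - ζ) • f ζ :=
    fun hκ z => hκ.integrable_smul hf.aestronglyMeasurable hr hC z
  have haI : ∀ z, IntegrableOn a (Iic z) := by
    intro z
    have := ((hint isKernel_kerJ z).integrableOn (s := Iic z)).const_mul (2 * Real.exp z)
    refine IntegrableOn.congr_fun this (fun ζ hζ => ?_) measurableSet_Iic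
    have : ζ ≤ z := hζ
    simp only [ha, kerJ, smul_eq_mul, abs_of_nonneg (sub_nonneg.2 this)]
    have e : Real.exp ζ = Real.exp z * Real.exp (-(z - ζ)) := by
      rw [← Real.exp_add]; congr 1; ring
    rw [e]; ring
  have hbI : ∀ z, IntegrableOn b (Ioi z) := by
    intro z
    have := ((hint isKernel_kerJ z).integrableOn (s := Ioi z)).const_mul (2 * Real.exp (-z))
    refine IntegrableOn.congr_fun this (fun ζ hζ => ?_) measurableSet_Ioi
    have : z < ζ := hζ
    simp only [hb, kerJ, smul_eq_mul, abs_of_neg (sub_neg.2 this)]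
    have e : Real.exp (-ζ) = Real.exp (-z) * Real.exp (- -(z - ζ)) := by
      rw [← Real.exp_add]; congr 1; ring
    rw [e]; ring
  set A : ℝ → ℝ := fun z => ∫ ζ in Iic z, a ζ with hA
  set B : ℝ → ℝ := fun z => ∫ ζ in Ioi z, b ζ with hB
  have hAd : HasDerivAt A (a z) z := by
    have e : A = fun y => A z + ∫ ζ in z..y, a ζ := by
      ext y
      have := intervalIntegral.integral_Iic_sub_Iic (haI z) (haI y)
      simp only [hA]; rw [← this]; ring
    rw [e]
    exact (intervalIntegral.integral_hasDerivAt_right (hac.intervalIntegrable _ _)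
      (hac.stronglyMeasurableAtFilter _ _) hac.continuousAt).const_add _
  have hBd : HasDerivAt B (- b z) z := by
    have e : B = fun y => B z - ∫ ζ in z..y, b ζ := by
      ext y
      have := intervalIntegral.integral_Ioi_sub_Ioi' (hbI z) (hbI y)
      simp only [hB]; rw [← this]; ring
    rw [e]
    exact (intervalIntegral.integral_hasDerivAt_right (hbc.intervalIntegrable _ _)
      (hbc.stronglyMeasurableAtFilter _ _) hbc.continuousAt).const_sub _
  have hsplit : ∀ {κ : ℝ → ℝ}, IsKernel κ → ∀ s : ℝ,
      (∀ t, 0 < t → κ t = s * Real.exp (-t)) → (∀ t, t < 0 → κ t = 1 / 2 * Real.exp t) →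
      ∀ z, cv κ f z = s * Real.exp (-z) * A z + 1 / 2 * Real.exp z * B z := by
    intro κ hκ s h1 h2 z
    rw [cv, ← intervalIntegral.integral_Iic_add_Ioi (hint hκ z).integrableOn
      (hint hκ z).integrableOn]
    congr 1
    · simp only [hA]
      rw [← integral_const_mul]
      rw [integral_Iic_eq_integral_Iio, integral_Iic_eq_integral_Iio]
      refine setIntegral_congr_fun measurableSet_Iio fun ζ hζ => ?_
      have : ζ < z := hζ
      simp only [h1 _ (sub_pos.2 this), ha, smul_eq_mul]
      have e : Real.exp (-(z - ζ)) = Real.exp (-z) * Real.exp ζ := by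
        rw [← Real.exp_add]; congr 1; ring
      rw [e]; ring
    · simp only [hB]
      rw [← integral_const_mul]
      refine setIntegral_congr_fun measurableSet_Ioi fun ζ hζ => ?_
      have : z < ζ := hζ
      simp only [h2 _ (sub_neg.2 this), hb, smul_eq_mul]
      have e : Real.exp (z - ζ) = Real.exp z * Real.exp (-ζ) := by
        rw [← Real.exp_add]; congr 1
      rw [e]; ring
  have e1 : cv kerJ' f = fun z => -(1 / 2) * Real.exp (-z) * A z + 1 / 2 * Real.exp z * B z := by
    ext z
    exact hsplit isKernel_kerJ' _ (fun t ht => kerJ'_of_pos ht) (fun t ht => kerJ'_of_neg ht) z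
  have e2 : cv kerJ f z = 1 / 2 * Real.exp (-z) * A z + 1 / 2 * Real.exp z * B z :=
    hsplit isKernel_kerJ _ (fun t ht => by simp [kerJ, abs_of_pos ht])
      (fun t ht => by simp [kerJ, abs_of_neg ht]) z
  rw [e1, e2]
  have d1 : HasDerivAt (fun z => -(1 / 2) * Real.exp (-z) * A z) _ z :=
    (((hasDerivAt_neg z).exp).const_mul (-(1 / 2) : ℝ)).mul hAd
  have d2 : HasDerivAt (fun z => 1 / 2 * Real.exp z * B z) _ z :=
    (((Real.hasDerivAt_exp z)).const_mul (1 / 2 : ℝ)).mul hBd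
  refine (d1.add d2).congr_deriv ?_
  have e3 : Real.exp (-z) * Real.exp z = 1 := by rw [← Real.exp_add]; simp
  simp only [ha, hb]
  linear_combination (-f z) * e3

/-! ### Calculus on products and measurability of derivatives -/

lemma contDiffOn_one_of_hasFDerivAt {X : Type*} [NormedAddCommGroup X] [NormedSpace ℝ X]
    {S : Set X} (hS : IsOpen S) {f : X → V} {f' : X → X →L[ℝ] V}
    (h : ∀ x ∈ S, HasFDerivAt f (f' x) x) (hc : ContinuousOn f' S) : ContDiffOn ℝ 1 f S := by
  rw [show (1 : WithTop ℕ∞) = 0 + 1 from rfl, contDiffOn_succ_iff_fderiv_of_isOpen hS]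
  refine ⟨fun x hx => (h x hx).differentiableAt.differentiableWithinAt, by simp, ?_⟩
  rw [contDiffOn_zero]
  exact hc.congr fun x hx => (h x hx).fderiv

lemma contDiffOn_two_of_hasFDerivAt {X : Type*} [NormedAddCommGroup X] [NormedSpace ℝ X]
    {S : Set X} (hS : IsOpen S) {f : X → V} {f' : X → X →L[ℝ] V}
    (h : ∀ x ∈ S, HasFDerivAt f (f' x) x) (hc : ContDiffOn ℝ 1 f' S) : ContDiffOn ℝ 2 f S := by
  rw [show (2 : WithTop ℕ∞) = 1 + 1 from rfl, contDiffOn_succ_iff_fderiv_of_isOpen hS]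
  refine ⟨fun x hx => (h x hx).differentiableAt.differentiableWithinAt, by simp, ?_⟩
  exact hc.congr fun x hx => (h x hx).fderiv

/-- A function of two variables with continuous partial derivatives is differentiable. -/
lemma hasFDerivAt_of_partials {S : Set (Space n)} (hS : IsOpen S) {f fz : ℝ → Space n → V}
    {fx : ℝ → Space n → Space n →L[ℝ] V}
    (hz : ∀ z, ∀ x ∈ S, HasDerivAt (fun s => f s x) (fz z x) z)
    (hx : ∀ z, ∀ x ∈ S, HasFDerivAt (f z) (fx z x) x)
    (hzc : ContinuousOn (fun q : ℝ × Space n => fz q.1 q.2) (univ ×ˢ S))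
    (hxc : ContinuousOn (fun q : ℝ × Space n => fx q.1 q.2) (univ ×ˢ S))
    (q : ℝ × Space n) (hq : q ∈ (univ : Set ℝ) ×ˢ S) :
    HasFDerivAt (fun q : ℝ × Space n => f q.1 q.2)
      ((toSpanSingletonCLE (𝕜 := ℝ) (E := V) (fz q.1 q.2)).coprod (fx q.1 q.2)) q := by
  have hU : IsOpen ((univ : Set ℝ) ×ˢ S) := isOpen_univ.prod hS
  have hcont : ContinuousOn (fun q : ℝ × Space n =>
      (toSpanSingletonCLE (𝕜 := ℝ) (E := V) (fz q.1 q.2))) (univ ×ˢ S) :=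
    (toSpanSingletonCLE (𝕜 := ℝ) (E := V)).continuous.comp_continuousOn hzc
  refine (hasStrictFDerivAt_uncurry_coprod (f := f) (u := q)
    (f₁ := fun z x => (toSpanSingletonCLE (𝕜 := ℝ) (E := V) (fz z x))) (f₂ := fx) ?_ ?_
    (hcont.continuousAt (hU.mem_nhds hq)) (hxc.continuousAt (hU.mem_nhds hq))).hasFDerivAt
  · filter_upwards [hU.mem_nhds hq] with v hv
    exact (hz v.1 v.2 hv.2).hasFDerivAt
  · filter_upwards [hU.mem_nhds hq] with v hv
    exact hx v.1 v.2 hv.2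

lemma contDiffOn_one_of_partials {S : Set (Space n)} (hS : IsOpen S) {f fz : ℝ → Space n → V}
    {fx : ℝ → Space n → Space n →L[ℝ] V}
    (hz : ∀ z, ∀ x ∈ S, HasDerivAt (fun s => f s x) (fz z x) z)
    (hx : ∀ z, ∀ x ∈ S, HasFDerivAt (f z) (fx z x) x)
    (hzc : ContinuousOn (fun q : ℝ × Space n => fz q.1 q.2) (univ ×ˢ S))
    (hxc : ContinuousOn (fun q : ℝ × Space n => fx q.1 q.2) (univ ×ˢ S)) :
    ContDiffOn ℝ 1 (fun q : ℝ × Space n => f q.1 q.2) (univ ×ˢ S) := by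
  refine contDiffOn_one_of_hasFDerivAt (isOpen_univ.prod hS)
    (hasFDerivAt_of_partials hS hz hx hzc hxc) ?_
  exact ((coprodEquivL (𝕜 := ℝ) (E := ℝ) (F := Space n) (G := V) ℝ).contDiff.comp_contDiffOn
    (((toSpanSingletonCLE (𝕜 := ℝ) (E := V)).contDiff.comp_contDiffOn
      (contDiffOn_zero.2 hzc)).prodMk (contDiffOn_zero.2 hxc))).continuousOn

lemma contDiffOn_two_of_partials {S : Set (Space n)} (hS : IsOpen S) {f fz : ℝ → Space n → V}
    {fx : ℝ → Space n → Space n →L[ℝ] V}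
    (hz : ∀ z, ∀ x ∈ S, HasDerivAt (fun s => f s x) (fz z x) z)
    (hx : ∀ z, ∀ x ∈ S, HasFDerivAt (f z) (fx z x) x)
    (hzc : ContDiffOn ℝ 1 (fun q : ℝ × Space n => fz q.1 q.2) (univ ×ˢ S))
    (hxc : ContDiffOn ℝ 1 (fun q : ℝ × Space n => fx q.1 q.2) (univ ×ˢ S)) :
    ContDiffOn ℝ 2 (fun q : ℝ × Space n => f q.1 q.2) (univ ×ˢ S) := by
  refine contDiffOn_two_of_hasFDerivAt (isOpen_univ.prod hS)
    (hasFDerivAt_of_partials hS hz hx hzc.continuousOn hxc.continuousOn) ?_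
  exact (coprodEquivL (𝕜 := ℝ) (E := ℝ) (F := Space n) (G := V) ℝ).contDiff.comp_contDiffOn
    (((toSpanSingletonCLE (𝕜 := ℝ) (E := V)).contDiff.comp_contDiffOn hzc).prodMk hxc)

/-- Derivatives in a parameter are measurable, as limits of difference quotients. -/
lemma aestronglyMeasurable_fderiv {S : Set (Space n)} (hS : IsOpen S) {F : ℝ → Space n → V}
    (hm : ∀ x ∈ S, AEStronglyMeasurable fun z => F z x)
    (hd : ∀ᵐ z, ∀ x ∈ S, DifferentiableAt ℝ (F z) x) {x : Space n} (hx : x ∈ S) :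
    AEStronglyMeasurable fun z => fderiv ℝ (F z) x := by
  have h1 : ∀ e, AEStronglyMeasurable fun z => fderiv ℝ (F z) x e := by
    intro e
    have hc : Tendsto (fun k : ℕ => ‖((k : ℝ) + 1)‖) atTop atTop := by
      refine tendsto_norm_atTop_atTop.comp ?_
      exact tendsto_atTop_add_const_right _ _ tendsto_natCast_atTop_atTop
    have hlim : Tendsto (fun k : ℕ => x + ((k : ℝ) + 1)⁻¹ • e) atTop (𝓝 x) := by
      have : Tendsto (fun k : ℕ => ((k : ℝ) + 1)⁻¹) atTop (𝓝 0) := by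
        simpa [one_div] using tendsto_one_div_add_atTop_nhds_zero_nat (𝕜 := ℝ)
      simpa using (this.smul_const e).const_add x
    obtain ⟨N, hN⟩ := (eventually_atTop.1 (hlim.eventually (hS.mem_nhds hx)))
    refine aestronglyMeasurable_of_tendsto_ae atTop
      (f := fun (k : ℕ) z => (((k + N : ℕ) : ℝ) + 1) •
        (F z (x + (((k + N : ℕ) : ℝ) + 1)⁻¹ • e) - F z x)) (fun k => ?_) ?_
    · exact ((hm _ (hN _ (by omega))).sub (hm x hx)).const_smul _
    · filter_upwards [hd] with z hz
      exact ((hz x hx).hasFDerivAt.lim e hc).comp (tendsto_add_atTop_nat N)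
  have h2 : (fun z => fderiv ℝ (F z) x) = fun z => ∑ i : Fin n,
      (EuclideanSpace.proj i : Space n →L[ℝ] ℝ).smulRight
        (fderiv ℝ (F z) x (EuclideanSpace.single i 1)) := by
    ext z e
    have he : e = ∑ i : Fin n, e i • EuclideanSpace.single i (1 : ℝ) := by
      simpa using ((EuclideanSpace.basisFun (Fin n) ℝ).sum_repr e).symm
    conv_lhs => rw [he]
    simp
  rw [h2]
  refine Finset.aestronglyMeasurable_fun_sum _ fun i _ => ?_
  exact (ContinuousLinearMap.smulRightL ℝ (Space n) V
    (EuclideanSpace.proj i : Space n →L[ℝ] ℝ)).continuous.comp_aestronglyMeasurable (h1 _)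

/-! ### Profiles -/

/-- Source terms: functions of class `C²` in `x` for almost every `z`, whose value, gradient and
Laplacian, and full second derivative decay with rates `a`, `b` and `c`. The rate `c` may be
negative, and the Laplacian is treated apart since it may decay faster than the second
derivative. -/
structure IsSource (S : Set (Space n)) (a b c : ℝ) (f : ℝ → Space n → ℝ) : Prop where
  meas : ∀ x ∈ S, AEStronglyMeasurable fun z => f z x
  smooth : ∀ᵐ z, ContDiffOn ℝ 2 (f z) S
  bound : ∃ C, ∀ᵐ z, ∀ x ∈ S, |f z x| ≤ C * Real.exp (-(a * |z|)) ∧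
    ‖fderiv ℝ (f z) x‖ ≤ C * Real.exp (-(b * |z|)) ∧
    |(Δ (f z)) x| ≤ C * Real.exp (-(b * |z|)) ∧
    ‖fderiv ℝ (fderiv ℝ (f z)) x‖ ≤ C * Real.exp (-(c * |z|))

/-- The same as `IsSource`, for every `z`, together with the joint continuity of the
derivatives in `x`. -/
structure IsProfile (S : Set (Space n)) (a b c : ℝ) (f : ℝ → Space n → ℝ) : Prop where
  smooth : ∀ z, ContDiffOn ℝ 2 (f z) S
  continuousOn : ContinuousOn (fun q : ℝ × Space n => f q.1 q.2) (univ ×ˢ S)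
  continuousOn_fderiv : ContinuousOn (fun q : ℝ × Space n => fderiv ℝ (f q.1) q.2) (univ ×ˢ S)
  continuousOn_fderiv_fderiv :
    ContinuousOn (fun q : ℝ × Space n => fderiv ℝ (fderiv ℝ (f q.1)) q.2) (univ ×ˢ S)
  bound : ∃ C, ∀ z, ∀ x ∈ S, |f z x| ≤ C * Real.exp (-(a * |z|)) ∧
    ‖fderiv ℝ (f z) x‖ ≤ C * Real.exp (-(b * |z|)) ∧
    |(Δ (f z)) x| ≤ C * Real.exp (-(b * |z|)) ∧
    ‖fderiv ℝ (fderiv ℝ (f z)) x‖ ≤ C * Real.exp (-(c * |z|))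

lemma continuous_of_continuousOn_prod {V : Type*} [TopologicalSpace V] {S : Set (Space n)}
    {f : ℝ → Space n → V}
    (h : ContinuousOn (fun q : ℝ × Space n => f q.1 q.2) (univ ×ˢ S)) {x : Space n} (hx : x ∈ S) :
    Continuous fun z => f z x := by
  rw [← continuousOn_univ]
  exact h.comp (f := fun z => (z, x)) (Continuous.continuousOn (by fun_prop))
    fun z _ => ⟨mem_univ _, hx⟩

lemma IsProfile.isSource {S : Set (Space n)} {a b c : ℝ} {f : ℝ → Space n → ℝ}
    (h : IsProfile S a b c f) : IsSource S a b c f := by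
  refine ⟨fun x hx => (continuous_of_continuousOn_prod h.continuousOn hx).aestronglyMeasurable,
    Eventually.of_forall h.smooth, ?_⟩
  obtain ⟨C, hC⟩ := h.bound
  exact ⟨C, Eventually.of_forall hC⟩

section differentiability
variable {S : Set (Space n)} {g : Space n → ℝ}

lemma hasFDerivAt_of_contDiffOn_two (hS : IsOpen S) (hg : ContDiffOn ℝ 2 g S)
    {x : Space n} (hx : x ∈ S) : HasFDerivAt g (fderiv ℝ g x) x :=
  ((hg.contDiffAt (hS.mem_nhds hx)).differentiableAt (by simp)).hasFDerivAt

lemma contDiffOn_fderiv (hS : IsOpen S) (hg : ContDiffOn ℝ 2 g S) :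
    ContDiffOn ℝ 1 (fderiv ℝ g) S := hg.fderiv_of_isOpen hS (by norm_num)

lemma hasFDerivAt_fderiv_of_contDiffOn_two (hS : IsOpen S) (hg : ContDiffOn ℝ 2 g S)
    {x : Space n} (hx : x ∈ S) : HasFDerivAt (fderiv ℝ g) (fderiv ℝ (fderiv ℝ g) x) x :=
  (((contDiffOn_fderiv hS hg).contDiffAt (hS.mem_nhds hx)).differentiableAt one_ne_zero).hasFDerivAt

lemma continuousOn_fderiv_fderiv (hS : IsOpen S) (hg : ContDiffOn ℝ 2 g S) :
    ContinuousOn (fderiv ℝ (fderiv ℝ g)) S :=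
  (contDiffOn_fderiv hS hg).continuousOn_fderiv_of_isOpen hS le_rfl

end differentiability

section source
variable {S : Set (Space n)} {a b c : ℝ} {f : ℝ → Space n → ℝ} {κ : ℝ → ℝ}

lemma IsSource.meas_fderiv (h : IsSource S a b c f) (hS : IsOpen S) {x : Space n} (hx : x ∈ S) :
    AEStronglyMeasurable fun z => fderiv ℝ (f z) x :=
  aestronglyMeasurable_fderiv hS h.meas (h.smooth.mono fun _ hz _ hy =>
    (hasFDerivAt_of_contDiffOn_two hS hz hy).differentiableAt) hx

lemma IsSource.meas_fderiv_fderiv (h : IsSource S a b c f) (hS : IsOpen S) {x : Space n}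
    (hx : x ∈ S) : AEStronglyMeasurable fun z => fderiv ℝ (fderiv ℝ (f z)) x :=
  aestronglyMeasurable_fderiv hS (fun _ hy => h.meas_fderiv hS hy) (h.smooth.mono fun _ hz _ hy =>
    (hasFDerivAt_fderiv_of_contDiffOn_two hS hz hy).differentiableAt) hx

lemma IsSource.hasFDerivAt_cv (h : IsSource S a b c f) (hS : IsOpen S) (hκ : IsKernel κ)
    (ha : |a| < 1) (hb : |b| < 1) (z : ℝ) {x : Space n} (hx : x ∈ S) :
    HasFDerivAt (fun x => cv κ (fun ζ => f ζ x) z) (cv κ (fun ζ => fderiv ℝ (f ζ) x) z) x := by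
  obtain ⟨C, hC⟩ := h.bound
  exact hκ.hasFDerivAt_cv hS h.meas (fun y hy => h.meas_fderiv hS hy)
    (h.smooth.mono fun _ hz _ hy => hasFDerivAt_of_contDiffOn_two hS hz hy) ha
    (hC.mono fun _ hz y hy => (hz y hy).1) hb (hC.mono fun _ hz y hy => (hz y hy).2.1) z hx

lemma IsSource.hasFDerivAt_cv_fderiv (h : IsSource S a b c f) (hS : IsOpen S) (hκ : IsKernel κ)
    (hb : |b| < 1) (hc : |c| < 1) (z : ℝ) {x : Space n} (hx : x ∈ S) :
    HasFDerivAt (fun x => cv κ (fun ζ => fderiv ℝ (f ζ) x) z)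
      (cv κ (fun ζ => fderiv ℝ (fderiv ℝ (f ζ)) x) z) x := by
  obtain ⟨C, hC⟩ := h.bound
  exact hκ.hasFDerivAt_cv hS (fun y hy => h.meas_fderiv hS hy)
    (fun y hy => h.meas_fderiv_fderiv hS hy)
    (h.smooth.mono fun _ hz _ hy => hasFDerivAt_fderiv_of_contDiffOn_two hS hz hy) hb
    (hC.mono fun _ hz y hy => (hz y hy).2.1) hc (hC.mono fun _ hz y hy => (hz y hy).2.2.2) z hx

lemma IsSource.continuousOn_cv (h : IsSource S a b c f) (hS : IsOpen S) (hκ : IsKernel κ)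
    (ha : |a| < 1) :
    ContinuousOn (fun q : ℝ × Space n => cv κ (fun ζ => f ζ q.2) q.1) (univ ×ˢ S) := by
  obtain ⟨C, hC⟩ := h.bound
  exact hκ.continuousOn_cv hS h.meas (h.smooth.mono fun _ hz => hz.continuousOn) ha
    (hC.mono fun _ hz y hy => (hz y hy).1)

lemma IsSource.continuousOn_cv_fderiv (h : IsSource S a b c f) (hS : IsOpen S) (hκ : IsKernel κ)
    (hb : |b| < 1) :
    ContinuousOn (fun q : ℝ × Space n => cv κ (fun ζ => fderiv ℝ (f ζ) q.2) q.1) (univ ×ˢ S) := by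
  obtain ⟨C, hC⟩ := h.bound
  exact hκ.continuousOn_cv hS (fun y hy => h.meas_fderiv hS hy)
    (h.smooth.mono fun _ hz => (contDiffOn_fderiv hS hz).continuousOn) hb
    (hC.mono fun _ hz y hy => (hz y hy).2.1)

lemma IsSource.continuousOn_cv_fderiv_fderiv (h : IsSource S a b c f) (hS : IsOpen S)
    (hκ : IsKernel κ) (hc : |c| < 1) :
    ContinuousOn (fun q : ℝ × Space n => cv κ (fun ζ => fderiv ℝ (fderiv ℝ (f ζ)) q.2) q.1)
      (univ ×ˢ S) := by
  obtain ⟨C, hC⟩ := h.bound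
  exact hκ.continuousOn_cv hS (fun y hy => h.meas_fderiv_fderiv hS hy)
    (h.smooth.mono fun _ hz => continuousOn_fderiv_fderiv hS hz) hc
    (hC.mono fun _ hz y hy => (hz y hy).2.2.2)

lemma IsSource.fderiv_cv (h : IsSource S a b c f) (hS : IsOpen S) (hκ : IsKernel κ)
    (ha : |a| < 1) (hb : |b| < 1) (z : ℝ) {x : Space n} (hx : x ∈ S) :
    fderiv ℝ (fun x => cv κ (fun ζ => f ζ x) z) x = cv κ (fun ζ => fderiv ℝ (f ζ) x) z :=
  (h.hasFDerivAt_cv hS hκ ha hb z hx).fderiv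

lemma IsSource.fderiv_fderiv_cv (h : IsSource S a b c f) (hS : IsOpen S) (hκ : IsKernel κ)
    (ha : |a| < 1) (hb : |b| < 1) (hc : |c| < 1) (z : ℝ) {x : Space n} (hx : x ∈ S) :
    fderiv ℝ (fderiv ℝ (fun x => cv κ (fun ζ => f ζ x) z)) x
      = cv κ (fun ζ => fderiv ℝ (fderiv ℝ (f ζ)) x) z := by
  have : fderiv ℝ (fun x => cv κ (fun ζ => f ζ x) z) =ᶠ[𝓝 x]
      fun x => cv κ (fun ζ => fderiv ℝ (f ζ) x) z := by
    filter_upwards [hS.mem_nhds hx] with y hy using h.fderiv_cv hS hκ ha hb z hy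
  rw [this.fderiv_eq]
  exact (h.hasFDerivAt_cv_fderiv hS hκ hb hc z hx).fderiv

lemma IsSource.laplacian_cv (h : IsSource S a b c f) (hS : IsOpen S) (hκ : IsKernel κ)
    (ha : |a| < 1) (hb : |b| < 1) (hc : |c| < 1) (z : ℝ) {x : Space n} (hx : x ∈ S) :
    (Δ (fun x => cv κ (fun ζ => f ζ x) z)) x = cv κ (fun ζ => (Δ (f ζ)) x) z := by
  obtain ⟨C, hC⟩ := h.bound
  rw [laplacian_eq_sum, h.fderiv_fderiv_cv hS hκ ha hb hc z hx]
  have hi :=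
    hκ.integrable_smul (f := fun ζ => fderiv ℝ (fderiv ℝ (f ζ)) x) (h.meas_fderiv_fderiv hS hx) hc
      (hC.mono fun _ hz => (hz x hx).2.2.2) z
  have h1 : ∀ e : Space n, cv κ (fun ζ => fderiv ℝ (fderiv ℝ (f ζ)) x) z e e
      = ∫ ζ, κ (z - ζ) * fderiv ℝ (fderiv ℝ (f ζ)) x e e := by
    intro e
    rw [cv, ContinuousLinearMap.integral_apply hi, ContinuousLinearMap.integral_apply]
    · simp
    · exact hi.apply_continuousLinearMap e
  simp only [h1]
  rw [← integral_finsetSum]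
  · rw [cv]
    refine integral_congr_ae (Eventually.of_forall fun ζ => ?_)
    simp only [laplacian_eq_sum, smul_eq_mul, Finset.mul_sum]
  · intro i _
    have := (hi.apply_continuousLinearMap (EuclideanSpace.single i 1)).apply_continuousLinearMap
      (EuclideanSpace.single i 1)
    simpa using this

/-- Convolution in `z` maps sources to profiles with the same rates. -/
lemma IsSource.isProfile_cv (h : IsSource S a b c f) (hS : IsOpen S) (hκ : IsKernel κ)
    (ha : |a| < 1) (hb : |b| < 1) (hc : |c| < 1) :
    IsProfile S a b c fun z x => cv κ (fun ζ => f ζ x) z := by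
  have hc1 := h.continuousOn_cv_fderiv hS hκ hb
  have hc2 := h.continuousOn_cv_fderiv_fderiv hS hκ hc
  refine ⟨fun z => ?_, h.continuousOn_cv hS hκ ha, ?_, ?_, ?_⟩
  · refine contDiffOn_two_of_hasFDerivAt hS (fun x hx => h.hasFDerivAt_cv hS hκ ha hb z hx) ?_
    exact contDiffOn_one_of_hasFDerivAt hS
      (fun x hx => h.hasFDerivAt_cv_fderiv hS hκ hb hc z hx) (hc2.comp (f := fun x => (z, x))
        (Continuous.continuousOn (by fun_prop)) fun x hx => ⟨mem_univ _, hx⟩)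
  · exact hc1.congr fun q hq => h.fderiv_cv hS hκ ha hb q.1 hq.2
  · exact hc2.congr fun q hq => h.fderiv_fderiv_cv hS hκ ha hb hc q.1 hq.2
  · obtain ⟨C, hC⟩ := h.bound
    set M := max (cvConst a) (max (cvConst b) (cvConst c)) with hM
    refine ⟨max C 0 * M, fun z x hx => ?_⟩
    have hC0 : (0 : ℝ) ≤ max C 0 := le_max_right _ _
    have hC' : ∀ᵐ ζ, |f ζ x| ≤ max C 0 * Real.exp (-(a * |ζ|)) ∧
        ‖fderiv ℝ (f ζ) x‖ ≤ max C 0 * Real.exp (-(b * |ζ|)) ∧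
        |(Δ (f ζ)) x| ≤ max C 0 * Real.exp (-(b * |ζ|)) ∧
        ‖fderiv ℝ (fderiv ℝ (f ζ)) x‖ ≤ max C 0 * Real.exp (-(c * |ζ|)) := by
      filter_upwards [hC] with ζ hζ
      obtain ⟨h1, h2, h3, h4⟩ := hζ x hx
      have hle : ∀ r : ℝ, C * Real.exp (-(r * |ζ|)) ≤ max C 0 * Real.exp (-(r * |ζ|)) :=
        fun r => mul_le_mul_of_nonneg_right (le_max_left _ _) (Real.exp_pos _).le
      exact ⟨h1.trans (hle _), h2.trans (hle _), h3.trans (hle _), h4.trans (hle _)⟩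
    have hfin : ∀ r : ℝ, cvConst r ≤ M → max C 0 * cvConst r * Real.exp (-(r * |z|))
        ≤ max C 0 * M * Real.exp (-(r * |z|)) := fun r hr => by gcongr
    have m1 : cvConst a ≤ M := le_max_left _ _
    have m2 : cvConst b ≤ M := (le_max_left _ _).trans (le_max_right _ _)
    have m3 : cvConst c ≤ M := (le_max_right _ _).trans (le_max_right _ _)
    refine ⟨?_, ?_, ?_, ?_⟩
    · exact (hκ.norm_cv_le (f := fun ζ => f ζ x) ha (hC'.mono fun _ hz => hz.1) z).trans (hfin a m1)
    · rw [h.fderiv_cv hS hκ ha hb z hx]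
      exact (hκ.norm_cv_le hb (hC'.mono fun _ hz => hz.2.1) z).trans (hfin b m2)
    · rw [h.laplacian_cv hS hκ ha hb hc z hx]
      exact (hκ.norm_cv_le (f := fun ζ => (Δ (f ζ)) x) hb
        (hC'.mono fun _ hz => hz.2.2.1) z).trans (hfin b m2)
    · rw [h.fderiv_fderiv_cv hS hκ ha hb hc z hx]
      exact (hκ.norm_cv_le hc (hC'.mono fun _ hz => hz.2.2.2) z).trans (hfin c m3)

/-- `J ∗ f` is jointly of class `C²` as soon as `f` is jointly continuous. -/
lemma IsSource.contDiffOn_cv_kerJ (h : IsSource S a b c f) (hS : IsOpen S)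
    (ha : |a| < 1) (hb : |b| < 1) (hc : |c| < 1)
    (hf : ContinuousOn (fun q : ℝ × Space n => f q.1 q.2) (univ ×ˢ S)) :
    ContDiffOn ℝ 2 (fun q : ℝ × Space n => cv kerJ (fun ζ => f ζ q.2) q.1) (univ ×ˢ S) := by
  obtain ⟨C, hC⟩ := h.bound
  have d0 : ∀ z, ∀ x ∈ S, HasDerivAt (cv kerJ fun ζ => f ζ x) (cv kerJ' (fun ζ => f ζ x) z) z :=
    fun z x hx => hasDerivAt_cv_kerJ (h.meas x hx) ha (hC.mono fun _ hz => (hz x hx).1) z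
  have d1 : ∀ z, ∀ x ∈ S, HasDerivAt (cv kerJ fun ζ => fderiv ℝ (f ζ) x)
      (cv kerJ' (fun ζ => fderiv ℝ (f ζ) x) z) z := fun z x hx =>
    hasDerivAt_cv_kerJ (h.meas_fderiv hS hx) hb (hC.mono fun _ hz => (hz x hx).2.1) z
  have d2 : ∀ z, ∀ x ∈ S, HasDerivAt (cv kerJ' fun ζ => f ζ x)
      (cv kerJ (fun ζ => f ζ x) z - f z x) z := fun z x hx =>
    hasDerivAt_cv_kerJ' (continuous_of_continuousOn_prod hf hx) ha
      (hC.mono fun _ hz => (hz x hx).1) z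
  refine contDiffOn_two_of_partials (f := fun z x => cv kerJ (fun ζ => f ζ x) z) hS d0
    (fun z x hx => h.hasFDerivAt_cv hS isKernel_kerJ ha hb z hx) ?_ ?_
  · exact contDiffOn_one_of_partials (f := fun z x => cv kerJ' (fun ζ => f ζ x) z) hS d2
      (fun z x hx => h.hasFDerivAt_cv hS isKernel_kerJ' ha hb z hx)
      ((h.continuousOn_cv hS isKernel_kerJ ha).sub hf)
      (h.continuousOn_cv_fderiv hS isKernel_kerJ' hb)
  · exact contDiffOn_one_of_partials (f := fun z x => cv kerJ (fun ζ => fderiv ℝ (f ζ) x) z) hS d1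
      (fun z x hx => h.hasFDerivAt_cv_fderiv hS isKernel_kerJ hb hc z hx)
      (h.continuousOn_cv_fderiv hS isKernel_kerJ' hb)
      (h.continuousOn_cv_fderiv_fderiv hS isKernel_kerJ hc)

end source

end vectorValued

/-! ### Algebra of source terms -/

/-- Functions of class `C²` on `S`, bounded together with their derivatives of order up to two. -/
structure IsBddC2 {V : Type*} [NormedAddCommGroup V] [NormedSpace ℝ V] (S : Set (Space n))
    (h : Space n → V) : Prop where
  contDiffOn : ContDiffOn ℝ 2 h S
  bound : ∃ C, ∀ x ∈ S, ‖h x‖ ≤ C ∧ ‖fderiv ℝ h x‖ ≤ C ∧ ‖fderiv ℝ (fderiv ℝ h) x‖ ≤ C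

lemma abs_laplacian_le (f : Space n → ℝ) (x : Space n) :
    |(Δ f) x| ≤ n * ‖fderiv ℝ (fderiv ℝ f) x‖ := by
  rw [laplacian_eq_sum]
  refine (Finset.abs_sum_le_sum_abs _ _).trans ?_
  refine (Finset.sum_le_card_nsmul _ _ ‖fderiv ℝ (fderiv ℝ f) x‖ fun i _ => ?_).trans
    (le_of_eq (by simp))
  have := (fderiv ℝ (fderiv ℝ f) x).le_opNorm₂ (EuclideanSpace.single i 1)
    (EuclideanSpace.single i 1)
  simpa using this

lemma norm_smul_clm {E F : Type*} [NormedAddCommGroup E] [NormedSpace ℝ E] [NormedAddCommGroup F]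
    [NormedSpace ℝ F] (c : ℝ) (A : E →L[ℝ] F) : ‖c • A‖ = |c| * ‖A‖ := norm_smul c A

section mul
variable {S : Set (Space n)} {h f : Space n → ℝ}

lemma fderiv_mul_of_contDiffOn (hS : IsOpen S) (hh : ContDiffOn ℝ 2 h S) (hf : ContDiffOn ℝ 2 f S)
    {x : Space n} (hx : x ∈ S) :
    fderiv ℝ (fun y => h y * f y) x = h x • fderiv ℝ f x + f x • fderiv ℝ h x :=
  ((hasFDerivAt_of_contDiffOn_two hS hh hx).mul (hasFDerivAt_of_contDiffOn_two hS hf hx)).fderiv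

lemma fderiv_fderiv_mul_of_contDiffOn (hS : IsOpen S) (hh : ContDiffOn ℝ 2 h S)
    (hf : ContDiffOn ℝ 2 f S) {x : Space n} (hx : x ∈ S) :
    fderiv ℝ (fderiv ℝ (fun y => h y * f y)) x
      = (h x • fderiv ℝ (fderiv ℝ f) x + (fderiv ℝ h x).smulRight (fderiv ℝ f x))
        + (f x • fderiv ℝ (fderiv ℝ h) x + (fderiv ℝ f x).smulRight (fderiv ℝ h x)) := by
  have : fderiv ℝ (fun y => h y * f y) =ᶠ[𝓝 x]
      fun y => h y • fderiv ℝ f y + f y • fderiv ℝ h y := by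
    filter_upwards [hS.mem_nhds hx] with y hy using fderiv_mul_of_contDiffOn hS hh hf hy
  rw [this.fderiv_eq]
  exact (((hasFDerivAt_of_contDiffOn_two hS hh hx).smul
    (hasFDerivAt_fderiv_of_contDiffOn_two hS hf hx)).add
    ((hasFDerivAt_of_contDiffOn_two hS hf hx).smul
    (hasFDerivAt_fderiv_of_contDiffOn_two hS hh hx))).fderiv

lemma laplacian_mul_of_contDiffOn (hS : IsOpen S) (hh : ContDiffOn ℝ 2 h S)
    (hf : ContDiffOn ℝ 2 f S) {x : Space n} (hx : x ∈ S) :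
    (Δ fun y => h y * f y) x = h x * (Δ f) x + f x * (Δ h) x
      + 2 * ∑ i, fderiv ℝ h x (EuclideanSpace.single i 1) *
          fderiv ℝ f x (EuclideanSpace.single i 1) := by
  simp only [laplacian_eq_sum, fderiv_fderiv_mul_of_contDiffOn hS hh hf hx, Finset.mul_sum]
  rw [← Finset.sum_add_distrib, ← Finset.sum_add_distrib]
  refine Finset.sum_congr rfl fun i _ => ?_
  simp
  ring

end mul

lemma abs_sum_fderiv_mul_le (L M : Space n →L[ℝ] ℝ) :
    |∑ i, L (EuclideanSpace.single i 1) * M (EuclideanSpace.single i 1)| ≤ n * (‖L‖ * ‖M‖) := by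
  refine (Finset.abs_sum_le_sum_abs _ _).trans ?_
  refine (Finset.sum_le_card_nsmul _ _ (‖L‖ * ‖M‖) fun i _ => ?_).trans
    (le_of_eq (by simp))
  rw [abs_mul]
  have h1 := L.le_opNorm (EuclideanSpace.single i 1)
  have h2 := M.le_opNorm (EuclideanSpace.single i 1)
  simp only [PiLp.norm_single, norm_one, mul_one, Real.norm_eq_abs] at h1 h2
  gcongr

lemma exp_rate_le {a b : ℝ} (h : b ≤ a) (z : ℝ) :
    Real.exp (-(a * |z|)) ≤ Real.exp (-(b * |z|)) := by
  rw [Real.exp_le_exp]; nlinarith [abs_nonneg z]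

section source
variable {S : Set (Space n)} {a b c : ℝ} {f g : ℝ → Space n → ℝ}

/-- The bounds of a source hold with a positive constant. -/
lemma IsSource.exists_pos_bound (hf : IsSource S a b c f) : ∃ C, 0 < C ∧ ∀ᵐ z, ∀ x ∈ S,
    |f z x| ≤ C * Real.exp (-(a * |z|)) ∧ ‖fderiv ℝ (f z) x‖ ≤ C * Real.exp (-(b * |z|)) ∧
    |(Δ (f z)) x| ≤ C * Real.exp (-(b * |z|)) ∧
    ‖fderiv ℝ (fderiv ℝ (f z)) x‖ ≤ C * Real.exp (-(c * |z|)) := by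
  obtain ⟨C, hC⟩ := hf.bound
  refine ⟨max C 1, by positivity, hC.mono fun z hz x hx => ?_⟩
  obtain ⟨h1, h2, h3, h4⟩ := hz x hx
  have hle : ∀ r : ℝ, C * Real.exp (-(r * |z|)) ≤ max C 1 * Real.exp (-(r * |z|)) :=
    fun r => mul_le_mul_of_nonneg_right (le_max_left _ _) (Real.exp_pos _).le
  exact ⟨h1.trans (hle _), h2.trans (hle _), h3.trans (hle _), h4.trans (hle _)⟩

lemma IsSource.mono {a' b' c' : ℝ} (hf : IsSource S a b c f) (ha : a' ≤ a) (hb : b' ≤ b)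
    (hc : c' ≤ c) : IsSource S a' b' c' f := by
  obtain ⟨C, hC0, hC⟩ := hf.exists_pos_bound
  refine ⟨hf.meas, hf.smooth, C, hC.mono fun z hz x hx => ?_⟩
  obtain ⟨h1, h2, h3, h4⟩ := hz x hx
  exact ⟨h1.trans (by gcongr ?_ * ?_; exact exp_rate_le ha z),
    h2.trans (by gcongr ?_ * ?_; exact exp_rate_le hb z),
    h3.trans (by gcongr ?_ * ?_; exact exp_rate_le hb z),
    h4.trans (by gcongr ?_ * ?_; exact exp_rate_le hc z)⟩

lemma IsSource.add (hS : IsOpen S) (hf : IsSource S a b c f) (hg : IsSource S a b c g) :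
    IsSource S a b c fun z x => f z x + g z x := by
  obtain ⟨C, hC⟩ := hf.bound
  obtain ⟨D, hD⟩ := hg.bound
  refine ⟨fun x hx => (hf.meas x hx).add (hg.meas x hx), ?_, C + D, ?_⟩
  · filter_upwards [hf.smooth, hg.smooth] with z h1 h2 using h1.add h2
  · filter_upwards [hf.smooth, hg.smooth, hC, hD] with z s1 s2 h1 h2 x hx
    obtain ⟨p1, p2, p3, p4⟩ := h1 x hx
    obtain ⟨q1, q2, q3, q4⟩ := h2 x hx
    have e1 : ∀ y ∈ S, fderiv ℝ (fun y => f z y + g z y) y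
        = fderiv ℝ (f z) y + fderiv ℝ (g z) y := fun y hy =>
      ((hasFDerivAt_of_contDiffOn_two hS s1 hy).add
        (hasFDerivAt_of_contDiffOn_two hS s2 hy)).fderiv
    have e2 : fderiv ℝ (fderiv ℝ (fun y => f z y + g z y)) x
        = fderiv ℝ (fderiv ℝ (f z)) x + fderiv ℝ (fderiv ℝ (g z)) x := by
      have : fderiv ℝ (fun y => f z y + g z y) =ᶠ[𝓝 x]
          fun y => fderiv ℝ (f z) y + fderiv ℝ (g z) y := by
        filter_upwards [hS.mem_nhds hx] with y hy using e1 y hy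
      rw [this.fderiv_eq]
      exact ((hasFDerivAt_fderiv_of_contDiffOn_two hS s1 hx).add
        (hasFDerivAt_fderiv_of_contDiffOn_two hS s2 hx)).fderiv
    have e3 : (Δ fun y => f z y + g z y) x = (Δ (f z)) x + (Δ (g z)) x :=
      (s1.contDiffAt (hS.mem_nhds hx)).laplacian_add (s2.contDiffAt (hS.mem_nhds hx))
    rw [e1 x hx, e2, e3]
    simp only [add_mul]
    exact ⟨(abs_add_le _ _).trans (add_le_add p1 q1), (norm_add_le _ _).trans (add_le_add p2 q2),
      (abs_add_le _ _).trans (add_le_add p3 q3), (opNorm_add_le _ _).trans (add_le_add p4 q4)⟩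

lemma IsSource.mul (hS : IsOpen S) {h : Space n → ℝ} (hh : IsBddC2 S h)
    (hf : IsSource S a b c f) (hba : b ≤ a) (hcb : c ≤ b) :
    IsSource S a b c fun z x => h x * f z x := by
  obtain ⟨C, hC0, hC⟩ := hf.exists_pos_bound
  obtain ⟨D, hD⟩ := hh.bound
  refine ⟨fun x hx => (hf.meas x hx).const_mul _, ?_, (D * C) * (4 + 3 * n), ?_⟩
  · filter_upwards [hf.smooth] with z h1 using hh.contDiffOn.mul h1
  · filter_upwards [hf.smooth, hC] with z s1 h1 x hx
    obtain ⟨p1, p2, p3, p4⟩ := h1 x hx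
    obtain ⟨q1, q2, q3⟩ := hD x hx
    rw [Real.norm_eq_abs] at q1
    have hD0 : 0 ≤ D := (abs_nonneg _).trans q1
    have hb' := exp_rate_le hba z
    have hc' := exp_rate_le hcb z
    set ea := Real.exp (-(a * |z|))
    set eb := Real.exp (-(b * |z|))
    set ec := Real.exp (-(c * |z|))
    have hea : 0 < ea := Real.exp_pos _
    have heb : 0 < eb := Real.exp_pos _
    have hec : 0 < ec := Real.exp_pos _
    have hDC : 0 ≤ D * C := by positivity
    have hn : (0 : ℝ) ≤ n := Nat.cast_nonneg n
    have m1 : |h x| * |f z x| ≤ D * C * ea := by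
      calc _ ≤ D * (C * ea) := by gcongr
        _ = _ := by ring
    have m1b : D * C * ea ≤ D * C * eb := by gcongr
    have m1c : D * C * eb ≤ D * C * ec := by gcongr
    have m2 : |h x| * ‖fderiv ℝ (f z) x‖ ≤ D * C * eb := by
      calc _ ≤ D * (C * eb) := by gcongr
        _ = _ := by ring
    have m3 : |f z x| * ‖fderiv ℝ h x‖ ≤ D * C * ea := by
      calc _ ≤ (C * ea) * D := by gcongr
        _ = _ := by ring
    have m4 : |h x| * |(Δ (f z)) x| ≤ D * C * eb := by
      calc _ ≤ D * (C * eb) := by gcongr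
        _ = _ := by ring
    have m5 : |f z x| * ‖fderiv ℝ (fderiv ℝ h) x‖ ≤ D * C * ea := by
      calc _ ≤ (C * ea) * D := by gcongr
        _ = _ := by ring
    have m6 : ‖fderiv ℝ h x‖ * ‖fderiv ℝ (f z) x‖ ≤ D * C * eb := by
      calc _ ≤ D * (C * eb) := by gcongr
        _ = _ := by ring
    have m7 : |h x| * ‖fderiv ℝ (fderiv ℝ (f z)) x‖ ≤ D * C * ec := by
      calc _ ≤ D * (C * ec) := by gcongr
        _ = _ := by ring
    have big : ∀ e : ℝ, 0 < e → 4 * (D * C * e) ≤ D * C * (4 + 3 * n) * e := by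
      intro e he
      have : 0 ≤ D * C * e * n := by positivity
      nlinarith
    refine ⟨?_, ?_, ?_, ?_⟩
    · rw [abs_mul]
      have := big ea hea
      have : 0 ≤ D * C * ea := by positivity
      linarith
    · rw [fderiv_mul_of_contDiffOn hS hh.contDiffOn s1 hx]
      refine (norm_add_le _ _).trans ?_
      rw [norm_smul, norm_smul, Real.norm_eq_abs, Real.norm_eq_abs]
      have := big eb heb
      have : 0 ≤ D * C * eb := by positivity
      linarith
    · rw [laplacian_mul_of_contDiffOn hS hh.contDiffOn s1 hx]
      have t1 := abs_add_le (h x * (Δ (f z)) x + f z x * (Δ h) x)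
        (2 * ∑ i, fderiv ℝ h x (EuclideanSpace.single i 1) *
          fderiv ℝ (f z) x (EuclideanSpace.single i 1))
      have t2 := abs_add_le (h x * (Δ (f z)) x) (f z x * (Δ h) x)
      have t3 := abs_sum_fderiv_mul_le (fderiv ℝ h x) (fderiv ℝ (f z) x)
      have t4 := abs_laplacian_le h x
      rw [abs_mul, abs_mul] at t2
      rw [abs_mul 2, abs_two] at t1
      have t5 : |f z x| * |(Δ h) x| ≤ n * (D * C * eb) := by
        calc _ ≤ |f z x| * (n * ‖fderiv ℝ (fderiv ℝ h) x‖) := by gcongr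
          _ = n * (|f z x| * ‖fderiv ℝ (fderiv ℝ h) x‖) := by ring
          _ ≤ _ := mul_le_mul_of_nonneg_left (by linarith) hn
      have t6 : (n : ℝ) * (‖fderiv ℝ h x‖ * ‖fderiv ℝ (f z) x‖) ≤ n * (D * C * eb) :=
        mul_le_mul_of_nonneg_left m6 hn
      have : 0 ≤ D * C * eb := by positivity
      calc _ ≤ D * C * eb + n * (D * C * eb) + 2 * (n * (D * C * eb)) := by linarith
        _ ≤ _ := by linarith
    · rw [fderiv_fderiv_mul_of_contDiffOn hS hh.contDiffOn s1 hx]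
      refine (opNorm_add_le _ _).trans ?_
      refine (add_le_add (opNorm_add_le _ _) (opNorm_add_le _ _)).trans ?_
      rw [norm_smul_clm (h x) (fderiv ℝ (fderiv ℝ (f z)) x),
        norm_smul_clm (f z x) (fderiv ℝ (fderiv ℝ h) x), norm_smulRight_apply,
        norm_smulRight_apply, mul_comm ‖fderiv ℝ (f z) x‖]
      have := big ec hec
      linarith

lemma abs_mul_exp_le {r τ : ℝ} (hτ : 0 < τ) (z : ℝ) :
    |z| * Real.exp (-(r * |z|)) ≤ 1 / τ * Real.exp (-((r - τ) * |z|)) := by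
  have e : Real.exp (-((r - τ) * |z|)) = Real.exp (τ * |z|) * Real.exp (-(r * |z|)) := by
    rw [← Real.exp_add]; congr 1; ring
  rw [e, ← mul_assoc]
  refine mul_le_mul_of_nonneg_right ?_ (Real.exp_pos _).le
  have := Real.add_one_le_exp (τ * |z|)
  rw [one_div, ← div_eq_inv_mul, le_div_iff₀ hτ]
  linarith

/-- Multiplication by `z` costs an arbitrarily small part of the rates. -/
lemma IsSource.mul_id (hS : IsOpen S) (hf : IsSource S a b c f) {τ : ℝ} (hτ : 0 < τ) :
    IsSource S (a - τ) (b - τ) (c - τ) fun z x => z * f z x := by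
  obtain ⟨C, hC0, hC⟩ := hf.exists_pos_bound
  refine ⟨fun x hx => measurable_id.aestronglyMeasurable.mul (hf.meas x hx), ?_, C * (1 / τ), ?_⟩
  · filter_upwards [hf.smooth] with z h1 using contDiffOn_const.mul h1
  · filter_upwards [hf.smooth, hC] with z s1 h1 x hx
    obtain ⟨p1, p2, p3, p4⟩ := h1 x hx
    have e1 : ∀ y ∈ S, fderiv ℝ (fun y => z * f z y) y = z • fderiv ℝ (f z) y := fun y hy =>
      ((hasFDerivAt_of_contDiffOn_two hS s1 hy).const_mul z).fderiv
    have e2 : fderiv ℝ (fderiv ℝ (fun y => z * f z y)) x = z • fderiv ℝ (fderiv ℝ (f z)) x := by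
      have : fderiv ℝ (fun y => z * f z y) =ᶠ[𝓝 x] fun y => z • fderiv ℝ (f z) y := by
        filter_upwards [hS.mem_nhds hx] with y hy using e1 y hy
      rw [this.fderiv_eq]
      exact ((hasFDerivAt_fderiv_of_contDiffOn_two hS s1 hx).const_smul z).fderiv
    have e3 : (Δ fun y => z * f z y) x = z * (Δ (f z)) x := by
      rw [laplacian_eq_sum, laplacian_eq_sum, e2, Finset.mul_sum]; simp
    have key : ∀ (r t : ℝ), t ≤ C * Real.exp (-(r * |z|)) →
        |z| * t ≤ C * (1 / τ) * Real.exp (-((r - τ) * |z|)) := by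
      intro r t ht
      calc |z| * t ≤ |z| * (C * Real.exp (-(r * |z|))) := by gcongr
        _ = C * (|z| * Real.exp (-(r * |z|))) := by ring
        _ ≤ C * (1 / τ * Real.exp (-((r - τ) * |z|))) :=
          mul_le_mul_of_nonneg_left (abs_mul_exp_le hτ z) hC0.le
        _ = _ := by ring
    rw [e1 x hx, e2, e3, abs_mul, abs_mul, norm_smul,
      norm_smul_clm z (fderiv ℝ (fderiv ℝ (f z)) x), Real.norm_eq_abs]
    exact ⟨key _ _ p1, key _ _ p2, key _ _ p3, key _ _ p4⟩

end source

section comp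
variable {S : Set (Space n)} {P : Space n → Space n} {g : Space n → ℝ}

lemma fderiv_comp_of_contDiffOn (hS : IsOpen S) (hP : ContDiffOn ℝ 2 P S) (hPS : MapsTo P S S)
    (hg : ContDiffOn ℝ 2 g S) {x : Space n} (hx : x ∈ S) :
    fderiv ℝ (fun y => g (P y)) x = (fderiv ℝ g (P x)).comp (fderiv ℝ P x) :=
  ((hasFDerivAt_of_contDiffOn_two hS hg (hPS hx)).comp x
    ((hP.contDiffAt (hS.mem_nhds hx)).differentiableAt (by simp)).hasFDerivAt).fderiv

lemma norm_fderiv_comp_le (hS : IsOpen S) (hP : ContDiffOn ℝ 2 P S) (hPS : MapsTo P S S)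
    (hg : ContDiffOn ℝ 2 g S) {x : Space n} (hx : x ∈ S) {C : ℝ}
    (h1 : ‖fderiv ℝ P x‖ ≤ C) :
    ‖fderiv ℝ (fun y => g (P y)) x‖ ≤ C * ‖fderiv ℝ g (P x)‖ := by
  rw [fderiv_comp_of_contDiffOn hS hP hPS hg hx]
  refine (opNorm_comp_le _ _).trans ?_
  rw [mul_comm]; gcongr

lemma norm_fderiv_fderiv_comp_le (hS : IsOpen S) (hP : ContDiffOn ℝ 2 P S) (hPS : MapsTo P S S)
    (hg : ContDiffOn ℝ 2 g S) {x : Space n} (hx : x ∈ S) {C : ℝ}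
    (h1 : ‖fderiv ℝ P x‖ ≤ C) (h2 : ‖fderiv ℝ (fderiv ℝ P) x‖ ≤ C) :
    ‖fderiv ℝ (fderiv ℝ (fun y => g (P y))) x‖
      ≤ C ^ 2 * ‖fderiv ℝ (fderiv ℝ g) (P x)‖ + C * ‖fderiv ℝ g (P x)‖ := by
  have hC : 0 ≤ C := (norm_nonneg _).trans h1
  have he : fderiv ℝ (fun y => g (P y)) =ᶠ[𝓝 x]
      fun y => (fderiv ℝ g (P y)).comp (fderiv ℝ P y) := by
    filter_upwards [hS.mem_nhds hx] with y hy using fderiv_comp_of_contDiffOn hS hP hPS hg hy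
  have hP' : HasFDerivAt (fderiv ℝ P) (fderiv ℝ (fderiv ℝ P) x) x :=
    (((hP.fderiv_of_isOpen hS (m := 1) (by norm_num)).contDiffAt
      (hS.mem_nhds hx)).differentiableAt one_ne_zero).hasFDerivAt
  have hPd : HasFDerivAt P (fderiv ℝ P x) x :=
    ((hP.contDiffAt (hS.mem_nhds hx)).differentiableAt (by simp)).hasFDerivAt
  have hgP := (hasFDerivAt_fderiv_of_contDiffOn_two hS hg (hPS hx)).comp x hPd
  have hd := hgP.clm_comp hP'
  rw [he.fderiv_eq]
  have hd' := hd.fderiv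
  simp only [Function.comp_def] at hd'
  rw [hd']
  refine opNorm_le_bound _ (by positivity) fun v => ?_
  refine opNorm_le_bound _ (by positivity) fun w => ?_
  simp only [add_apply, comp_apply, compL_apply, flip_apply]
  refine (norm_add_le _ _).trans ?_
  have i1 : ‖fderiv ℝ g (P x) (fderiv ℝ (fderiv ℝ P) x v w)‖
      ≤ ‖fderiv ℝ g (P x)‖ * (C * ‖v‖ * ‖w‖) := by
    refine (le_opNorm _ _).trans ?_
    gcongr
    refine (le_opNorm₂ _ _ _).trans ?_
    gcongr
  have i2 : ‖fderiv ℝ (fderiv ℝ g) (P x) (fderiv ℝ P x v) (fderiv ℝ P x w)‖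
      ≤ ‖fderiv ℝ (fderiv ℝ g) (P x)‖ * (C * ‖v‖) * (C * ‖w‖) := by
    refine (le_opNorm₂ _ _ _).trans ?_
    gcongr
    · exact (le_opNorm _ _).trans (by gcongr)
    · exact (le_opNorm _ _).trans (by gcongr)
  calc _ ≤ ‖fderiv ℝ g (P x)‖ * (C * ‖v‖ * ‖w‖)
        + ‖fderiv ℝ (fderiv ℝ g) (P x)‖ * (C * ‖v‖) * (C * ‖w‖) := add_le_add i1 i2
    _ = _ := by ring

/-- Composition of a profile with a map of class `C²` with bounded derivatives. -/
lemma IsProfile.comp_map {a : ℝ} {f : ℝ → Space n → ℝ} (hS : IsOpen S) (hf : IsProfile S a a a f)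
    (hP : ContDiffOn ℝ 2 P S) (hPS : MapsTo P S S) {C : ℝ}
    (h1 : ∀ x ∈ S, ‖fderiv ℝ P x‖ ≤ C) (h2 : ∀ x ∈ S, ‖fderiv ℝ (fderiv ℝ P) x‖ ≤ C) :
    IsSource S a a a fun z x => f z (P x) := by
  obtain ⟨D, hD⟩ := hf.bound
  refine ⟨fun x hx => (continuous_of_continuousOn_prod hf.continuousOn
    (hPS hx)).aestronglyMeasurable, Eventually.of_forall fun z => (hf.smooth z).comp hP hPS,
    (1 + n) * ((C ^ 2 + C) * D) + D + C * D, Eventually.of_forall fun z x hx => ?_⟩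
  obtain ⟨p1, p2, p3, p4⟩ := hD z (P x) (hPS hx)
  have hC0 : 0 ≤ C := (norm_nonneg _).trans (h1 x hx)
  have he : 0 < Real.exp (-(a * |z|)) := Real.exp_pos _
  have hD0 : 0 ≤ D := nonneg_of_mul_nonneg_left ((abs_nonneg _).trans p1) he
  set e := Real.exp (-(a * |z|))
  have k1 := norm_fderiv_comp_le hS hP hPS (hf.smooth z) hx (h1 x hx)
  have k2 := norm_fderiv_fderiv_comp_le hS hP hPS (hf.smooth z) hx (h1 x hx) (h2 x hx)
  have k3 := abs_laplacian_le (fun y => f z (P y)) x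
  have k4 : ‖fderiv ℝ (fderiv ℝ fun y => f z (P y)) x‖ ≤ (C ^ 2 + C) * D * e := by
    calc _ ≤ C ^ 2 * (D * e) + C * (D * e) := k2.trans (by gcongr)
      _ = _ := by ring
  have k5 : |(Δ fun y => f z (P y)) x| ≤ n * ((C ^ 2 + C) * D * e) := k3.trans (by gcongr)
  have k6 : ‖fderiv ℝ (fun y => f z (P y)) x‖ ≤ C * (D * e) := k1.trans (by gcongr)
  have z1 : 0 ≤ (C ^ 2 + C) * D * e := by positivity
  have z2 : 0 ≤ n * ((C ^ 2 + C) * D * e) := by positivity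
  have z3 : 0 ≤ D * e := by positivity
  have z4 : 0 ≤ C * D * e := by positivity
  refine ⟨?_, ?_, ?_, ?_⟩ <;> nlinarith

end comp

/-! ### Decay in the sense of essential suprema -/

/-- For functions continuous in `x`, the essential bound holds for almost every `z` and every
`x`. -/
lemma ExpDecay.ae_forall {S : Set (Space n)} (hS : IsOpen S) {μ Λ : ℝ} {w : ℝ → Space n → ℝ}
    (h : ExpDecay S μ Λ w) (hc : ∀ z, ContinuousOn (w z) S) :
    ∀ᵐ z, ∀ x ∈ S, |w z x| ≤ Λ * Real.exp (-(μ * |z|)) := by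
  have h1 := h.2
  rw [Measure.volume_eq_prod, ← Measure.prod_restrict, Measure.restrict_univ] at h1
  filter_upwards [Measure.ae_ae_of_ae_prod h1] with z hz x hx
  have hbound : ∀ᵐ y ∂(volume.restrict S), |w z y| ≤ Λ * Real.exp (-(μ * |z|)) := by
    filter_upwards [hz] with y hy
    rw [abs_mul, abs_of_pos (Real.exp_pos _)] at hy
    rw [Real.exp_neg, ← div_eq_mul_inv, le_div_iff₀ (Real.exp_pos _)]
    linarith
  by_contra! hlt
  set U := S ∩ (fun y => |w z y|) ⁻¹' Ioi (Λ * Real.exp (-(μ * |z|))) with hU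
  have hUo : IsOpen U := (hc z).abs.isOpen_inter_preimage hS isOpen_Ioi
  have hU0 : volume U = 0 := by
    rw [ae_restrict_iff' hS.measurableSet] at hbound
    refine measure_mono_null ?_ (ae_iff.1 hbound)
    rintro y ⟨hyS, hy⟩ hcon
    exact absurd (hcon hyS) (not_le.2 hy)
  have := (hUo.measure_eq_zero_iff volume).1 hU0
  exact (this ▸ (⟨hx, hlt⟩ : x ∈ U) : x ∈ (∅ : Set (Space n)))

lemma expDecay_of_forall {S : Set (Space n)} (hS : IsOpen S) {μ Λ : ℝ} {w : ℝ → Space n → ℝ}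
    (hm : AEStronglyMeasurable (fun q : ℝ × Space n => w q.1 q.2) (volume.restrict (univ ×ˢ S)))
    (h : ∀ z, ∀ x ∈ S, |w z x| ≤ Λ * Real.exp (-(μ * |z|))) : ExpDecay S μ Λ w := by
  refine ⟨hm, ?_⟩
  rw [ae_restrict_iff' (isOpen_univ.prod hS).measurableSet]
  refine Eventually.of_forall fun q hq => ?_
  have := h q.1 q.2 hq.2
  rw [Real.exp_neg, ← div_eq_mul_inv, le_div_iff₀ (Real.exp_pos _)] at this
  rw [abs_mul, abs_of_pos (Real.exp_pos _)]
  linarith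

lemma expDecay_of_continuousOn {S : Set (Space n)} (hS : IsOpen S) {μ Λ : ℝ}
    {w : ℝ → Space n → ℝ} (hc : ContinuousOn (fun q : ℝ × Space n => w q.1 q.2) (univ ×ˢ S))
    (h : ∀ z, ∀ x ∈ S, |w z x| ≤ Λ * Real.exp (-(μ * |z|))) : ExpDecay S μ Λ w :=
  expDecay_of_forall hS (hc.aestronglyMeasurable (isOpen_univ.prod hS).measurableSet) h

/-! ### The Laplacian of a profile as a source term -/

/-- The trace of a bilinear form on `ℝⁿ`. -/
noncomputable def traceForm (n : ℕ) : (Space n →L[ℝ] Space n →L[ℝ] ℝ) →L[ℝ] ℝ :=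
  ∑ i : Fin n, (ContinuousLinearMap.apply ℝ ℝ (EuclideanSpace.single i (1 : ℝ))).comp
    (ContinuousLinearMap.apply ℝ (Space n →L[ℝ] ℝ) (EuclideanSpace.single i (1 : ℝ)))

lemma laplacian_eq_traceForm (f : Space n → ℝ) :
    (Δ f) = traceForm n ∘ fderiv ℝ (fderiv ℝ f) := by
  ext x; simp [laplacian_eq_sum, traceForm]

lemma contDiffOn_fderiv_fderiv_of_four {S : Set (Space n)} (hS : IsOpen S) {f : Space n → ℝ}
    (hf : ContDiffOn ℝ 4 f S) : ContDiffOn ℝ 2 (fderiv ℝ (fderiv ℝ f)) S :=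
  (hf.fderiv_of_isOpen hS (m := 3) (by norm_num)).fderiv_of_isOpen hS (by norm_num)

set_option maxSynthPendingDepth 3 in
lemma norm_iteratedFDeriv_laplacian_le {S : Set (Space n)} (hS : IsOpen S) {f : Space n → ℝ}
    (hf : ContDiffOn ℝ 4 f S) {x : Space n} (hx : x ∈ S) {k : ℕ} (hk : k ≤ 2) :
    ‖iteratedFDeriv ℝ k (Δ f) x‖ ≤ ‖traceForm n‖ * ‖iteratedFDeriv ℝ (k + 2) f x‖ := by
  rw [laplacian_eq_traceForm]
  have h1 := (traceForm n).norm_iteratedFDeriv_comp_left (x := x)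
    (((contDiffOn_fderiv_fderiv_of_four hS hf).contDiffAt (hS.mem_nhds hx)))
    (by exact_mod_cast hk)
  refine h1.trans (le_of_eq ?_)
  rw [norm_iteratedFDeriv_fderiv, norm_iteratedFDeriv_fderiv]

lemma norm_fderiv_eq_iterated {V : Type*} [NormedAddCommGroup V] [NormedSpace ℝ V]
    (f : Space n → V) (x : Space n) : ‖fderiv ℝ f x‖ = ‖iteratedFDeriv ℝ 1 f x‖ := by
  rw [← norm_iteratedFDeriv_zero (𝕜 := ℝ) (f := fderiv ℝ f), norm_iteratedFDeriv_fderiv]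

lemma norm_fderiv_fderiv_eq_iterated (f : Space n → ℝ) (x : Space n) :
    ‖fderiv ℝ (fderiv ℝ f) x‖ = ‖iteratedFDeriv ℝ 2 f x‖ := by
  rw [norm_fderiv_eq_iterated, norm_iteratedFDeriv_fderiv]

variable {Ω E : Set (Space n)} {δ : ℝ}

/-! ### The signed distance function and the nearest point projection -/

lemma exists_mem_frontier_between {x y : Space n} (hx : x ∈ E) (hy : y ∉ E) :
    ∃ z ∈ frontier E, dist x z + dist z y = dist x y := by
  have hpre := (convex_segment (𝕜 := ℝ) x y).isPreconnected
  suffices h : ∃ z ∈ segment ℝ x y, z ∈ frontier E by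
    obtain ⟨z, hz, hz'⟩ := h
    exact ⟨z, hz', dist_add_dist_of_mem_segment hz⟩
  by_contra! h
  have hcover : ∀ z ∈ segment ℝ x y, z ∈ interior E ∨ z ∈ (closure E)ᶜ := fun z hz => by
    by_contra! hcon
    exact h z hz ⟨not_not.1 hcon.2, hcon.1⟩
  have hx' : x ∈ interior E := (hcover x (left_mem_segment ℝ x y)).resolve_right
    fun hn => hn (subset_closure hx)
  have hy' : y ∈ (closure E)ᶜ := (hcover y (right_mem_segment ℝ x y)).resolve_left
    fun hn => hy (interior_subset hn)
  obtain ⟨z, -, hz1, hz2⟩ := hpre _ _ isOpen_interior isClosed_closure.isOpen_compl hcover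
    ⟨x, left_mem_segment ℝ x y, hx'⟩ ⟨y, right_mem_segment ℝ x y, hy'⟩
  exact hz2 (subset_closure (interior_subset hz1))

lemma continuous_sdist : Continuous (sdist Ω E) :=
  (continuous_infDist_pt _).sub (continuous_infDist_pt _)

namespace IsInterface

lemma isOpen_tube (hE : IsInterface Ω E δ) : IsOpen (tube Ω E δ) :=
  hE.isOpen_domain.inter (isOpen_lt continuous_sdist.abs continuous_const)

lemma frontier_subset (hE : IsInterface Ω E δ) : frontier E ⊆ Ω :=
  frontier_subset_closure.trans hE.closure_phase_subset

lemma frontier_disjoint (hE : IsInterface Ω E δ) {x : Space n} (hx : x ∈ frontier E) : x ∉ E :=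
  fun h => (hE.isOpen_phase.frontier_eq ▸ hx).2 h

lemma isCompact_closure (hE : IsInterface Ω E δ) : IsCompact (closure E) :=
  Metric.isCompact_of_isClosed_isBounded isClosed_closure
    (hE.isBounded_domain.subset hE.closure_phase_subset)

lemma isCompact_frontier (hE : IsInterface Ω E δ) : IsCompact (frontier E) :=
  hE.isCompact_closure.of_isClosed_subset isClosed_frontier frontier_subset_closure

/-- If the domain is not empty, neither are the interface and the two phases: in the degenerate
cases the signed distance vanishes identically, so that the interface would have to contain
nearest points. -/
lemma nonempty (hE : IsInterface Ω E δ) {x : Space n} (hx : x ∈ Ω) :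
    E.Nonempty ∧ (frontier E).Nonempty := by
  have htube : sdist Ω E x = 0 → (frontier E).Nonempty := fun h => by
    obtain ⟨y, hy, -⟩ := hE.existsUnique_proj x ⟨hx, by rw [h]; simp [hE.pos]⟩
    exact ⟨y, hy.1⟩
  have hne : E.Nonempty := by
    rw [nonempty_iff_ne_empty]
    rintro rfl
    have : sdist Ω ∅ x = 0 := by simp [sdist, infDist_zero_of_mem hx]
    simpa using htube this
  refine ⟨hne, nonempty_frontier_iff.2 ⟨hne, ?_⟩⟩
  rintro rfl
  have : sdist Ω univ x = 0 := by simp [sdist, infDist_zero_of_mem (mem_univ x)]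
  simpa using htube this

lemma sdist_of_mem (hE : IsInterface Ω E δ) {x : Space n} (hx : x ∈ E) :
    sdist Ω E x = infDist x (frontier E) := by
  have hxΩ : x ∈ Ω := hE.closure_phase_subset (subset_closure hx)
  obtain ⟨-, hΓ⟩ := hE.nonempty hxΩ
  have hsub : frontier E ⊆ Ω \ E := fun y hy => ⟨hE.frontier_subset hy, hE.frontier_disjoint hy⟩
  rw [sdist, infDist_zero_of_mem hx, sub_zero]
  refine le_antisymm (infDist_le_infDist_of_subset hsub hΓ) ?_
  refine (le_infDist (hΓ.mono hsub)).2 fun y hy => ?_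
  obtain ⟨z, hz, h⟩ := exists_mem_frontier_between hx hy.2
  exact (infDist_le_dist_of_mem hz).trans (by linarith [dist_nonneg (x := z) (y := y)])

lemma sdist_of_notMem (hE : IsInterface Ω E δ) {x : Space n} (hx : x ∈ Ω) (hx' : x ∉ E) :
    sdist Ω E x = - infDist x (frontier E) := by
  obtain ⟨hne, hΓ⟩ := hE.nonempty hx
  rw [sdist, infDist_zero_of_mem (show x ∈ Ω \ E from ⟨hx, hx'⟩), zero_sub]
  congr 1
  refine le_antisymm ?_ ?_
  · rw [← infDist_closure (s := E)]
    exact infDist_le_infDist_of_subset frontier_subset_closure hΓ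
  · refine (le_infDist hne).2 fun y hy => ?_
    obtain ⟨z, hz, h⟩ := exists_mem_frontier_between hy hx'
    rw [dist_comm y x] at h
    refine (infDist_le_dist_of_mem hz).trans ?_
    rw [dist_comm x z]
    linarith [dist_nonneg (x := y) (y := z)]

lemma abs_sdist (hE : IsInterface Ω E δ) {x : Space n} (hx : x ∈ Ω) :
    |sdist Ω E x| = infDist x (frontier E) := by
  by_cases h : x ∈ E
  · rw [hE.sdist_of_mem h, abs_of_nonneg infDist_nonneg]
  · rw [hE.sdist_of_notMem hx h, abs_neg, abs_of_nonneg infDist_nonneg]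

lemma sdist_pos (hE : IsInterface Ω E δ) {x : Space n} (hx : x ∈ E) : 0 < sdist Ω E x := by
  rw [hE.sdist_of_mem hx]
  have hΓ := (hE.nonempty (hE.closure_phase_subset (subset_closure hx))).2
  exact (isClosed_frontier.notMem_iff_infDist_pos hΓ).1 fun h => hE.frontier_disjoint h hx

lemma sdist_eq_zero_iff (hE : IsInterface Ω E δ) {x : Space n} (hx : x ∈ Ω) :
    sdist Ω E x = 0 ↔ x ∈ frontier E := by
  rw [← abs_eq_zero, hE.abs_sdist hx]
  exact (isClosed_frontier.mem_iff_infDist_zero (hE.nonempty hx).2).symm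

/-- The signed distance is 1-Lipschitz in the domain. -/
lemma abs_sdist_sub_le (hE : IsInterface Ω E δ) {x y : Space n} (hx : x ∈ Ω) (hy : y ∈ Ω) :
    |sdist Ω E x - sdist Ω E y| ≤ dist x y := by
  have hl : |infDist x (frontier E) - infDist y (frontier E)| ≤ dist x y := by
    have := (lipschitz_infDist_pt (frontier E)).dist_le_mul x y
    simpa [Real.dist_eq] using this
  have cross : ∀ a b : Space n, a ∈ E → b ∉ E → b ∈ Ω →
      |sdist Ω E a - sdist Ω E b| ≤ dist a b := by
    intro a b ha hb hbΩ
    obtain ⟨z, hz, h⟩ := exists_mem_frontier_between ha hb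
    rw [hE.sdist_of_mem ha, hE.sdist_of_notMem hbΩ hb, sub_neg_eq_add,
      abs_of_nonneg (add_nonneg infDist_nonneg infDist_nonneg), ← h]
    refine add_le_add (infDist_le_dist_of_mem hz) ?_
    rw [dist_comm]; exact infDist_le_dist_of_mem hz
  by_cases h1 : x ∈ E <;> by_cases h2 : y ∈ E
  · rwa [hE.sdist_of_mem h1, hE.sdist_of_mem h2]
  · exact cross x y h1 h2 hy
  · rw [abs_sub_comm, dist_comm]; exact cross y x h2 h1 hx
  · rw [hE.sdist_of_notMem hx h1, hE.sdist_of_notMem hy h2, neg_sub_neg, abs_sub_comm]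
    exact hl

lemma mem_tube_of_infDist_lt (hE : IsInterface Ω E δ) (hΓ : (frontier E).Nonempty) {x : Space n}
    (hx : infDist x (frontier E) < 5 * δ) : x ∈ tube Ω E δ := by
  have hxΩ : x ∈ Ω := hE.tube_subset <| by
    obtain ⟨y, hy, h⟩ := (infDist_lt_iff hΓ).1 hx
    exact mem_thickening_iff.2 ⟨y, hy, h⟩
  exact ⟨hxΩ, by rwa [hE.abs_sdist hxΩ]⟩

lemma frontier_subset_tube (hE : IsInterface Ω E δ) : frontier E ⊆ tube Ω E δ := fun x hx =>
  hE.mem_tube_of_infDist_lt ⟨x, hx⟩ (by rw [infDist_zero_of_mem hx]; linarith [hE.pos])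

lemma proj_spec (hE : IsInterface Ω E δ) {x : Space n} (hx : x ∈ tube Ω E δ) :
    proj E x ∈ frontier E ∧ dist x (proj E x) = infDist x (frontier E) :=
  Classical.epsilon_spec (p := fun y => y ∈ frontier E ∧ dist x y = infDist x (frontier E))
    (hE.existsUnique_proj x hx).exists

lemma proj_eq (hE : IsInterface Ω E δ) {x y : Space n} (hx : x ∈ tube Ω E δ)
    (hy : y ∈ frontier E) (h : dist x y = infDist x (frontier E)) : proj E x = y :=
  (hE.existsUnique_proj x hx).unique (hE.proj_spec hx) ⟨hy, h⟩

lemma mapsTo_proj (hE : IsInterface Ω E δ) : MapsTo (proj E) (tube Ω E δ) (tube Ω E δ) :=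
  fun _ hx => hE.frontier_subset_tube (hE.proj_spec hx).1

lemma proj_of_mem_frontier (hE : IsInterface Ω E δ) {x : Space n} (hx : x ∈ frontier E) :
    proj E x = x :=
  hE.proj_eq (hE.frontier_subset_tube hx) hx (by rw [infDist_zero_of_mem hx, dist_self])

lemma proj_proj (hE : IsInterface Ω E δ) {x : Space n} (hx : x ∈ tube Ω E δ) :
    proj E (proj E x) = proj E x := hE.proj_of_mem_frontier (hE.proj_spec hx).1

lemma dist_proj (hE : IsInterface Ω E δ) {x : Space n} (hx : x ∈ tube Ω E δ) :
    dist x (proj E x) = |sdist Ω E x| := by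
  rw [(hE.proj_spec hx).2, hE.abs_sdist hx.1]

/-- The normal segment from a point of the tube to its projection stays in the tube, projects to
the same point, and the signed distance is linear on it. -/
lemma segment_spec (hE : IsInterface Ω E δ) {x : Space n} (hx : x ∈ tube Ω E δ) {t : ℝ}
    (ht : t ∈ Icc (0 : ℝ) 1) :
    proj E x + t • (x - proj E x) ∈ tube Ω E δ ∧
      proj E (proj E x + t • (x - proj E x)) = proj E x ∧
      sdist Ω E (proj E x + t • (x - proj E x)) = t * sdist Ω E x := by
  obtain ⟨hy, hr⟩ := hE.proj_spec hx
  have hd := hE.dist_proj hx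
  set y := proj E x with hydef
  set r := infDist x (frontier E) with hrdef
  set xt := y + t • (x - y) with hxt
  have hr0 : 0 ≤ r := infDist_nonneg
  have h1 : dist xt y = t * r := by
    rw [hxt, dist_eq_norm, add_sub_cancel_left, norm_smul, ← dist_eq_norm, hr,
      Real.norm_eq_abs, abs_of_nonneg ht.1]
  have h2 : dist x xt = (1 - t) * r := by
    have : x - xt = (1 - t) • (x - y) := by rw [hxt]; module
    rw [dist_eq_norm, this, norm_smul, ← dist_eq_norm x y, hr, Real.norm_eq_abs,
      abs_of_nonneg (by linarith [ht.2])]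
  have h3 : infDist xt (frontier E) = t * r := by
    refine le_antisymm (h1 ▸ infDist_le_dist_of_mem hy) ?_
    have := infDist_le_infDist_add_dist (s := frontier E) (x := x) (y := xt)
    rw [h2] at this
    linarith
  have hr5 : r < 5 * δ := by rw [hrdef, ← hE.abs_sdist hx.1]; exact hx.2
  have hmem : xt ∈ tube Ω E δ := by
    refine hE.mem_tube_of_infDist_lt ⟨y, hy⟩ ?_
    rw [h3]; nlinarith [ht.1, ht.2]
  refine ⟨hmem, hE.proj_eq hmem hy (by rw [h1, h3]), ?_⟩
  have h4 := hE.abs_sdist_sub_le hx.1 hmem.1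
  have h5 := hE.abs_sdist hmem.1
  rw [h2] at h4
  rw [h3] at h5
  rw [hr] at hd
  rw [abs_le] at h4
  rcases abs_choice (sdist Ω E x) with h | h <;> rw [h] at hd
  · have := le_abs_self (sdist Ω E xt)
    rw [← hd]; nlinarith
  · have := neg_le_abs (sdist Ω E xt)
    have e : sdist Ω E x = - r := by linarith
    rw [e] at h4 ⊢; nlinarith

end IsInterface

/-- The normal field `ν = ∇d`. -/
noncomputable abbrev nu (Ω E : Set (Space n)) : Space n → Space n := gradient (sdist Ω E)

lemma contDiffOn_gradient {S : Set (Space n)} (hS : IsOpen S) {f : Space n → ℝ} {k m : ℕ∞}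
    (hf : ContDiffOn ℝ k f S) (hm : m + 1 ≤ k) : ContDiffOn ℝ m (gradient f) S :=
  (InnerProductSpace.toDual ℝ (Space n)).symm.contDiff.comp_contDiffOn
    (hf.fderiv_of_isOpen hS (by exact_mod_cast hm))

namespace IsInterface

lemma contDiffOn_nu (hE : IsInterface Ω E δ) : ContDiffOn ℝ 3 (nu Ω E) (tube Ω E δ) :=
  contDiffOn_gradient (k := 4) (m := 3) hE.isOpen_tube hE.contDiffOn_sdist (by norm_num)

lemma contDiffOn_normalDeriv (hE : IsInterface Ω E δ) :
    ContDiffOn ℝ 2 (normalDeriv Ω E) (tube Ω E δ) :=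
  hE.contDiffOn_nu.fderiv_of_isOpen hE.isOpen_tube (by norm_num)

lemma hasFDerivAt_nu (hE : IsInterface Ω E δ) {x : Space n} (hx : x ∈ tube Ω E δ) :
    HasFDerivAt (nu Ω E) (normalDeriv Ω E x) x :=
  ((hE.contDiffOn_nu.contDiffAt (hE.isOpen_tube.mem_nhds hx)).differentiableAt
    (by simp)).hasFDerivAt

lemma hasFDerivAt_sdist (hE : IsInterface Ω E δ) {x : Space n} (hx : x ∈ tube Ω E δ) :
    HasFDerivAt (sdist Ω E) (innerSL ℝ (nu Ω E x)) x := by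
  have h := ((hE.contDiffOn_sdist.contDiffAt (hE.isOpen_tube.mem_nhds hx)).differentiableAt
    (by simp)).hasFDerivAt
  have e : fderiv ℝ (sdist Ω E) x = innerSL ℝ (nu Ω E x) := by
    ext v; simp
  rwa [e] at h

lemma norm_nu_le (hE : IsInterface Ω E δ) {x : Space n} (hx : x ∈ tube Ω E δ) :
    ‖nu Ω E x‖ ≤ 1 := by
  have h : ‖innerSL ℝ (nu Ω E x)‖ ≤ (1 : NNReal) := by
    refine (hE.hasFDerivAt_sdist hx).le_of_lipschitzOn (hE.isOpen_tube.mem_nhds hx) ?_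
    refine LipschitzOnWith.of_dist_le_mul fun y hy z hz => ?_
    rw [Real.dist_eq, NNReal.coe_one, one_mul]
    exact hE.abs_sdist_sub_le hy.1 hz.1
  simpa using h

lemma inner_nu_sub_proj (hE : IsInterface Ω E δ) {x : Space n} (hx : x ∈ tube Ω E δ) :
    ⟪nu Ω E x, x - proj E x⟫_ℝ = sdist Ω E x := by
  set y := proj E x with hy
  have h0 : HasDerivAt (fun t : ℝ => y + t • (x - y)) (x - y) 1 := by
    simpa using ((hasDerivAt_id (1 : ℝ)).smul_const (x - y)).const_add y
  have e : y + (1 : ℝ) • (x - y) = x := by simp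
  have hd : HasFDerivAt (sdist Ω E) (innerSL ℝ (nu Ω E x)) (y + (1 : ℝ) • (x - y)) := by
    rw [e]; exact hE.hasFDerivAt_sdist hx
  have h1 := (hd.comp_hasDerivAt (1 : ℝ) h0).hasDerivWithinAt (s := Icc 0 1)
  have h2 : HasDerivWithinAt (fun t : ℝ => t * sdist Ω E x) (sdist Ω E x) (Icc 0 1) 1 := by
    simpa using ((hasDerivAt_id (1 : ℝ)).mul_const (sdist Ω E x)).hasDerivWithinAt
  have h3 := h1.congr (f₁ := fun t : ℝ => t * sdist Ω E x)
    (fun t ht => (hE.segment_spec hx ht).2.2.symm) (by simp)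
  have hu : UniqueDiffWithinAt ℝ (Icc (0 : ℝ) 1) 1 :=
    uniqueDiffOn_Icc zero_lt_one 1 (right_mem_Icc.2 zero_le_one)
  have := hu.eq_deriv _ h3 h2
  simpa using this

lemma sub_proj_eq (hE : IsInterface Ω E δ) {x : Space n} (hx : x ∈ tube Ω E δ) :
    x - proj E x = sdist Ω E x • nu Ω E x := by
  have h1 := hE.inner_nu_sub_proj hx
  have h2 := hE.norm_nu_le hx
  have h3 : ‖x - proj E x‖ = |sdist Ω E x| := by rw [← dist_eq_norm, hE.dist_proj hx]
  rw [← sub_eq_zero, ← norm_eq_zero]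
  have h4 : ‖x - proj E x - sdist Ω E x • nu Ω E x‖ ^ 2 ≤ 0 := by
    rw [norm_sub_sq_real, h3, inner_smul_right, real_inner_comm, h1, norm_smul, mul_pow,
      Real.norm_eq_abs, sq_abs]
    have : ‖nu Ω E x‖ ^ 2 ≤ 1 := pow_le_one₀ (norm_nonneg _) h2
    nlinarith [sq_nonneg (sdist Ω E x)]
  exact pow_eq_zero_iff (two_ne_zero) |>.1 (le_antisymm h4 (sq_nonneg _))

lemma proj_eq_sub (hE : IsInterface Ω E δ) {x : Space n} (hx : x ∈ tube Ω E δ) :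
    proj E x = x - sdist Ω E x • nu Ω E x := by
  rw [← hE.sub_proj_eq hx]; abel

/-- The eikonal equation. On the interface it follows by continuity from the phase `E`. -/
lemma norm_nu (hE : IsInterface Ω E δ) {x : Space n} (hx : x ∈ tube Ω E δ) :
    ‖nu Ω E x‖ = 1 := by
  have key : ∀ y ∈ tube Ω E δ, sdist Ω E y ≠ 0 → ‖nu Ω E y‖ = 1 := by
    intro y hy h
    have h1 : ‖y - proj E y‖ = |sdist Ω E y| := by rw [← dist_eq_norm, hE.dist_proj hy]
    rw [hE.sub_proj_eq hy, norm_smul, Real.norm_eq_abs] at h1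
    have := abs_pos.2 h
    nlinarith
  by_cases h : sdist Ω E x = 0
  · by_contra hne
    have hΓ := (hE.sdist_eq_zero_iff hx.1).1 h
    have hc : ContinuousAt (fun y => ‖nu Ω E y‖) x :=
      (hE.contDiffOn_nu.continuousOn.continuousAt (hE.isOpen_tube.mem_nhds hx)).norm
    have h1 := hc.eventually_ne hne
    have h2 : ∃ᶠ y in 𝓝 x, y ∈ E := mem_closure_iff_frequently.1 (frontier_subset_closure hΓ)
    obtain ⟨y, hy, hy1, hy2⟩ := (h2.and_eventually
      (h1.and (hE.isOpen_tube.mem_nhds hx))).exists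
    exact hy1 (key y hy2 (hE.sdist_pos hy).ne')
  · exact key x hx h

/-- The normal field is constant in normal direction. -/
lemma nu_proj (hE : IsInterface Ω E δ) {x : Space n} (hx : x ∈ tube Ω E δ) :
    nu Ω E (proj E x) = nu Ω E x := by
  by_cases h : sdist Ω E x = 0
  · rw [hE.proj_of_mem_frontier ((hE.sdist_eq_zero_iff hx.1).1 h)]
  set y := proj E x with hy
  have hc : ContinuousAt (nu Ω E) y := hE.contDiffOn_nu.continuousOn.continuousAt
    (hE.isOpen_tube.mem_nhds (hE.mapsTo_proj hx))
  have hlim : Tendsto (fun t : ℝ => nu Ω E (y + t • (x - y))) (𝓝[>] 0) (𝓝 (nu Ω E y)) := by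
    have h0 : Tendsto (fun t : ℝ => y + t • (x - y)) (𝓝[>] 0) (𝓝 y) := by
      have : Continuous fun t : ℝ => y + t • (x - y) := by fun_prop
      simpa using (this.tendsto 0).mono_left nhdsWithin_le_nhds
    exact hc.tendsto.comp h0
  have hev : (fun t : ℝ => nu Ω E (y + t • (x - y))) =ᶠ[𝓝[>] 0] fun _ => nu Ω E x := by
    filter_upwards [Ioo_mem_nhdsGT (zero_lt_one (α := ℝ))] with t ht
    obtain ⟨h1, h2, h3⟩ := hE.segment_spec hx ⟨ht.1.le, ht.2.le⟩
    have h4 := hE.sub_proj_eq h1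
    rw [← hy] at h1 h2 h3 h4
    have h5 : y + t • (x - y) - y = (t * sdist Ω E x) • nu Ω E x := by
      rw [add_sub_cancel_left, hE.sub_proj_eq hx, smul_smul]
    rw [h2, h3, h5] at h4
    exact (smul_right_injective _ (mul_ne_zero ht.1.ne' h) h4).symm
  exact tendsto_nhds_unique (hlim.congr' hev) tendsto_const_nhds

end IsInterface

/-! ### Curvature of the level sets of the signed distance -/

lemma norm_apply_le_of_norm_le {V W : Type*} [NormedAddCommGroup V] [NormedSpace ℝ V]
    [NormedAddCommGroup W] [NormedSpace ℝ W] {A : V →L[ℝ] W} {C : ℝ} (h : ‖A‖ ≤ C) (v : V) :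
    ‖A v‖ ≤ C * ‖v‖ := A.le_of_opNorm_le h v

namespace IsInterface

lemma hasFDerivAt_inner_nu (hE : IsInterface Ω E δ) {x : Space n} (hx : x ∈ tube Ω E δ)
    (b : Space n) :
    HasFDerivAt (fun y => ⟪nu Ω E y, b⟫_ℝ) ((innerSL ℝ b).comp (normalDeriv Ω E x)) x := by
  have h := ((innerSL ℝ b).hasFDerivAt (x := nu Ω E x)).comp x (hE.hasFDerivAt_nu hx)
  refine h.congr_of_eventuallyEq (Eventually.of_forall fun y => ?_)
  simp

lemma fderiv_fderiv_sdist (hE : IsInterface Ω E δ) {x : Space n} (hx : x ∈ tube Ω E δ)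
    (a b : Space n) :
    fderiv ℝ (fderiv ℝ (sdist Ω E)) x a b = ⟪normalDeriv Ω E x a, b⟫_ℝ := by
  have h2 : ContDiffOn ℝ 2 (sdist Ω E) (tube Ω E δ) := hE.contDiffOn_sdist.of_le (by norm_num)
  have h := (hasFDerivAt_fderiv_of_contDiffOn_two hE.isOpen_tube h2 hx).clm_apply
    (hasFDerivAt_const b x)
  have e : (fun y => fderiv ℝ (sdist Ω E) y b) = fun y => ⟪nu Ω E y, b⟫_ℝ := by
    ext y; rw [nu, inner_gradient_eq]
  rw [e] at h
  have := congrArg (fun L : Space n →L[ℝ] ℝ => L a) (h.unique (hE.hasFDerivAt_inner_nu hx b))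
  simpa [real_inner_comm] using this

lemma normalDeriv_symm (hE : IsInterface Ω E δ) {x : Space n} (hx : x ∈ tube Ω E δ)
    (a b : Space n) : ⟪normalDeriv Ω E x a, b⟫_ℝ = ⟪a, normalDeriv Ω E x b⟫_ℝ := by
  rw [real_inner_comm (normalDeriv Ω E x b), ← hE.fderiv_fderiv_sdist hx,
    ← hE.fderiv_fderiv_sdist hx]
  exact ((hE.contDiffOn_sdist.contDiffAt (hE.isOpen_tube.mem_nhds hx)).isSymmSndFDerivAt
    (by simp; norm_num)) a b

lemma normalDeriv_nu (hE : IsInterface Ω E δ) {x : Space n} (hx : x ∈ tube Ω E δ) :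
    normalDeriv Ω E x (nu Ω E x) = 0 := by
  have h := (hE.hasFDerivAt_nu hx).inner ℝ (hE.hasFDerivAt_nu hx)
  have h1 : (fun y => ⟪nu Ω E y, nu Ω E y⟫_ℝ) =ᶠ[𝓝 x] fun _ => (1 : ℝ) := by
    filter_upwards [hE.isOpen_tube.mem_nhds hx] with y hy
    rw [real_inner_self_eq_norm_sq, hE.norm_nu hy, one_pow]
  have h2 := (h.congr_of_eventuallyEq h1.symm).unique (hasFDerivAt_const (1 : ℝ) x)
  refine ext_inner_right ℝ fun a => ?_
  have h3 := congrArg (fun L : Space n →L[ℝ] ℝ => L a) h2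
  simp only [comp_apply, prod_apply, fderivInnerCLM_apply, zero_apply] at h3
  rw [hE.normalDeriv_symm hx, inner_zero_left]
  linarith [real_inner_comm (nu Ω E x) (normalDeriv Ω E x a)]

/-- The differential of the nearest point projection. -/
lemma hasFDerivAt_proj (hE : IsInterface Ω E δ) {x : Space n} (hx : x ∈ tube Ω E δ) :
    HasFDerivAt (proj E) (ContinuousLinearMap.id ℝ (Space n) -
      (sdist Ω E x • normalDeriv Ω E x + (innerSL ℝ (nu Ω E x)).smulRight (nu Ω E x))) x := by
  refine ((hasFDerivAt_id x).sub
    ((hE.hasFDerivAt_sdist hx).smul (hE.hasFDerivAt_nu hx))).congr_of_eventuallyEq ?_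
  filter_upwards [hE.isOpen_tube.mem_nhds hx] with y hy using hE.proj_eq_sub hy

lemma fderiv_proj_apply (hE : IsInterface Ω E δ) {x : Space n} (hx : x ∈ tube Ω E δ)
    (e : Space n) : fderiv ℝ (proj E) x e
      = e - (sdist Ω E x • normalDeriv Ω E x e + ⟪nu Ω E x, e⟫_ℝ • nu Ω E x) := by
  rw [(hE.hasFDerivAt_proj hx).fderiv]; simp

lemma contDiffOn_proj (hE : IsInterface Ω E δ) : ContDiffOn ℝ 3 (proj E) (tube Ω E δ) :=
  (contDiffOn_id.sub ((hE.contDiffOn_sdist.of_le (by norm_num)).smul hE.contDiffOn_nu)).congr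
    fun _ hx => hE.proj_eq_sub hx

lemma contDiffOn_two_proj (hE : IsInterface Ω E δ) : ContDiffOn ℝ 2 (proj E) (tube Ω E δ) :=
  hE.contDiffOn_proj.of_le (by norm_num)

lemma fderiv_proj_nu (hE : IsInterface Ω E δ) {x : Space n} (hx : x ∈ tube Ω E δ) :
    fderiv ℝ (proj E) x (nu Ω E x) = 0 := by
  rw [hE.fderiv_proj_apply hx, hE.normalDeriv_nu hx, real_inner_self_eq_norm_sq, hE.norm_nu hx]
  simp

/-- The Riccati equation `Dν(x) + d(x) Dν(y) Dν(x) = Dν(y)`, `y = Π(x)`, in integrated form: it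
expresses the curvature of the parallel surfaces through that of `Γ`. -/
lemma normalDeriv_riccati (hE : IsInterface Ω E δ) {x : Space n} (hx : x ∈ tube Ω E δ)
    (e : Space n) : normalDeriv Ω E x e
      + sdist Ω E x • normalDeriv Ω E (proj E x) (normalDeriv Ω E x e)
      = normalDeriv Ω E (proj E x) e := by
  have h1 : HasFDerivAt (fun y => nu Ω E (proj E y))
      ((normalDeriv Ω E (proj E x)).comp (fderiv ℝ (proj E) x)) x :=
    (hE.hasFDerivAt_nu (hE.mapsTo_proj hx)).comp x
      ((hE.hasFDerivAt_proj hx).differentiableAt.hasFDerivAt)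
  have h2 : (fun y => nu Ω E (proj E y)) =ᶠ[𝓝 x] nu Ω E := by
    filter_upwards [hE.isOpen_tube.mem_nhds hx] with y hy using hE.nu_proj hy
  have h3 := (h1.congr_of_eventuallyEq h2.symm).unique (hE.hasFDerivAt_nu hx)
  have h4 : normalDeriv Ω E (proj E x) (nu Ω E x) = 0 := by
    rw [← hE.nu_proj hx]; exact hE.normalDeriv_nu (hE.mapsTo_proj hx)
  have h5 := congrArg (fun L : Space n →L[ℝ] Space n => L e) h3
  simp only [comp_apply, hE.fderiv_proj_apply hx, map_sub, map_add, map_smul, h4, smul_zero,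
    add_zero] at h5
  exact eq_sub_iff_add_eq.1 h5.symm

/-- By compactness, the lower bound on the Jacobian bounds the inverses of `I + s Dν(y)`. -/
lemma exists_inverse_bound (hE : IsInterface Ω E δ) : ∃ c > 0, ∀ y ∈ frontier E,
    ∀ s ∈ Icc (-(5 * δ)) (5 * δ), ∀ w : Space n, c * ‖w‖ ≤ ‖w + s • normalDeriv Ω E y w‖ := by
  have hN : ContinuousOn (normalDeriv Ω E) (frontier E) :=
    hE.contDiffOn_normalDeriv.continuousOn.mono hE.frontier_subset_tube
  have hdet : ∀ y ∈ frontier E, ∀ s ∈ Icc (-(5 * δ)) (5 * δ),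
      (ContinuousLinearMap.id ℝ (Space n) + s • normalDeriv Ω E y).det ≠ 0 := by
    intro y hy s hs
    have hc : Continuous fun s : ℝ =>
        (ContinuousLinearMap.id ℝ (Space n) + s • normalDeriv Ω E y).det :=
      ContinuousLinearMap.continuous_det.comp (by fun_prop)
    have hcl : IsClosed {s : ℝ | 1 / 2 ≤
        (ContinuousLinearMap.id ℝ (Space n) + s • normalDeriv Ω E y).det} :=
      isClosed_le continuous_const hc
    have hsub := hcl.closure_subset_iff.2 fun s hs => (hE.jacobian_mem y hy s hs).1
    rw [closure_Ioo (by linarith [hE.pos])] at hsub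
    have : (1 : ℝ) / 2 ≤ _ := hsub hs
    exact ((by norm_num : (0 : ℝ) < 1 / 2).trans_le this).ne'
  have hK : IsCompact (frontier E ×ˢ (Icc (-(5 * δ)) (5 * δ) ×ˢ sphere (0 : Space n) 1)) :=
    hE.isCompact_frontier.prod (isCompact_Icc.prod (isCompact_sphere 0 1))
  have hcont : ContinuousOn (fun q : Space n × ℝ × Space n =>
      ‖q.2.2 + q.2.1 • normalDeriv Ω E q.1 q.2.2‖)
      (frontier E ×ˢ (Icc (-(5 * δ)) (5 * δ) ×ˢ sphere (0 : Space n) 1)) := by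
    have h1 : ContinuousOn (fun q : Space n × ℝ × Space n => normalDeriv Ω E q.1)
        (frontier E ×ˢ (Icc (-(5 * δ)) (5 * δ) ×ˢ sphere (0 : Space n) 1)) :=
      hN.comp continuousOn_fst fun q hq => hq.1
    have h2 : ContinuousOn (fun q : Space n × ℝ × Space n => normalDeriv Ω E q.1 q.2.2)
        (frontier E ×ˢ (Icc (-(5 * δ)) (5 * δ) ×ˢ sphere (0 : Space n) 1)) :=
      h1.clm_apply (by fun_prop)
    fun_prop
  obtain ⟨c, hc, hle⟩ := hK.exists_forall_le' (a := 0) hcont fun q hq => by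
    rw [norm_pos_iff]
    intro h0
    have hinj := (LinearMap.equivOfDetNeZero _ (hdet q.1 hq.1 q.2.1 hq.2.1)).injective
    have h3 : q.2.2 = 0 := hinj (by
      rw [map_zero]
      simpa [LinearMap.equivOfDetNeZero] using h0)
    have h4 : ‖q.2.2‖ = 1 := by simpa using hq.2.2
    rw [h3] at h4; simp at h4
  refine ⟨c, hc, fun y hy s hs w => ?_⟩
  by_cases hw : w = 0
  · simp [hw]
  have hw' : 0 < ‖w‖ := norm_pos_iff.2 hw
  have h1 := hle (y, s, ‖w‖⁻¹ • w) ⟨hy, hs, by simp [norm_smul, hw'.ne']⟩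
  have e : ‖w‖⁻¹ • w + s • normalDeriv Ω E y (‖w‖⁻¹ • w)
      = ‖w‖⁻¹ • (w + s • normalDeriv Ω E y w) := by
    rw [map_smul, smul_add, smul_comm]
  simp only [e, norm_smul, norm_inv, norm_norm] at h1
  rw [inv_mul_eq_div, le_div_iff₀ hw'] at h1
  exact h1

lemma sdist_mem_Icc {x : Space n} (hx : x ∈ tube Ω E δ) :
    sdist Ω E x ∈ Icc (-(5 * δ)) (5 * δ) := ⟨(abs_lt.1 hx.2).1.le, (abs_lt.1 hx.2).2.le⟩

lemma exists_bound_frontier (hE : IsInterface Ω E δ) {V : Type*} [NormedAddCommGroup V]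
    {f : Space n → V} (hf : ContinuousOn f (tube Ω E δ)) :
    ∃ C, 0 ≤ C ∧ ∀ x ∈ tube Ω E δ, ‖f (proj E x)‖ ≤ C := by
  obtain ⟨C, hC⟩ := hE.isCompact_frontier.exists_bound_of_continuousOn
    (hf.mono hE.frontier_subset_tube)
  exact ⟨max C 0, le_max_right _ _,
    fun x hx => (hC _ (hE.proj_spec hx).1).trans (le_max_left _ _)⟩

/-- The curvature of the parallel surfaces is bounded up to the boundary of the tube. -/
lemma exists_normalDeriv_bound (hE : IsInterface Ω E δ) :
    ∃ C, 0 ≤ C ∧ ∀ x ∈ tube Ω E δ, ‖normalDeriv Ω E x‖ ≤ C ∧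
      ‖normalDeriv Ω E (proj E x)‖ ≤ C ∧ ‖fderiv ℝ (proj E) x‖ ≤ C := by
  obtain ⟨c, hc, hinv⟩ := hE.exists_inverse_bound
  obtain ⟨M, hM0, hM⟩ := hE.exists_bound_frontier hE.contDiffOn_normalDeriv.continuousOn
  have hδ := hE.pos
  have hN : ∀ x ∈ tube Ω E δ, ‖normalDeriv Ω E x‖ ≤ M / c := fun x hx => by
    refine opNorm_le_bound _ (by positivity) fun e => ?_
    have h1 := hinv _ (hE.proj_spec hx).1 _ (sdist_mem_Icc hx) (normalDeriv Ω E x e)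
    rw [hE.normalDeriv_riccati hx] at h1
    rw [div_mul_eq_mul_div, le_div_iff₀ hc, mul_comm]
    exact h1.trans (norm_apply_le_of_norm_le (hM x hx) e)
  refine ⟨M / c + M + (2 + 5 * δ * (M / c)), by positivity, fun x hx => ⟨?_, ?_, ?_⟩⟩
  · have := hN x hx
    have : 0 ≤ M + (2 + 5 * δ * (M / c)) := by positivity
    linarith [hN x hx]
  · have : 0 ≤ M / c + (2 + 5 * δ * (M / c)) := by positivity
    linarith [hM x hx]
  · refine opNorm_le_bound _ (by positivity) fun e => ?_
    rw [hE.fderiv_proj_apply hx]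
    have h1 : ‖sdist Ω E x • normalDeriv Ω E x e‖ ≤ 5 * δ * (M / c * ‖e‖) := by
      rw [norm_smul, Real.norm_eq_abs]
      exact mul_le_mul hx.2.le (norm_apply_le_of_norm_le (hN x hx) e) (norm_nonneg _)
        (by positivity)
    have h2 : ‖⟪nu Ω E x, e⟫_ℝ • nu Ω E x‖ ≤ ‖e‖ := by
      rw [norm_smul, hE.norm_nu hx, mul_one]
      simpa [hE.norm_nu hx] using norm_inner_le_norm (𝕜 := ℝ) (nu Ω E x) e
    have h3 := norm_sub_le e (sdist Ω E x • normalDeriv Ω E x e + ⟪nu Ω E x, e⟫_ℝ • nu Ω E x)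
    have h4 := norm_add_le (sdist Ω E x • normalDeriv Ω E x e) (⟪nu Ω E x, e⟫_ℝ • nu Ω E x)
    have h5 : 0 ≤ (M / c + M) * ‖e‖ := by positivity
    linarith

lemma hasFDerivAt_normalDeriv (hE : IsInterface Ω E δ) {x : Space n} (hx : x ∈ tube Ω E δ) :
    HasFDerivAt (normalDeriv Ω E) (fderiv ℝ (normalDeriv Ω E) x) x :=
  ((hE.contDiffOn_normalDeriv.contDiffAt (hE.isOpen_tube.mem_nhds hx)).differentiableAt
    (by simp)).hasFDerivAt

/-- The derivative of the curvature is bounded in the tube: differentiate the Riccati equation. -/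
lemma exists_fderiv_normalDeriv_bound (hE : IsInterface Ω E δ) :
    ∃ C, 0 ≤ C ∧ ∀ x ∈ tube Ω E δ, ∀ a e,
      ‖fderiv ℝ (normalDeriv Ω E) x a e‖ ≤ C * (‖a‖ * ‖e‖) := by
  obtain ⟨c, hc, hinv⟩ := hE.exists_inverse_bound
  obtain ⟨C, hC0, hC⟩ := hE.exists_normalDeriv_bound
  obtain ⟨M, hM0, hM⟩ := hE.exists_bound_frontier
    (hE.contDiffOn_normalDeriv.continuousOn_fderiv_of_isOpen hE.isOpen_tube (by norm_num))
  have hδ := hE.pos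
  refine ⟨(M * C + C * C + 5 * δ * (M * C * C)) / c, by positivity, fun x hx a e => ?_⟩
  obtain ⟨hC1, hC2, hC3⟩ := hC x hx
  have hMx := hM x hx
  set y := proj E x with hy
  have hP := (hE.hasFDerivAt_proj hx).differentiableAt.hasFDerivAt
  have hNx : HasFDerivAt (fun y => normalDeriv Ω E y e) _ x :=
    (hE.hasFDerivAt_normalDeriv hx).clm_apply (hasFDerivAt_const e x)
  have hNy := (hE.hasFDerivAt_normalDeriv (hE.mapsTo_proj hx)).comp x hP
  have hL := hNx.add ((hE.hasFDerivAt_sdist hx).smul (hNy.clm_apply hNx))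
  have hR := hNy.clm_apply (hasFDerivAt_const e x)
  have hev : (fun z => normalDeriv Ω E z e + sdist Ω E z •
      normalDeriv Ω E (proj E z) (normalDeriv Ω E z e)) =ᶠ[𝓝 x]
      fun z => normalDeriv Ω E (proj E z) e := by
    filter_upwards [hE.isOpen_tube.mem_nhds hx] with z hz using hE.normalDeriv_riccati hz e
  have h1 := congrArg (fun L : Space n →L[ℝ] Space n => L a)
    ((hR.congr_of_eventuallyEq hev).unique hL)
  simp only [Function.comp_apply, add_apply, comp_apply, flip_apply, smul_apply,
    smulRight_apply, _root_.zero_apply, map_zero, zero_add, innerSL_apply_apply, ← hy] at h1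
  set D := fderiv ℝ (normalDeriv Ω E) x a e with hD
  set DM := fderiv ℝ (normalDeriv Ω E) y (fderiv ℝ (proj E) x a) with hDM
  have hDMle : ‖DM‖ ≤ M * (C * ‖a‖) :=
    (norm_apply_le_of_norm_le hMx _).trans
      (mul_le_mul_of_nonneg_left (norm_apply_le_of_norm_le hC3 a) hM0)
  have k1 := hinv y (hE.proj_spec hx).1 _ (sdist_mem_Icc hx) D
  have k2 : D + sdist Ω E x • normalDeriv Ω E y D = DM e
      - (sdist Ω E x • DM (normalDeriv Ω E x e)
        + ⟪nu Ω E x, a⟫_ℝ • normalDeriv Ω E y (normalDeriv Ω E x e)) := by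
    rw [h1]; module
  rw [k2] at k1
  have k3 : ‖DM e‖ ≤ M * (C * ‖a‖) * ‖e‖ := norm_apply_le_of_norm_le hDMle e
  have kN : ‖normalDeriv Ω E x e‖ ≤ C * ‖e‖ := norm_apply_le_of_norm_le hC1 e
  have k4 : ‖sdist Ω E x • DM (normalDeriv Ω E x e)‖ ≤
      5 * δ * (M * (C * ‖a‖) * (C * ‖e‖)) := by
    rw [norm_smul, Real.norm_eq_abs]
    refine mul_le_mul hx.2.le ((norm_apply_le_of_norm_le hDMle _).trans ?_) (norm_nonneg _)
      (by positivity)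
    gcongr
  have k5 : ‖⟪nu Ω E x, a⟫_ℝ • normalDeriv Ω E y (normalDeriv Ω E x e)‖
      ≤ ‖a‖ * (C * (C * ‖e‖)) := by
    rw [norm_smul]
    refine mul_le_mul (by simpa [hE.norm_nu hx] using norm_inner_le_norm (𝕜 := ℝ) (nu Ω E x) a)
      ((norm_apply_le_of_norm_le hC2 _).trans ?_) (norm_nonneg _) (norm_nonneg _)
    gcongr
  have k6 := norm_sub_le (DM e) (sdist Ω E x • DM (normalDeriv Ω E x e)
        + ⟪nu Ω E x, a⟫_ℝ • normalDeriv Ω E y (normalDeriv Ω E x e))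
  have k7 := norm_add_le (sdist Ω E x • DM (normalDeriv Ω E x e))
    (⟪nu Ω E x, a⟫_ℝ • normalDeriv Ω E y (normalDeriv Ω E x e))
  rw [div_mul_eq_mul_div, le_div_iff₀ hc, mul_comm]
  linarith

/-- The projection has bounded derivatives up to second order in the tube. -/
lemma exists_proj_bound (hE : IsInterface Ω E δ) :
    ∃ C, (∀ x ∈ tube Ω E δ, ‖fderiv ℝ (proj E) x‖ ≤ C) ∧
      ∀ x ∈ tube Ω E δ, ‖fderiv ℝ (fderiv ℝ (proj E)) x‖ ≤ C := by
  obtain ⟨C, hC0, hC⟩ := hE.exists_normalDeriv_bound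
  obtain ⟨D, hD0, hD⟩ := hE.exists_fderiv_normalDeriv_bound
  have hδ := hE.pos
  refine ⟨C + (3 * C + 5 * δ * D), fun x hx => (hC x hx).2.2.trans
    (le_add_of_nonneg_right (by positivity)), fun x hx => ?_⟩
  refine opNorm_le_bound₂ _ (by positivity) fun a e => ?_
  have h1 : HasFDerivAt (fun y => fderiv ℝ (proj E) y e)
      (((fderiv ℝ (fderiv ℝ (proj E)) x).flip e)) x := by
    have hP : HasFDerivAt (fderiv ℝ (proj E)) (fderiv ℝ (fderiv ℝ (proj E)) x) x :=
      (((hE.contDiffOn_two_proj.fderiv_of_isOpen hE.isOpen_tube (m := 1) (by norm_num)).contDiffAt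
        (hE.isOpen_tube.mem_nhds hx)).differentiableAt one_ne_zero).hasFDerivAt
    simpa using hP.clm_apply (hasFDerivAt_const e x)
  have hNx : HasFDerivAt (fun y => normalDeriv Ω E y e) _ x :=
    (hE.hasFDerivAt_normalDeriv hx).clm_apply (hasFDerivAt_const e x)
  have h2 := (hasFDerivAt_const e x).sub (((hE.hasFDerivAt_sdist hx).smul hNx).add
    ((hE.hasFDerivAt_inner_nu hx e).smul (hE.hasFDerivAt_nu hx)))
  have hev : (fun y => fderiv ℝ (proj E) y e) =ᶠ[𝓝 x] fun y =>
      e - (sdist Ω E y • normalDeriv Ω E y e + ⟪nu Ω E y, e⟫_ℝ • nu Ω E y) := by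
    filter_upwards [hE.isOpen_tube.mem_nhds hx] with y hy using hE.fderiv_proj_apply hy e
  have h3 := congrArg (fun L : Space n →L[ℝ] Space n => L a)
    (h1.unique (h2.congr_of_eventuallyEq hev))
  simp only [add_apply, comp_apply, flip_apply, smul_apply, smulRight_apply,
    _root_.zero_apply, map_zero, zero_add, zero_sub, neg_apply,
    innerSL_apply_apply] at h3
  rw [h3, norm_neg]
  have hNl : ∀ b, ‖normalDeriv Ω E x b‖ ≤ C * ‖b‖ := norm_apply_le_of_norm_le (hC x hx).1
  have hν : ∀ b, ‖⟪nu Ω E x, b⟫_ℝ‖ ≤ ‖b‖ := fun b => by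
    simpa [hE.norm_nu hx] using norm_inner_le_norm (𝕜 := ℝ) (nu Ω E x) b
  have k1 : ‖sdist Ω E x • fderiv ℝ (normalDeriv Ω E) x a e‖ ≤ 5 * δ * (D * (‖a‖ * ‖e‖)) := by
    rw [norm_smul, Real.norm_eq_abs]
    exact mul_le_mul hx.2.le (hD x hx a e) (norm_nonneg _) (by positivity)
  have k2 : ‖⟪nu Ω E x, a⟫_ℝ • normalDeriv Ω E x e‖ ≤ ‖a‖ * (C * ‖e‖) := by
    rw [norm_smul]
    exact mul_le_mul (hν a) (hNl e) (norm_nonneg _) (norm_nonneg _)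
  have k3 : ‖⟪nu Ω E x, e⟫_ℝ • normalDeriv Ω E x a‖ ≤ ‖e‖ * (C * ‖a‖) := by
    rw [norm_smul]
    exact mul_le_mul (hν e) (hNl a) (norm_nonneg _) (norm_nonneg _)
  have k4 : ‖⟪e, normalDeriv Ω E x a⟫_ℝ • nu Ω E x‖ ≤ ‖e‖ * (C * ‖a‖) := by
    rw [norm_smul, hE.norm_nu hx, mul_one]
    exact (norm_inner_le_norm _ _).trans (by gcongr; exact hNl a)
  refine (norm_add_le _ _).trans ((add_le_add (norm_add_le _ _) (norm_add_le _ _)).trans ?_)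
  have : 0 ≤ C * ‖a‖ * ‖e‖ := by positivity
  nlinarith

/-- A `C²` function on the tube, composed with the projection, has bounded derivatives. -/
lemma isBddC2_comp_proj (hE : IsInterface Ω E δ) {f : Space n → ℝ}
    (hf : ContDiffOn ℝ 2 f (tube Ω E δ)) : IsBddC2 (tube Ω E δ) fun x => f (proj E x) := by
  have hS := hE.isOpen_tube
  have hP := hE.contDiffOn_two_proj
  obtain ⟨C, h1, h2⟩ := hE.exists_proj_bound
  obtain ⟨A, hA0, hA⟩ := hE.exists_bound_frontier hf.continuousOn
  obtain ⟨B, hB0, hB⟩ := hE.exists_bound_frontier (contDiffOn_fderiv hS hf).continuousOn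
  obtain ⟨D, hD0, hD⟩ := hE.exists_bound_frontier (V := Space n →L[ℝ] Space n →L[ℝ] ℝ)
    (continuousOn_fderiv_fderiv hS hf)
  refine ⟨hf.comp hP hE.mapsTo_proj, A + C * B + (C ^ 2 * D + C * B), fun x hx => ?_⟩
  have hC : 0 ≤ C := (norm_nonneg _).trans (h1 x hx)
  refine ⟨(hA x hx).trans ?_,
    (norm_fderiv_comp_le hS hP hE.mapsTo_proj hf hx (h1 x hx)).trans ?_,
    (norm_fderiv_fderiv_comp_le hS hP hE.mapsTo_proj hf hx (h1 x hx) (h2 x hx)).trans ?_⟩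
  · have : 0 ≤ C * B + (C ^ 2 * D + C * B) := by positivity
    linarith
  · have h3 := mul_le_mul_of_nonneg_left (hB x hx) hC
    have : 0 ≤ A + (C ^ 2 * D + C * B) := by positivity
    linarith
  · have h3 := mul_le_mul_of_nonneg_left (hB x hx) hC
    have h4 := mul_le_mul_of_nonneg_left (hD x hx) (sq_nonneg C)
    have : 0 ≤ A + C * B := by positivity
    linarith

lemma meanCurv_eq_sum (y : Space n) : meanCurv Ω E y
    = ∑ i, ⟪EuclideanSpace.single i (1 : ℝ), normalDeriv Ω E y (EuclideanSpace.single i 1)⟫_ℝ := by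
  rw [meanCurv, LinearMap.trace_eq_sum_inner _ (EuclideanSpace.basisFun (Fin n) ℝ)]
  simp

lemma laplacian_sdist (hE : IsInterface Ω E δ) {x : Space n} (hx : x ∈ tube Ω E δ) :
    (Δ (sdist Ω E)) x = meanCurv Ω E x := by
  rw [laplacian_eq_sum, meanCurv_eq_sum]
  exact Finset.sum_congr rfl fun i _ => by rw [hE.fderiv_fderiv_sdist hx, real_inner_comm]

lemma contDiffOn_meanCurv (hE : IsInterface Ω E δ) :
    ContDiffOn ℝ 2 (meanCurv Ω E) (tube Ω E δ) := by
  have e : meanCurv Ω E = fun y => ∑ i, ⟪EuclideanSpace.single i (1 : ℝ),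
      normalDeriv Ω E y (EuclideanSpace.single i 1)⟫_ℝ := funext meanCurv_eq_sum
  rw [e]
  exact ContDiffOn.sum fun i _ => contDiffOn_const.inner ℝ
    (hE.contDiffOn_normalDeriv.clm_apply contDiffOn_const)

lemma contDiffOn_sqSecondFF (hE : IsInterface Ω E δ) :
    ContDiffOn ℝ 2 (sqSecondFF Ω E) (tube Ω E δ) :=
  ContDiffOn.sum fun _ _ => (hE.contDiffOn_normalDeriv.clm_apply contDiffOn_const).norm_sq ℝ

/-- Expansion of the mean curvature of the parallel surfaces in the distance to `Γ`. -/
lemma exists_laplacian_sdist_expansion (hE : IsInterface Ω E δ) :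
    ∃ C, 0 ≤ C ∧ ∀ x ∈ tube Ω E δ, |(Δ (sdist Ω E)) x| ≤ C ∧
      |(Δ (sdist Ω E)) x - meanCurv Ω E (proj E x)| ≤ C * |sdist Ω E x| ∧
      |(Δ (sdist Ω E)) x - (meanCurv Ω E (proj E x) - sdist Ω E x * sqSecondFF Ω E (proj E x))|
        ≤ C * sdist Ω E x ^ 2 := by
  obtain ⟨C, hC0, hC⟩ := hE.exists_normalDeriv_bound
  refine ⟨n * (C + C * C + C * (C * C)), by positivity, fun x hx => ?_⟩
  obtain ⟨hC1, hC2, -⟩ := hC x hx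
  have hy := hE.mapsTo_proj hx
  rw [hE.laplacian_sdist hx]
  set N := normalDeriv Ω E x
  set M := normalDeriv Ω E (proj E x) with hM
  set d := sdist Ω E x
  have hMN : ∀ e, M e - N e = d • M (N e) := fun e =>
    sub_eq_of_eq_add' (hE.normalDeriv_riccati hx e).symm
  have key : ∀ (g : Fin n → Space n) (B : ℝ), (∀ i, ‖g i‖ ≤ B) →
      |∑ i, ⟪EuclideanSpace.single i (1 : ℝ), g i⟫_ℝ| ≤ n * B := by
    intro g B hg
    refine (Finset.abs_sum_le_sum_abs _ _).trans ((Finset.sum_le_card_nsmul _ _ B fun i _ =>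
      ?_).trans (le_of_eq (by simp)))
    refine (abs_real_inner_le_norm _ _).trans ?_
    simpa using hg i
  have hNb : ∀ i, ‖N (EuclideanSpace.single i 1)‖ ≤ C := fun i => by
    simpa using norm_apply_le_of_norm_le hC1 (EuclideanSpace.single i (1 : ℝ))
  have hMNb : ∀ i, ‖M (N (EuclideanSpace.single i 1))‖ ≤ C * C := fun i =>
    (norm_apply_le_of_norm_le hC2 _).trans (mul_le_mul_of_nonneg_left (hNb i) hC0)
  have hMMNb : ∀ i, ‖M (M (N (EuclideanSpace.single i 1)))‖ ≤ C * (C * C) := fun i =>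
    (norm_apply_le_of_norm_le hC2 _).trans (mul_le_mul_of_nonneg_left (hMNb i) hC0)
  have e1 : meanCurv Ω E x - meanCurv Ω E (proj E x)
      = - d * ∑ i, ⟪EuclideanSpace.single i (1 : ℝ), M (N (EuclideanSpace.single i 1))⟫_ℝ := by
    rw [meanCurv_eq_sum, meanCurv_eq_sum, ← Finset.sum_sub_distrib, Finset.mul_sum]
    refine Finset.sum_congr rfl fun i _ => ?_
    rw [← inner_sub_right]
    change ⟪_, N _ - M _⟫_ℝ = _
    rw [← neg_sub, hMN, inner_neg_right, inner_smul_right, neg_mul]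
  have e2 : sqSecondFF Ω E (proj E x) - ∑ i, ⟪EuclideanSpace.single i (1 : ℝ),
        M (N (EuclideanSpace.single i 1))⟫_ℝ
      = d * ∑ i, ⟪EuclideanSpace.single i (1 : ℝ),
        M (M (N (EuclideanSpace.single i 1)))⟫_ℝ := by
    rw [sqSecondFF, ← Finset.sum_sub_distrib, Finset.mul_sum]
    refine Finset.sum_congr rfl fun i _ => ?_
    rw [← real_inner_self_eq_norm_sq, hE.normalDeriv_symm hy, ← inner_sub_right, ← hM,
      ← map_sub, hMN, map_smul, inner_smul_right]
  refine ⟨?_, ?_, ?_⟩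
  · rw [meanCurv_eq_sum]
    refine (key _ C hNb).trans ?_
    gcongr
    have : 0 ≤ C * C + C * (C * C) := by positivity
    linarith
  · rw [e1, abs_mul, abs_neg, mul_comm]
    gcongr
    refine (key _ _ hMNb).trans ?_
    gcongr
    have : 0 ≤ C + C * (C * C) := by positivity
    linarith
  · have e3 : meanCurv Ω E x - (meanCurv Ω E (proj E x) - d * sqSecondFF Ω E (proj E x))
        = d ^ 2 * ∑ i, ⟪EuclideanSpace.single i (1 : ℝ),
          M (M (N (EuclideanSpace.single i 1)))⟫_ℝ := by
      linear_combination e1 + d * e2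
    rw [e3, abs_mul, abs_of_nonneg (sq_nonneg d), mul_comm]
    gcongr
    refine (key _ _ hMMNb).trans ?_
    gcongr
    have : 0 ≤ C + C * C := by positivity
    linarith

end IsInterface

/-! ### The Laplacian in Fermi coordinates -/

lemma sum_inner_single_smul (w : Space n) :
    ∑ i, ⟪w, EuclideanSpace.single i (1 : ℝ)⟫_ℝ • EuclideanSpace.single i (1 : ℝ) = w := by
  have h := (EuclideanSpace.basisFun (Fin n) ℝ).sum_repr' w
  simp only [EuclideanSpace.basisFun_apply] at h
  simpa [real_inner_comm] using h

lemma sum_inner_single_sq (w : Space n) :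
    ∑ i, ⟪w, EuclideanSpace.single i (1 : ℝ)⟫_ℝ ^ 2 = ‖w‖ ^ 2 := by
  rw [EuclideanSpace.norm_sq_eq]
  simp [EuclideanSpace.inner_single_right]

section partial_derivatives
variable {S : Set (Space n)} {G : ℝ × Space n → ℝ}

lemma hasFDerivAt_joint (hS : IsOpen S) (hG : ContDiffOn ℝ 2 G (univ ×ˢ S)) {t : ℝ}
    {x : Space n} (hx : x ∈ S) : HasFDerivAt G (fderiv ℝ G (t, x)) (t, x) :=
  ((hG.contDiffAt ((isOpen_univ.prod hS).mem_nhds ⟨trivial, hx⟩)).differentiableAt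
    (by simp)).hasFDerivAt

lemma hasFDerivAt_fderiv_joint (hS : IsOpen S) (hG : ContDiffOn ℝ 2 G (univ ×ˢ S)) {t : ℝ}
    {x : Space n} (hx : x ∈ S) :
    HasFDerivAt (fderiv ℝ G) (fderiv ℝ (fderiv ℝ G) (t, x)) (t, x) :=
  (((hG.fderiv_of_isOpen (isOpen_univ.prod hS) (m := 1) (by norm_num)).contDiffAt
      ((isOpen_univ.prod hS).mem_nhds ⟨trivial, hx⟩)).differentiableAt one_ne_zero).hasFDerivAt

lemma contDiffOn_joint_right (hG : ContDiffOn ℝ 2 G (univ ×ˢ S)) (t : ℝ) :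
    ContDiffOn ℝ 2 (fun y => G (t, y)) S :=
  hG.comp (contDiffOn_const.prodMk contDiffOn_id) fun _ hy => ⟨trivial, hy⟩

lemma hasDerivAt_prodMk_left (t : ℝ) (x : Space n) :
    HasDerivAt (fun t : ℝ => ((t, x) : ℝ × Space n)) (1, 0) t :=
  (hasDerivAt_id t).prodMk (hasDerivAt_const t x)

lemma fderiv_joint_left (hS : IsOpen S) (hG : ContDiffOn ℝ 2 G (univ ×ˢ S)) {t g : ℝ}
    {x : Space n} (hx : x ∈ S) (h : HasDerivAt (fun s => G (s, x)) g t) :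
    fderiv ℝ G (t, x) (1, 0) = g :=
  (HasFDerivAt.comp_hasDerivAt (f := fun t : ℝ => ((t, x) : ℝ × Space n)) t
    (hasFDerivAt_joint hS hG hx) (hasDerivAt_prodMk_left t x)).unique h

/-- Differentiating `t ↦ DG (t, x) v`. -/
lemma fderiv_fderiv_joint_left (hS : IsOpen S) (hG : ContDiffOn ℝ 2 G (univ ×ˢ S)) {t g : ℝ}
    {x : Space n} (hx : x ∈ S) (v : ℝ × Space n)
    (h : HasDerivAt (fun s => fderiv ℝ G (s, x) v) g t) :
    fderiv ℝ (fderiv ℝ G) (t, x) (1, 0) v = g := by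
  have k1 := (HasFDerivAt.comp_hasDerivAt (f := fun t : ℝ => ((t, x) : ℝ × Space n)) t
    (hasFDerivAt_fderiv_joint hS hG hx) (hasDerivAt_prodMk_left t x)).clm_apply
    (hasDerivAt_const t v)
  have := HasDerivAt.unique k1 h
  simpa using this

lemma hasFDerivAt_prodMk_right (t : ℝ) (y : Space n) :
    HasFDerivAt (fun y => ((t, y) : ℝ × Space n))
      ((0 : Space n →L[ℝ] ℝ).prod (ContinuousLinearMap.id ℝ (Space n))) y :=
  (hasFDerivAt_const t y).prodMk (hasFDerivAt_id y)

lemma fderiv_joint_right (hS : IsOpen S) (hG : ContDiffOn ℝ 2 G (univ ×ˢ S)) {t : ℝ}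
    {x : Space n} (hx : x ∈ S) (e : Space n) :
    fderiv ℝ (fun y => G (t, y)) x e = fderiv ℝ G (t, x) (0, e) := by
  have h := HasFDerivAt.comp (f := fun y => ((t, y) : ℝ × Space n)) x
    (hasFDerivAt_joint hS hG hx) (hasFDerivAt_prodMk_right t x)
  refine (congrArg (fun L : Space n →L[ℝ] ℝ => L e) h.fderiv).trans ?_
  simp

lemma fderiv_fderiv_joint_right (hS : IsOpen S) (hG : ContDiffOn ℝ 2 G (univ ×ˢ S)) {t : ℝ}
    {x : Space n} (hx : x ∈ S) (e : Space n) :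
    fderiv ℝ (fderiv ℝ fun y => G (t, y)) x e e = fderiv ℝ (fderiv ℝ G) (t, x) (0, e) (0, e) := by
  have k1 := (hasFDerivAt_fderiv_of_contDiffOn_two hS (contDiffOn_joint_right hG t) hx).clm_apply
    (hasFDerivAt_const e x)
  have k2 := (HasFDerivAt.comp (f := fun y => ((t, y) : ℝ × Space n)) x
    (hasFDerivAt_fderiv_joint hS hG hx) (hasFDerivAt_prodMk_right t x)).clm_apply
    (hasFDerivAt_const ((0, e) : ℝ × Space n) x)
  have hev : (fun y => fderiv ℝ (fun y => G (t, y)) y e) =ᶠ[𝓝 x]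
      fun y => fderiv ℝ G (t, y) (0, e) := by
    filter_upwards [hS.mem_nhds hx] with y hy using fderiv_joint_right hS hG hy e
  have k3 := congrArg (fun L : Space n →L[ℝ] ℝ => L e)
    (k1.unique (k2.congr_of_eventuallyEq hev))
  simpa using k3

end partial_derivatives

namespace IsInterface

lemma contDiffOn_comp_sdist (hE : IsInterface Ω E δ) {G : ℝ × Space n → ℝ}
    (hG : ContDiffOn ℝ 2 G (univ ×ˢ tube Ω E δ)) :
    ContDiffOn ℝ 2 (fun y => G (sdist Ω E y, y)) (tube Ω E δ) :=
  hG.comp ((hE.contDiffOn_sdist.of_le (by norm_num)).prodMk contDiffOn_id) fun _ hx => ⟨trivial, hx⟩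

/-- The Laplacian of `x ↦ G (d(x), x)` when `G (s, ·)` is constant in normal direction. There is no
mixed term, because `∇G (s, ·)` is tangential, and `|∇d| = 1`. -/
lemma laplacian_comp_sdist (hE : IsInterface Ω E δ) {G : ℝ × Space n → ℝ}
    (hG : ContDiffOn ℝ 2 G (univ ×ˢ tube Ω E δ))
    (hconst : ∀ s, ∀ x ∈ tube Ω E δ, G (s, x) = G (s, proj E x)) {x : Space n}
    (hx : x ∈ tube Ω E δ) {g₁ : ℝ → ℝ} {g₂ : ℝ}
    (h1 : ∀ s, HasDerivAt (fun s => G (s, x)) (g₁ s) s) (h2 : HasDerivAt g₁ g₂ (sdist Ω E x)) :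
    (Δ fun y => G (sdist Ω E y, y)) x
      = g₂ + (Δ (sdist Ω E)) x * g₁ (sdist Ω E x) + (Δ fun y => G (sdist Ω E x, y)) x := by
  have hT := hE.isOpen_tube
  set s := sdist Ω E x with hs
  set B := fderiv ℝ (fderiv ℝ G) (s, x) with hB
  have hsymm : ∀ a b, B a b = B b a := fun a b =>
    ((hG.contDiffAt ((isOpen_univ.prod hT).mem_nhds ⟨trivial, hx⟩)).isSymmSndFDerivAt (by simp)) a b
  -- first derivatives
  have hι : ∀ y ∈ tube Ω E δ, HasFDerivAt (fun y => (sdist Ω E y, y))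
      ((innerSL ℝ (nu Ω E y)).prod (ContinuousLinearMap.id ℝ (Space n))) y := fun y hy =>
    (hE.hasFDerivAt_sdist hy).prodMk (hasFDerivAt_id y)
  have hD1 : ∀ y ∈ tube Ω E δ, ∀ e, fderiv ℝ (fun y => G (sdist Ω E y, y)) y e
      = fderiv ℝ G (sdist Ω E y, y) (⟪nu Ω E y, e⟫_ℝ, e) := fun y hy e => by
    have h := HasFDerivAt.comp (f := fun y => (sdist Ω E y, y)) y
      (hasFDerivAt_joint hT hG hy) (hι y hy)
    refine (congrArg (fun L : Space n →L[ℝ] ℝ => L e) h.fderiv).trans ?_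
    simp
  -- second derivatives
  have hD2 : ∀ e, fderiv ℝ (fderiv ℝ fun y => G (sdist Ω E y, y)) x e e
      = ⟪nu Ω E x, e⟫_ℝ ^ 2 * B (1, 0) (1, 0) + 2 * B (1, 0) (0, ⟪nu Ω E x, e⟫_ℝ • e)
        + B (0, e) (0, e) + ⟪normalDeriv Ω E x e, e⟫_ℝ * fderiv ℝ G (s, x) (1, 0) := by
    intro e
    have k1 := (hasFDerivAt_fderiv_of_contDiffOn_two hE.isOpen_tube
      (hE.contDiffOn_comp_sdist hG) hx).clm_apply (hasFDerivAt_const e x)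
    have k2 := (HasFDerivAt.comp (f := fun y => (sdist Ω E y, y)) x
      (hasFDerivAt_fderiv_joint hT hG hx) (hι x hx)).clm_apply
      ((hE.hasFDerivAt_inner_nu hx e).prodMk (hasFDerivAt_const e x))
    have hev : (fun y => fderiv ℝ (fun y => G (sdist Ω E y, y)) y e) =ᶠ[𝓝 x]
        fun y => fderiv ℝ G (sdist Ω E y, y) (⟪nu Ω E y, e⟫_ℝ, e) := by
      filter_upwards [hE.isOpen_tube.mem_nhds hx] with y hy using hD1 y hy e
    have k3 := congrArg (fun L : Space n →L[ℝ] ℝ => L e)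
      (k1.unique (k2.congr_of_eventuallyEq hev))
    simp only [add_apply, comp_apply, flip_apply, _root_.zero_apply, map_zero, zero_add,
      prod_apply, innerSL_apply_apply, Function.comp_apply, coe_id', id_eq] at k3
    rw [k3, ← hB, ← hs]
    have e1 : ((⟪nu Ω E x, e⟫_ℝ, e) : ℝ × Space n)
        = ⟪nu Ω E x, e⟫_ℝ • ((1, 0) : ℝ × Space n) + (0, e) := by simp
    have e2 : ((⟪e, normalDeriv Ω E x e⟫_ℝ, 0) : ℝ × Space n)
        = ⟪normalDeriv Ω E x e, e⟫_ℝ • ((1, 0) : ℝ × Space n) := by simp [real_inner_comm]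
    have e3 : ((0, ⟪nu Ω E x, e⟫_ℝ • e) : ℝ × Space n)
        = ⟪nu Ω E x, e⟫_ℝ • ((0, e) : ℝ × Space n) := by simp
    rw [e1, e2, e3]
    simp only [map_add, map_smul, add_apply, smul_apply, smul_eq_mul]
    rw [hsymm (0, e) (1, 0)]
    ring
  -- the mixed derivative in normal direction vanishes
  have hmix : B (1, 0) (0, nu Ω E x) = 0 := by
    refine fderiv_fderiv_joint_left hT hG hx _ ?_
    have e : (fun t : ℝ => fderiv ℝ G (t, x) (0, nu Ω E x)) = fun _ => 0 := funext fun t => by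
      rw [← fderiv_joint_right hT hG hx]
      have hev : (fun y => G (t, y)) =ᶠ[𝓝 x] fun y => G (t, proj E y) := by
        filter_upwards [hT.mem_nhds hx] with y hy using hconst t y hy
      rw [hev.fderiv_eq, fderiv_comp_of_contDiffOn (g := fun y => G (t, y)) hT
        hE.contDiffOn_two_proj hE.mapsTo_proj (contDiffOn_joint_right hG t) hx, comp_apply,
        hE.fderiv_proj_nu hx, map_zero]
    rw [e]
    exact hasDerivAt_const s (0 : ℝ)
  have hmix' : ∑ i, B (1, 0) (0, ⟪nu Ω E x, EuclideanSpace.single i (1 : ℝ)⟫_ℝ •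
      EuclideanSpace.single i (1 : ℝ)) = 0 := by
    have := map_sum ((B (1, 0)).comp (ContinuousLinearMap.inr ℝ ℝ (Space n)))
      (fun i => ⟪nu Ω E x, EuclideanSpace.single i (1 : ℝ)⟫_ℝ • EuclideanSpace.single i (1 : ℝ))
      Finset.univ
    rw [sum_inner_single_smul] at this
    simp only [comp_apply, inr_apply] at this
    rw [← this, hmix]
  have hs2 : B (1, 0) (1, 0) = g₂ := by
    refine fderiv_fderiv_joint_left hT hG hx _ ?_
    have e : (fun t : ℝ => fderiv ℝ G (t, x) (1, 0)) = g₁ :=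
      funext fun t => fderiv_joint_left hT hG hx (h1 t)
    rwa [e]
  rw [laplacian_eq_sum, laplacian_eq_sum (fun y => G (s, y)), laplacian_eq_sum (sdist Ω E)]
  simp only [hD2, fderiv_fderiv_joint_right hT hG hx, hE.fderiv_fderiv_sdist hx]
  rw [Finset.sum_add_distrib, Finset.sum_add_distrib, Finset.sum_add_distrib, ← Finset.mul_sum,
    hmix', ← Finset.sum_mul, ← Finset.sum_mul, sum_inner_single_sq, hE.norm_nu hx,
    fderiv_joint_left hT hG hx (h1 s), hs2]
  ring

/-! ### Comparison functions that are constant away from the interface -/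

open Classical in
/-- A function on the domain which is twice differentiable in the tube and constant in each of the
two components of its complement is admissible in the comparison principle. -/
lemma isInteriorC2_ite (hE : IsInterface Ω E δ) {U : Space n → ℝ} {a b : ℝ}
    (hU : ContDiffOn ℝ 2 U (tube Ω E δ)) (ha : ∀ x ∈ Ω, 4 * δ < sdist Ω E x → U x = a)
    (hb : ∀ x ∈ Ω, sdist Ω E x < -(4 * δ) → U x = b) :
    IsInteriorC2 Ω (fun x => if x ∈ Ω then U x else b) ∧
      (∀ x ∈ tube Ω E δ, (Δ fun x => if x ∈ Ω then U x else b) x = (Δ U) x) ∧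
      ∀ x ∈ Ω, 4 * δ < |sdist Ω E x| → (Δ fun x => if x ∈ Ω then U x else b) x = 0 := by
  have hδ := hE.pos
  set V : Space n → ℝ := fun x => if x ∈ Ω then U x else b with hV
  have hVU : ∀ x ∈ Ω, V =ᶠ[𝓝 x] U := fun x hx => by
    filter_upwards [hE.isOpen_domain.mem_nhds hx] with y hy using if_pos hy
  have hconst : ∀ x ∈ Ω, 4 * δ < |sdist Ω E x| → ∃ c, V =ᶠ[𝓝 x] fun _ => c := by
    intro x hx h
    rcases lt_abs.1 h with h | h
    · refine ⟨a, ?_⟩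
      filter_upwards [hE.isOpen_domain.mem_nhds hx,
        (isOpen_lt continuous_const continuous_sdist).mem_nhds h] with y hy hy'
      exact (if_pos hy).trans (ha y hy hy')
    · refine ⟨b, ?_⟩
      filter_upwards [hE.isOpen_domain.mem_nhds hx,
        (isOpen_lt continuous_sdist continuous_const).mem_nhds (lt_neg.1 h)] with y hy hy'
      exact (if_pos hy).trans (hb y hy hy')
  set k : Set (Space n) := cthickening (4 * δ) (frontier E) ∪ closure E with hk
  have hkc : IsCompact k := hE.isCompact_frontier.cthickening.union hE.isCompact_closure
  have hkΩ : k ⊆ Ω := union_subset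
    ((cthickening_subset_thickening' (by linarith) (by linarith) _).trans hE.tube_subset)
    hE.closure_phase_subset
  have hVk : ∀ x, x ∉ k → V x = b := fun x hx => by
    by_cases hxΩ : x ∈ Ω
    · refine (if_pos hxΩ).trans (hb x hxΩ ?_)
      have hxE : x ∉ E := fun h => hx (Or.inr (subset_closure h))
      have h1 : 4 * δ < infDist x (frontier E) := by
        by_contra! hle
        obtain ⟨y, hy, hxy⟩ := hE.isCompact_frontier.exists_infDist_eq_dist (hE.nonempty hxΩ).2 x
        exact hx (Or.inl (mem_cthickening_of_dist_le x y _ _ hy (hxy ▸ hle)))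
      rw [hE.sdist_of_notMem hxΩ hxE]
      linarith
    · exact if_neg hxΩ
  refine ⟨⟨contDiff_iff_contDiffAt.2 fun x => ?_, b, ?_⟩, fun x hx => ?_, fun x hx h => ?_⟩
  · by_cases hxk : x ∈ k
    · have hxΩ := hkΩ hxk
      by_cases h : 4 * δ < |sdist Ω E x|
      · obtain ⟨c, hc⟩ := hconst x hxΩ h
        exact contDiffAt_const.congr_of_eventuallyEq hc
      · exact (hU.contDiffAt (hE.isOpen_tube.mem_nhds ⟨hxΩ, by linarith⟩)).congr_of_eventuallyEq
          (hVU x hxΩ)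
    · refine (contDiffAt_const (c := b)).congr_of_eventuallyEq ?_
      filter_upwards [hkc.isClosed.isOpen_compl.mem_nhds hxk] with y hy using hVk y hy
  · have hsub : tsupport (fun x => V x - b) ⊆ k := closure_minimal (fun x hx => by
      by_contra hxk
      exact hx (sub_eq_zero.2 (hVk x hxk))) hkc.isClosed
    exact ⟨HasCompactSupport.of_support_subset_isCompact hkc (subset_closure.trans hsub),
      hsub.trans hkΩ⟩
  · simp only [laplacian_eq_traceForm, Function.comp_apply]
    rw [(hVU x hx.1).fderiv.fderiv_eq]
  · obtain ⟨c, hc⟩ := hconst x hx h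
    simp only [laplacian_eq_traceForm, Function.comp_apply]
    rw [hc.fderiv.fderiv_eq]
    simp

end IsInterface

/-! ### The barrier -/

lemma hasDerivAt_inv_cosh (t : ℝ) :
    HasDerivAt (fun t => (Real.cosh t)⁻¹) (-(Real.sinh t / Real.cosh t ^ 2)) t := by
  have := (Real.hasDerivAt_cosh t).inv (Real.cosh_pos t).ne'
  rwa [neg_div] at this

lemma hasDerivAt_deriv_inv_cosh (t : ℝ) :
    HasDerivAt (fun t => -(Real.sinh t / Real.cosh t ^ 2))
      ((Real.cosh t)⁻¹ - 2 * (Real.cosh t)⁻¹ ^ 3) t := by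
  have hc := (Real.cosh_pos t).ne'
  have h := ((Real.hasDerivAt_sinh t).div ((Real.hasDerivAt_cosh t).pow 2) (pow_ne_zero 2 hc)).neg
  refine h.congr_deriv ?_
  simp only [Pi.pow_apply]
  have := Real.cosh_sq t
  have e : Real.sinh t ^ 2 = Real.cosh t ^ 2 - 1 := by linarith
  field_simp
  push_cast
  ring_nf
  rw [e]
  ring

lemma abs_deriv_inv_cosh_le (t : ℝ) :
    |-(Real.sinh t / Real.cosh t ^ 2)| ≤ (Real.cosh t)⁻¹ := by
  have hc := Real.cosh_pos t
  rw [abs_neg, abs_div, abs_of_pos (pow_pos hc 2), div_le_iff₀ (pow_pos hc 2), sq, ← mul_assoc,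
    inv_mul_cancel₀ hc.ne', one_mul]
  exact abs_le_of_sq_le_sq (by linarith [Real.cosh_sq t]) hc.le

lemma abs_deriv_deriv_inv_cosh_le (t : ℝ) :
    |(Real.cosh t)⁻¹ - 2 * (Real.cosh t)⁻¹ ^ 3| ≤ (Real.cosh t)⁻¹ := by
  have h0 : 0 < (Real.cosh t)⁻¹ := inv_pos.2 (Real.cosh_pos t)
  have h1 : (Real.cosh t)⁻¹ ≤ 1 := inv_le_one_of_one_le₀ (Real.one_le_cosh t)
  set h := (Real.cosh t)⁻¹
  have h2 : h ^ 3 ≤ h := by nlinarith [sq_nonneg h, pow_le_one₀ h0.le h1 (n := 2)]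
  rw [abs_le]
  constructor <;> nlinarith [pow_pos h0 3]

lemma exp_neg_abs_le_inv_cosh (t : ℝ) : Real.exp (-|t|) ≤ (Real.cosh t)⁻¹ := by
  rw [Real.exp_neg]
  refine inv_anti₀ (Real.cosh_pos t) ?_
  rw [← Real.cosh_abs, Real.cosh_eq]
  have : Real.exp (-|t|) ≤ Real.exp |t| := Real.exp_le_exp.2 (by linarith [abs_nonneg t])
  linarith

lemma inv_cosh_le (t : ℝ) : (Real.cosh t)⁻¹ ≤ 2 * Real.exp (-|t|) := by
  rw [Real.exp_neg, ← div_eq_mul_inv, inv_le_comm₀ (Real.cosh_pos t) (by positivity), inv_div,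
    ← Real.cosh_abs, Real.cosh_eq]
  linarith [Real.exp_pos (-|t|)]

namespace IsDistModifier
variable {φ₁ : ℝ → ℝ}

lemma zero (hφ : IsDistModifier φ₁) : φ₁ 0 = 0 := by
  have := hφ.odd 0
  rw [neg_zero] at this
  linarith

lemma abs_le_mul (hφ : IsDistModifier φ₁) (z : ℝ) : |φ₁ z| ≤ 9 / 10 * |z| := by
  rcases lt_trichotomy z 0 with h | h | h
  · have h1 := hφ.le (-z) (by linarith)
    have h2 := hφ.pos (-z) (by linarith)
    rw [hφ.odd] at h1 h2
    rw [abs_of_neg (by linarith), abs_of_neg h]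
    exact h1
  · simp [h, hφ.zero]
  · rw [abs_of_pos (hφ.pos z h), abs_of_pos h]
    exact hφ.le z h

lemma eq_two_of_lt (hφ : IsDistModifier φ₁) {z : ℝ} (hz : 5 / 2 < z) : φ₁ z = 2 := hφ.eq_two z hz

lemma eq_neg_two_of_lt (hφ : IsDistModifier φ₁) {z : ℝ} (hz : z < -(5 / 2)) : φ₁ z = -2 := by
  have h1 := hφ.odd z
  rw [hφ.eq_two_of_lt (by linarith)] at h1
  linarith

lemma abs_le_two (hφ : IsDistModifier φ₁) (z : ℝ) : |φ₁ z| ≤ 2 := by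
  have h1 := hφ.monotone (show z ≤ max z 3 from le_max_left _ _)
  have h2 := hφ.monotone (show min z (-3) ≤ z from min_le_left _ _)
  rw [hφ.eq_two_of_lt (lt_max_of_lt_right (by norm_num))] at h1
  rw [hφ.eq_neg_two_of_lt (min_lt_of_right_lt (by norm_num))] at h2
  exact abs_le.2 ⟨h2, h1⟩

lemma abs_deriv_le (hφ : IsDistModifier φ₁) (z : ℝ) : |deriv φ₁ z| ≤ 1 := by
  have key : ∀ z, 0 < z → |deriv φ₁ z| ≤ 1 := fun z hz => by
    have := hφ.deriv_mem z hz
    rw [abs_of_nonneg this.1]; exact this.2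
  rcases lt_trichotomy z 0 with h | h | h
  · have e : (fun y => φ₁ (-y)) = fun y => -φ₁ y := funext hφ.odd
    have h1 := congrArg (fun f => deriv f z) e
    simp only [deriv_comp_neg, deriv.fun_neg, neg_inj] at h1
    rw [← h1]
    exact key _ (by linarith)
  · rw [h, hφ.deriv_zero]; simp
  · exact key z h

lemma hasDerivAt (hφ : IsDistModifier φ₁) (z : ℝ) : HasDerivAt φ₁ (deriv φ₁ z) z :=
  (hφ.smooth.differentiable (by simp) z).hasDerivAt

lemma hasDerivAt_deriv (hφ : IsDistModifier φ₁) (z : ℝ) :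
    HasDerivAt (deriv φ₁) (deriv (deriv φ₁) z) z :=
  (((contDiff_infty.1 hφ.smooth 2).differentiable_deriv_two) z).hasDerivAt

lemma exists_deriv_deriv_bound (hφ : IsDistModifier φ₁) :
    ∃ C, 0 ≤ C ∧ ∀ z, |deriv (deriv φ₁) z| ≤ C := by
  have hc : Continuous (deriv (deriv φ₁)) := by
    have h1 : ContDiff ℝ 1 (deriv φ₁) :=
      ((contDiff_succ_iff_deriv (n := 1)).1 (contDiff_infty.1 hφ.smooth 2)).2.2
    exact h1.continuous_deriv le_rfl
  obtain ⟨C, hC⟩ := (isCompact_Icc (a := (-3 : ℝ)) (b := 3)).exists_bound_of_continuousOn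
    hc.continuousOn
  refine ⟨max C 0, le_max_right _ _, fun z => ?_⟩
  by_cases hz : z ∈ Icc (-3 : ℝ) 3
  · exact (hC z hz).trans (le_max_left _ _)
  · have h0 : ∃ c, φ₁ =ᶠ[𝓝 z] fun _ => c := by
      by_cases h : z < -3
      · exact ⟨-2, by filter_upwards [Iio_mem_nhds h] with y hy using
          hφ.eq_neg_two_of_lt (by linarith [mem_Iio.1 hy])⟩
      · have h' : 3 < z := by
          by_contra! h''
          exact hz ⟨not_lt.1 h, h''⟩
        exact ⟨2, by filter_upwards [Ioi_mem_nhds h'] with y hy using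
          hφ.eq_two_of_lt (by linarith [mem_Ioi.1 hy])⟩
    obtain ⟨c, h0⟩ := h0
    rw [h0.deriv.deriv_eq]
    simp

end IsDistModifier

/-- The function `1 / cosh (μ d_δ / ε)` is a supersolution for small `ε`, because `μ < 1` and the
curvature terms are of order `ε`; for the other `ε` a constant will do. -/
lemma IsInterface.exists_barrier (hE : IsInterface Ω E δ) {φ₁ : ℝ → ℝ} (hφ : IsDistModifier φ₁)
    {μ : ℝ} (hμ₀ : 0 < μ) (hμ₁ : μ < 1) : ∃ c > 0, ∃ C, ∀ ε > 0, ∃ B : Space n → ℝ,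
      IsInteriorC2 Ω B ∧ ∀ x ∈ Ω,
        c * Real.exp (-(μ / ε * |modDist Ω E δ φ₁ x|)) ≤ -ε ^ 2 * (Δ B) x + B x ∧
        |B x| ≤ C * Real.exp (-(μ / ε * |modDist Ω E δ φ₁ x|)) := by
  classical
  have hδ := hE.pos
  obtain ⟨D, hD0, hD⟩ := hφ.exists_deriv_deriv_bound
  obtain ⟨L, hL0, hL⟩ := hE.exists_laplacian_sdist_expansion
  set M := D / δ + L + 1 with hM
  have hM0 : 0 < M := by positivity
  set ε₁ := (1 - μ ^ 2) / (2 * M) with hε₁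
  have hμ2 : 0 < 1 - μ ^ 2 := by nlinarith
  have hε₁0 : 0 < ε₁ := by positivity
  refine ⟨min ((1 - μ ^ 2) / 2) 1, lt_min (by positivity) one_pos,
    max 2 (Real.exp (μ / ε₁ * (2 * δ))), fun ε hε => ?_⟩
  by_cases hsmall : ε < ε₁
  swap
  -- for `ε ≥ ε₁` the weight is bounded from below
  · refine ⟨fun _ => 1, isInteriorC2_const Ω 1, fun x _ => ⟨?_, ?_⟩⟩
    · have h1 : Real.exp (-(μ / ε * |modDist Ω E δ φ₁ x|)) ≤ 1 :=
        Real.exp_le_one_iff.2 (by rw [Left.neg_nonpos_iff]; positivity)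
      have h2 : (Δ fun _ : Space n => (1 : ℝ)) x = 0 := by
        simp
      rw [h2, mul_zero, zero_add]
      have := mul_le_mul (min_le_right ((1 - μ ^ 2) / 2) 1) h1 (Real.exp_pos _).le zero_le_one
      linarith
    · have h1 : |modDist Ω E δ φ₁ x| ≤ 2 * δ := by
        rw [modDist, abs_mul, abs_of_pos hδ, mul_comm]
        exact mul_le_mul_of_nonneg_right (hφ.abs_le_two _) hδ.le
      have h2 : μ / ε ≤ μ / ε₁ := div_le_div_of_nonneg_left hμ₀.le hε₁0 (not_lt.1 hsmall)
      have h3 : μ / ε * |modDist Ω E δ φ₁ x| ≤ μ / ε₁ * (2 * δ) :=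
        mul_le_mul h2 h1 (abs_nonneg _) (by positivity)
      rw [abs_one]
      calc (1 : ℝ) ≤ Real.exp (μ / ε₁ * (2 * δ)) * Real.exp (-(μ / ε * |modDist Ω E δ φ₁ x|)) := by
            rw [← Real.exp_add]; exact Real.one_le_exp (by linarith)
        _ ≤ _ := by gcongr; exact le_max_right _ _
  set T : ℝ → ℝ := fun s => μ / ε * (δ * φ₁ (s / δ)) with hT
  have hT1 : ∀ s, HasDerivAt T (μ / ε * deriv φ₁ (s / δ)) s := fun s => by
    have h1 := (hφ.hasDerivAt (s / δ)).comp s ((hasDerivAt_id s).div_const δ)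
    refine ((h1.const_mul δ).const_mul (μ / ε)).congr_deriv ?_
    field_simp
  have hT2 : ∀ s, HasDerivAt (fun s => μ / ε * deriv φ₁ (s / δ))
      (μ / ε * (deriv (deriv φ₁) (s / δ) / δ)) s := fun s => by
    have h1 := (hφ.hasDerivAt_deriv (s / δ)).comp s ((hasDerivAt_id s).div_const δ)
    refine (h1.const_mul (μ / ε)).congr_deriv ?_
    field_simp
  set h := fun t => (Real.cosh t)⁻¹ with hh
  set h' := fun t => -(Real.sinh t / Real.cosh t ^ 2) with hh'
  set h'' := fun t => (Real.cosh t)⁻¹ - 2 * (Real.cosh t)⁻¹ ^ 3 with hh''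
  have hb1 : ∀ s, HasDerivAt (fun s => h (T s)) (h' (T s) * (μ / ε * deriv φ₁ (s / δ))) s :=
    fun s => (hasDerivAt_inv_cosh (T s)).comp s (hT1 s)
  have hb2 : ∀ s, HasDerivAt (fun s => h' (T s) * (μ / ε * deriv φ₁ (s / δ)))
      (h'' (T s) * (μ / ε * deriv φ₁ (s / δ)) * (μ / ε * deriv φ₁ (s / δ))
        + h' (T s) * (μ / ε * (deriv (deriv φ₁) (s / δ) / δ))) s := fun s =>
    ((hasDerivAt_deriv_inv_cosh (T s)).comp s (hT1 s)).mul (hT2 s)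
  have hTs : ContDiff ℝ 2 T := contDiff_const.mul (contDiff_const.mul
    ((contDiff_infty.1 hφ.smooth 2).comp (contDiff_id.div_const δ)))
  have hhs : ContDiff ℝ 2 h := Real.contDiff_cosh.inv fun t => (Real.cosh_pos t).ne'
  have hG : ContDiffOn ℝ 2 (fun q : ℝ × Space n => h (T q.1)) (univ ×ˢ tube Ω E δ) :=
    ((hhs.comp hTs).comp contDiff_fst).contDiffOn
  -- `φ₁ = ±2` far from the interface, and `cosh` is even
  have hfar : ∀ s, 4 * δ < |s| → h (T s) = h (μ / ε * (δ * 2)) := by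
    intro s hs
    rcases lt_abs.1 hs with hs | hs
    · have : φ₁ (s / δ) = 2 := hφ.eq_two_of_lt (by rw [lt_div_iff₀ hδ]; linarith)
      simp only [hT, this]
    · have : φ₁ (s / δ) = -2 := hφ.eq_neg_two_of_lt (by rw [div_lt_iff₀ hδ]; linarith)
      simp only [hT, this, hh, mul_neg, Real.cosh_neg]
  obtain ⟨hC2, hin, hout⟩ := hE.isInteriorC2_ite (U := fun x => h (T (sdist Ω E x)))
    (hE.contDiffOn_comp_sdist hG) (a := h (μ / ε * (δ * 2))) (b := h (μ / ε * (δ * 2)))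
    (fun x _ hx => hfar _ (hx.trans_le (le_abs_self _)))
    (fun x _ hx => hfar _ ((lt_neg.1 hx).trans_le (neg_le_abs _)))
  refine ⟨_, hC2, fun x hx => ?_⟩
  have hTx : |T (sdist Ω E x)| = μ / ε * |modDist Ω E δ φ₁ x| := by
    simp only [hT]
    rw [abs_mul, abs_of_pos (div_pos hμ₀ hε)]
    rfl
  have hpos : 0 < h (T (sdist Ω E x)) := inv_pos.2 (Real.cosh_pos _)
  have hlow := exp_neg_abs_le_inv_cosh (T (sdist Ω E x))
  have hupp := inv_cosh_le (T (sdist Ω E x))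
  rw [hTx] at hlow hupp
  rw [if_pos hx]
  have hmain : (1 - μ ^ 2) / 2 * h (T (sdist Ω E x)) ≤
      -ε ^ 2 * (Δ fun x => if x ∈ Ω then h (T (sdist Ω E x)) else h (μ / ε * (δ * 2))) x
        + h (T (sdist Ω E x)) := by
    by_cases hd : 4 * δ < |sdist Ω E x|
    · rw [hout x hx hd]
      nlinarith [sq_nonneg μ]
    · have hxt : x ∈ tube Ω E δ := ⟨hx, by linarith⟩
      have hΔ := hE.laplacian_comp_sdist hG (fun _ _ _ => rfl) hxt hb1 (hb2 _)
      have h0 : (Δ fun _ : Space n => h (T (sdist Ω E x))) x = 0 := by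
        simp
      simp only [h0, add_zero] at hΔ
      rw [hin x hxt, hΔ]
      have a1 := abs_deriv_inv_cosh_le (T (sdist Ω E x))
      have a2 := abs_deriv_deriv_inv_cosh_le (T (sdist Ω E x))
      have a3 := hφ.abs_deriv_le (sdist Ω E x / δ)
      have a4 := hD (sdist Ω E x / δ)
      have a5 := (hL x hxt).1
      change |h' (T (sdist Ω E x))| ≤ h (T (sdist Ω E x)) at a1
      change |h'' (T (sdist Ω E x))| ≤ h (T (sdist Ω E x)) at a2
      generalize h (T (sdist Ω E x)) = y at *
      generalize h' (T (sdist Ω E x)) = y' at *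
      generalize h'' (T (sdist Ω E x)) = y'' at *
      generalize deriv (deriv φ₁) (sdist Ω E x / δ) = p'' at *
      generalize deriv φ₁ (sdist Ω E x / δ) = p' at *
      generalize (Δ (sdist Ω E)) x = l at *
      have e : -ε ^ 2 * (y'' * (μ / ε * p') * (μ / ε * p') + y' * (μ / ε * (p'' / δ))
          + l * (y' * (μ / ε * p'))) + y
          = y - μ ^ 2 * (y'' * p' ^ 2) - ε * μ * (y' * (p'' / δ)) - ε * μ * (l * (y' * p')) := by
        field_simp
        ring
      -- the first term loses at most the factor `μ² < 1`; the others are of order `ε`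
      rw [e]
      have b1 : y'' * p' ^ 2 ≤ y := by
        have : |y'' * p' ^ 2| ≤ y * 1 := by
          rw [abs_mul, abs_of_nonneg (sq_nonneg p')]
          exact mul_le_mul a2 (by rw [sq_le_one_iff_abs_le_one]; exact a3) (sq_nonneg _) hpos.le
        linarith [le_abs_self (y'' * p' ^ 2)]
      have b2 : y' * (p'' / δ) ≤ y * (D / δ) := by
        refine (le_abs_self _).trans ?_
        rw [abs_mul, abs_div, abs_of_pos hδ]
        gcongr
      have b3 : l * (y' * p') ≤ L * (y * 1) := by
        refine (le_abs_self _).trans ?_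
        rw [abs_mul, abs_mul]
        gcongr
      have hεM : ε * M ≤ (1 - μ ^ 2) / 2 := by
        have := hsmall.le
        rw [hε₁, le_div_iff₀ (by positivity)] at this
        linarith
      have c1 : μ ^ 2 * (y'' * p' ^ 2) ≤ μ ^ 2 * y := by gcongr
      have c2 : ε * μ * (y' * (p'' / δ)) + ε * μ * (l * (y' * p')) ≤ ε * M * y := by
        have : y' * (p'' / δ) + l * (y' * p') ≤ M * y := by
          rw [hM]; linarith
        calc _ = ε * μ * (y' * (p'' / δ) + l * (y' * p')) := by ring
          _ ≤ ε * μ * (M * y) := by gcongr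
          _ ≤ ε * 1 * (M * y) := by gcongr
          _ = _ := by ring
      have c3 : ε * M * y ≤ (1 - μ ^ 2) / 2 * y := by gcongr
      linarith
  refine ⟨le_trans ?_ hmain, ?_⟩
  · exact mul_le_mul (min_le_left _ _) hlow (Real.exp_pos _).le (by positivity)
  · rw [abs_of_pos hpos]
    refine hupp.trans ?_
    gcongr
    exact le_max_left _ _

/-! ### Cut-off functions -/

section sign
variable {g : ℝ → ℝ} {r : ℝ}

lemma sign_eventuallyEq {s : ℝ} (hs : s ≠ 0) : Real.sign =ᶠ[𝓝 s] fun _ => Real.sign s := by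
  rcases lt_or_gt_of_ne hs with h | h
  · filter_upwards [Iio_mem_nhds h] with y hy
    rw [Real.sign_of_neg hy, Real.sign_of_neg h]
  · filter_upwards [Ioi_mem_nhds h] with y hy
    rw [Real.sign_of_pos hy, Real.sign_of_pos h]

lemma measurable_sign : Measurable Real.sign :=
  Measurable.ite measurableSet_Iio measurable_const
    (Measurable.ite measurableSet_Ioi measurable_const measurable_const)

lemma abs_sign_le (s : ℝ) : |Real.sign s| ≤ 1 := by
  rcases Real.sign_apply_eq s with h | h | h <;> simp [h]

/-- A function vanishing near the origin may be multiplied by the sign as if by a constant. -/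
lemma mul_sign_eventuallyEq (hr : 0 < r) (h0 : ∀ s, |s| < r → g s = 0) (s : ℝ) :
    (fun s => g s * Real.sign s) =ᶠ[𝓝 s] fun t => g t * Real.sign s := by
  by_cases hs : s = 0
  · filter_upwards [ball_mem_nhds s hr] with y hy
    rw [h0 y (by simpa [hs] using hy), zero_mul, zero_mul]
  · filter_upwards [sign_eventuallyEq hs] with y hy
    rw [hy]

lemma hasDerivAt_mul_sign (hr : 0 < r) (h0 : ∀ s, |s| < r → g s = 0) {s g' : ℝ}
    (hg : HasDerivAt g g' s) : HasDerivAt (fun s => g s * Real.sign s) (g' * Real.sign s) s :=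
  (hg.mul_const _).congr_of_eventuallyEq (mul_sign_eventuallyEq hr h0 s)

lemma contDiff_mul_sign (hr : 0 < r) (h0 : ∀ s, |s| < r → g s = 0) (hg : ContDiff ℝ 2 g) :
    ContDiff ℝ 2 (fun s => g s * Real.sign s) :=
  contDiff_iff_contDiffAt.2 fun s =>
    (hg.contDiffAt.mul contDiffAt_const).congr_of_eventuallyEq (mul_sign_eventuallyEq hr h0 s)

end sign

namespace IsCutoff
variable {η₁ : ℝ → ℝ}

lemma eq_one_of_abs_le (hη : IsCutoff η₁) {z : ℝ} (hz : |z| ≤ 3) : η₁ z = 1 := by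
  rcases abs_choice z with h | h
  · rw [← h]; exact hη.eq_one _ ⟨abs_nonneg z, hz⟩
  · rw [← hη.even z, ← h]; exact hη.eq_one _ ⟨abs_nonneg z, hz⟩

lemma eq_zero_of_le_abs (hη : IsCutoff η₁) {z : ℝ} (hz : 4 ≤ |z|) : η₁ z = 0 := by
  rcases abs_choice z with h | h
  · rw [← h]; exact hη.eq_zero _ hz
  · rw [← hη.even z, ← h]; exact hη.eq_zero _ hz

lemma hasDerivAt (hη : IsCutoff η₁) (z : ℝ) : HasDerivAt η₁ (deriv η₁ z) z :=
  (hη.smooth.differentiable (by simp) z).hasDerivAt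

lemma hasDerivAt_deriv (hη : IsCutoff η₁) (z : ℝ) :
    HasDerivAt (deriv η₁) (deriv (deriv η₁) z) z :=
  ((contDiff_infty.1 hη.smooth 2).differentiable_deriv_two z).hasDerivAt

lemma eventuallyEq_const (hη : IsCutoff η₁) {z : ℝ} (hz : |z| < 3 ∨ 4 < |z|) :
    ∃ c, η₁ =ᶠ[𝓝 z] fun _ => c := by
  rcases hz with hz | hz
  · refine ⟨1, ?_⟩
    filter_upwards [(isOpen_lt continuous_abs continuous_const).mem_nhds hz] with y hy
    exact hη.eq_one_of_abs_le (le_of_lt hy)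
  · refine ⟨0, ?_⟩
    filter_upwards [(isOpen_lt continuous_const continuous_abs).mem_nhds hz] with y hy
    exact hη.eq_zero_of_le_abs (le_of_lt hy)

lemma deriv_eq_zero (hη : IsCutoff η₁) {z : ℝ} (hz : |z| < 3 ∨ 4 < |z|) : deriv η₁ z = 0 := by
  obtain ⟨c, hc⟩ := hη.eventuallyEq_const hz
  rw [hc.deriv_eq, deriv_const]

lemma deriv_deriv_eq_zero (hη : IsCutoff η₁) {z : ℝ} (hz : |z| < 3 ∨ 4 < |z|) :
    deriv (deriv η₁) z = 0 := by
  obtain ⟨c, hc⟩ := hη.eventuallyEq_const hz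
  rw [hc.deriv.deriv_eq]; simp

lemma exists_deriv_deriv_bound (hη : IsCutoff η₁) :
    ∃ C, 0 ≤ C ∧ ∀ z, |deriv (deriv η₁) z| ≤ C := by
  have hc : Continuous (deriv (deriv η₁)) := by
    have h1 : ContDiff ℝ 1 (deriv η₁) :=
      ((contDiff_succ_iff_deriv (n := 1)).1 (contDiff_infty.1 hη.smooth 2)).2.2
    exact h1.continuous_deriv le_rfl
  obtain ⟨C, hC⟩ := (isCompact_Icc (a := (-4 : ℝ)) (b := 4)).exists_bound_of_continuousOn
    hc.continuousOn
  refine ⟨max C 0, le_max_right _ _, fun z => ?_⟩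
  by_cases hz : 4 < |z|
  · rw [hη.deriv_deriv_eq_zero (Or.inr hz), abs_zero]; exact le_max_right _ _
  · exact (hC z (abs_le.1 (not_lt.1 hz))).trans (le_max_left _ _)

end IsCutoff

/-! ### From an approximate solution to an expansion -/

lemma laplacian_sum {ι : Type*} {s : Finset ι} {f : ι → Space n → ℝ} {x : Space n}
    (hf : ∀ i ∈ s, ContDiffAt ℝ 2 (f i) x) :
    (Δ fun y => ∑ i ∈ s, f i y) x = ∑ i ∈ s, (Δ (f i)) x := by
  classical
  induction s using Finset.induction_on with
  | empty => simp
  | insert i s hi ih =>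
    have h1 : ContDiffAt ℝ 2 (fun y => ∑ i ∈ s, f i y) x :=
      ContDiffAt.sum fun j hj => hf j (Finset.mem_insert_of_mem hj)
    rw [Finset.sum_insert hi, ← ih fun j hj => hf j (Finset.mem_insert_of_mem hj),
      ← (hf i (Finset.mem_insert_self i s)).laplacian_add h1]
    simp only [Finset.sum_insert hi]
    rfl

lemma exp_neg_div_le_pow {a : ℝ} (ha : 0 < a) (K : ℕ) :
    ∃ C, 0 ≤ C ∧ ∀ ε > 0, Real.exp (-(a / ε)) ≤ C * ε ^ K := by
  refine ⟨K.factorial / a ^ K, by positivity, fun ε hε => ?_⟩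
  have h := Real.pow_div_factorial_le_exp (a / ε) (by positivity) K
  rw [Real.exp_neg, inv_le_comm₀ (Real.exp_pos _) (by positivity)]
  refine le_trans (le_of_eq ?_) h
  rw [div_pow]
  field_simp

section expansion
variable {K : ℕ} {ε₀ μ Λ : ℝ} {φ₁ η₁ : ℝ → ℝ} {p q : ℕ → ℝ → Space n → ℝ}

lemma composite_eq (hη : IsCutoff η₁) (hδ : 0 < δ) (hqc : ∀ j ≤ K, NormalConst Ω E δ (q j))
    (ε : ℝ) {x : Space n} (hx : x ∈ Ω) :
    composite Ω E δ η₁ K q ε x =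
      η₁ (sdist Ω E x / δ) * (∑ j ∈ Finset.range (K + 1), ε ^ j * q j (sdist Ω E x / ε) x) +
        (1 - η₁ (sdist Ω E x / δ)) * Real.sign (sdist Ω E x) := by
  rw [composite, cutoff]
  by_cases h : 4 * δ < |sdist Ω E x|
  · rw [hη.eq_zero_of_le_abs (z := sdist Ω E x / δ)
      (by rw [abs_div, abs_of_pos hδ, le_div_iff₀ hδ]; exact h.le)]
    simp
  · congr 2
    refine Finset.sum_congr rfl fun j hj => ?_
    rw [← hqc j (Nat.lt_succ_iff.1 (Finset.mem_range.1 hj)) _ x ⟨hx, by linarith⟩]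

/-- The composite of bounded continuous profiles is square integrable. -/
lemma memLp_composite (hE : IsInterface Ω E δ) (hη : IsCutoff η₁)
    (hp : ∀ j ≤ K, ContinuousOn (fun r : ℝ × Space n => p j r.1 r.2) (univ ×ˢ tube Ω E δ))
    (hpc : ∀ j ≤ K, NormalConst Ω E δ (p j)) {C : ℝ}
    (hC : ∀ j ≤ K, ∀ z, ∀ x ∈ tube Ω E δ, |p j z x| ≤ C) (ε : ℝ) :
    MemLp (composite Ω E δ η₁ K p ε) 2 (volume.restrict Ω) := by
  have hδ := hE.pos
  have hΩ := hE.isOpen_domain.measurableSet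
  have hT := hE.isOpen_tube.measurableSet
  have : IsFiniteMeasure (volume.restrict Ω) :=
    ⟨by simpa using hE.isBounded_domain.measure_lt_top⟩
  set g : Space n → ℝ := (tube Ω E δ).indicator fun x => η₁ (sdist Ω E x / δ) *
    (∑ j ∈ Finset.range (K + 1), ε ^ j * p j (sdist Ω E x / ε) x) with hg
  set g' : Space n → ℝ := fun x => (1 - η₁ (sdist Ω E x / δ)) * Real.sign (sdist Ω E x) with hg'
  have hηd : Continuous fun x => η₁ (sdist Ω E x / δ) :=
    hη.smooth.continuous.comp (continuous_sdist.div_const δ)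
  have hgm : AEStronglyMeasurable g (volume.restrict Ω) := by
    have hc : ContinuousOn (fun x => η₁ (sdist Ω E x / δ) *
        (∑ j ∈ Finset.range (K + 1), ε ^ j * p j (sdist Ω E x / ε) x)) (tube Ω E δ) := by
      refine hηd.continuousOn.mul (continuousOn_finsetSum _ fun j hj => continuousOn_const.mul ?_)
      exact (hp j (Nat.lt_succ_iff.1 (Finset.mem_range.1 hj))).comp
        ((continuous_sdist.div_const ε).prodMk continuous_id).continuousOn fun x hx => ⟨trivial, hx⟩
    exact ((aestronglyMeasurable_indicator_iff hT).2
      (hc.aestronglyMeasurable hT)).mono_measure Measure.restrict_le_self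
  have hg'm : Measurable g' :=
    (continuous_const.sub hηd).measurable.mul (measurable_sign.comp continuous_sdist.measurable)
  have heq : ∀ x ∈ Ω, composite Ω E δ η₁ K p ε x = g x + g' x := fun x hx => by
    rw [composite_eq hη hδ hpc ε hx]
    simp only [hg, hg']
    by_cases h : x ∈ tube Ω E δ
    · rw [indicator_of_mem h]
    · have h5 : 5 * δ ≤ |sdist Ω E x| := not_lt.1 fun h' => h ⟨hx, h'⟩
      rw [indicator_of_notMem h, hη.eq_zero_of_le_abs (z := sdist Ω E x / δ)
        (by rw [abs_div, abs_of_pos hδ, le_div_iff₀ hδ]; linarith)]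
      ring
  have hae : composite Ω E δ η₁ K p ε =ᵐ[volume.restrict Ω] fun x => g x + g' x :=
    (ae_restrict_iff' hΩ).2 (Eventually.of_forall heq)
  refine MemLp.ae_eq hae.symm (MemLp.of_bound (hgm.add hg'm.aestronglyMeasurable)
    ((∑ j ∈ Finset.range (K + 1), |ε| ^ j * |C|) + 1) (Eventually.of_forall fun x => ?_))
  have hη1 : |η₁ (sdist Ω E x / δ)| ≤ 1 := by
    rw [abs_of_nonneg (hη.mem _).1]; exact (hη.mem _).2
  refine (norm_add_le _ _).trans (add_le_add ?_ ?_)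
  · by_cases h : x ∈ tube Ω E δ
    · rw [hg, indicator_of_mem h, norm_mul, Real.norm_eq_abs]
      refine (mul_le_of_le_one_left (norm_nonneg _) hη1).trans ((norm_sum_le _ _).trans
        (Finset.sum_le_sum fun j hj => ?_))
      rw [norm_mul, norm_pow, Real.norm_eq_abs]
      gcongr
      exact (hC j (Nat.lt_succ_iff.1 (Finset.mem_range.1 hj)) _ x h).trans (le_abs_self C)
    · rw [hg, indicator_of_notMem h, norm_zero]
      positivity
  · rw [hg', norm_mul]
    refine mul_le_one₀ ?_ (norm_nonneg _) (abs_sign_le _)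
    rw [Real.norm_eq_abs, abs_le]
    constructor <;> linarith [(hη.mem (sdist Ω E x / δ)).1, (hη.mem (sdist Ω E x / δ)).2]

/-- An ansatz whose residual is `O(ε^{K+1} e^{-9μ|z|/10})` in the inner variable has a residual of
order `ε^{K+1} e^{-μ|d_δ|/ε}`, because `|d_δ| ≤ 9|d|/10`; the errors caused by the cut-off function
live where `3δ ≤ |d|` and `|d_δ| ≤ 2δ`, and are exponentially small relative to
`e^{-μ|d_δ|/ε}`. -/
lemma exists_residual_bound (hE : IsInterface Ω E δ) (hφ : IsDistModifier φ₁)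
    (hη : IsCutoff η₁) (hμ₀ : 0 < μ) (hε₀ : 0 < ε₀)
    {u : ℝ → Space n → ℝ} (hu : IsRepresented Ω E δ φ₁ η₁ K ε₀ μ Λ p u)
    (hpc : ∀ j ≤ K, NormalConst Ω E δ (p j))
    (hq : ∀ j ≤ K, ContDiffOn ℝ 2 (fun r : ℝ × Space n => q j r.1 r.2) (univ ×ˢ tube Ω E δ))
    (hqc : ∀ j ≤ K, NormalConst Ω E δ (q j)) {q' f : ℕ → ℝ → Space n → ℝ}
    (hq1 : ∀ j ≤ K, ∀ x ∈ tube Ω E δ, ∀ z, HasDerivAt (fun z => q j z x) (q' j z x) z)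
    (hq2 : ∀ j ≤ K, ∀ x ∈ tube Ω E δ, ∀ z,
      HasDerivAt (fun z => q' j z x) (q j z x - f j z x) z)
    (hqb : ∃ C, 0 ≤ C ∧ ∀ ε ∈ Ioo 0 ε₀, ∀ z, ∀ x ∈ tube Ω E δ,
      |∑ j ∈ Finset.range (K + 1), ε ^ j * q j z x - Real.sign z|
        ≤ C * Real.exp (-(9 / 10 * μ * |z|)) ∧
      |∑ j ∈ Finset.range (K + 1), ε ^ j * q' j z x| ≤ C * Real.exp (-(9 / 10 * μ * |z|)))
    (hres : ∃ C, 0 ≤ C ∧ ∀ ε ∈ Ioo 0 ε₀, ∀ z, ∀ x ∈ tube Ω E δ, sdist Ω E x = ε * z →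
      |∑ j ∈ Finset.range (K + 1), ε ^ j * (p j z x - f j z x
        + ε * ((Δ (sdist Ω E)) x * q' j z x) + ε ^ 2 * (Δ (q j z)) x)|
        ≤ C * ε ^ (K + 1) * Real.exp (-(9 / 10 * μ * |z|))) :
    ∃ Z, 0 ≤ Z ∧ ∀ ε ∈ Ioo 0 ε₀, ∃ A : Space n → ℝ, IsInteriorC2 Ω A ∧
      (∀ x ∈ Ω, A x = composite Ω E δ η₁ K q ε x) ∧
      ∀ᵐ x ∂(volume.restrict Ω), |u ε x - (-ε ^ 2 * (Δ A) x + A x)|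
        ≤ Z * ε ^ (K + 1) * Real.exp (-(μ / ε * |modDist Ω E δ φ₁ x|)) := by
  classical
  have hδ := hE.pos
  obtain ⟨C₀, hC₀, hqb⟩ := hqb
  obtain ⟨C₁, hC₁, hres⟩ := hres
  obtain ⟨X, hX0, hX⟩ := hη.exists_deriv_deriv_bound
  obtain ⟨L, hL0, hL⟩ := hE.exists_laplacian_sdist_expansion
  obtain ⟨C₂, hC₂, hexp⟩ := exp_neg_div_le_pow (a := 7 / 10 * μ * δ) (by positivity) K
  set Y := (ε₀ * (X / δ ^ 2) + 2 * (2 / δ) + ε₀ * (L * (2 / δ))) * C₀ with hY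
  have hY0 : 0 ≤ Y := by positivity
  set Z := |Λ| + C₁ + Y * C₂ with hZ
  have hZ0 : 0 ≤ Z := by positivity
  refine ⟨Z, hZ0, fun ε hε => ?_⟩
  have hε0 : 0 < ε := hε.1
  obtain ⟨R, ⟨hRm, hR⟩, huR⟩ := hu ε hε
  have hΩm := hE.isOpen_domain.measurableSet
  set m : Space n → ℝ := fun x => Real.exp (-(μ / ε * |modDist Ω E δ φ₁ x|)) with hm
  have hm0 : ∀ x, 0 < m x := fun x => Real.exp_pos _
  set Q : ℝ → Space n → ℝ := fun z x => ∑ j ∈ Finset.range (K + 1), ε ^ j * q j z x with hQ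
  set Q' : ℝ → Space n → ℝ := fun z x => ∑ j ∈ Finset.range (K + 1), ε ^ j * q' j z x with hQ'
  set P : ℝ → Space n → ℝ := fun z x => ∑ j ∈ Finset.range (K + 1), ε ^ j * p j z x with hP
  set F : ℝ → Space n → ℝ := fun z x => ∑ j ∈ Finset.range (K + 1), ε ^ j * f j z x with hF
  set χ : ℝ → ℝ := fun s => η₁ (s / δ) with hχ
  set χ' : ℝ → ℝ := fun s => deriv η₁ (s / δ) / δ with hχ'
  set χ'' : ℝ → ℝ := fun s => deriv (deriv η₁) (s / δ) / δ ^ 2 with hχ''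
  have hmem : ∀ {j}, j ∈ Finset.range (K + 1) → j ≤ K := fun hj =>
    Nat.lt_succ_iff.1 (Finset.mem_range.1 hj)
  have hdiv : ∀ s : ℝ, HasDerivAt (fun s => s / δ) (1 / δ) s := fun s =>
    (hasDerivAt_id s).div_const δ
  have hdivε : ∀ s : ℝ, HasDerivAt (fun s => s / ε) (1 / ε) s := fun s =>
    (hasDerivAt_id s).div_const ε
  have hχ1 : ∀ s, HasDerivAt χ (χ' s) s := fun s =>
    ((hη.hasDerivAt (s / δ)).comp s (hdiv s)).congr_deriv (by simp only [hχ']; ring)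
  have hχ2 : ∀ s, HasDerivAt χ' (χ'' s) s := fun s => by
    have h := (hη.hasDerivAt_deriv (s / δ)).comp s (hdiv s)
    refine (h.div_const δ).congr_deriv ?_
    simp only [hχ'']
    field_simp
  have hlt : ∀ s : ℝ, |s| < 3 * δ → |s / δ| < 3 := fun s hs => by
    rwa [abs_div, abs_of_pos hδ, div_lt_iff₀ hδ]
  have h3δ : 0 < 3 * δ := by positivity
  have hχc : ContDiff ℝ 2 χ := (contDiff_infty.1 hη.smooth 2).comp (contDiff_id.div_const δ)
  have hσ : ∀ s, HasDerivAt (fun s => (1 - χ s) * Real.sign s) (-χ' s * Real.sign s) s := fun s =>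
    hasDerivAt_mul_sign h3δ (fun s hs => by
      simp only [hχ]; rw [hη.eq_one_of_abs_le (hlt s hs).le, sub_self])
      (((hasDerivAt_const s (1 : ℝ)).sub (hχ1 s)).congr_deriv (by ring))
  have hσ2 : ∀ s, HasDerivAt (fun s => -χ' s * Real.sign s) (-χ'' s * Real.sign s) s := fun s =>
    hasDerivAt_mul_sign (g := fun s => -χ' s) h3δ (fun s hs => by
      simp only [hχ']; rw [hη.deriv_eq_zero (Or.inl (hlt s hs)), zero_div, neg_zero])
      (hχ2 s).fun_neg
  have hσc : ContDiff ℝ 2 (fun s => (1 - χ s) * Real.sign s) :=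
    contDiff_mul_sign h3δ (fun s hs => by
      simp only [hχ]; rw [hη.eq_one_of_abs_le (hlt s hs).le, sub_self]) (contDiff_const.sub hχc)
  -- the ansatz as a function of the distance and the position
  set G : ℝ × Space n → ℝ := fun r => χ r.1 * Q (r.1 / ε) r.2 + (1 - χ r.1) * Real.sign r.1 with hG
  have hQc : ContDiffOn ℝ 2 (fun r : ℝ × Space n => Q (r.1 / ε) r.2) (univ ×ˢ tube Ω E δ) :=
    ContDiffOn.sum fun j hj => contDiffOn_const.mul ((hq j (hmem hj)).comp
      ((contDiff_fst.div_const ε).prodMk contDiff_snd).contDiffOn fun _ hr => ⟨trivial, hr.2⟩)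
  have hGc : ContDiffOn ℝ 2 G (univ ×ˢ tube Ω E δ) :=
    ((hχc.comp contDiff_fst).contDiffOn.mul hQc).add (hσc.comp contDiff_fst).contDiffOn
  have hGconst : ∀ s, ∀ x ∈ tube Ω E δ, G (s, x) = G (s, proj E x) := fun s x hx => by
    simp only [hG, hQ]
    congr 2
    exact Finset.sum_congr rfl fun j hj => by rw [hqc j (hmem hj) _ x hx]
  have hQ1 : ∀ x ∈ tube Ω E δ, ∀ s, HasDerivAt (fun s => Q (s / ε) x) (Q' (s / ε) x / ε) s :=
    fun x hx s => by
      have h := HasDerivAt.fun_sum (u := Finset.range (K + 1)) fun j hj =>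
        ((hq1 j (hmem hj) x hx (s / ε)).comp s (hdivε s)).const_mul (ε ^ j)
      refine h.congr_deriv ?_
      simp only [hQ', Finset.sum_div]
      exact Finset.sum_congr rfl fun j _ => by ring
  have hQ2 : ∀ x ∈ tube Ω E δ, ∀ s, HasDerivAt (fun s => Q' (s / ε) x / ε)
      ((Q (s / ε) x - F (s / ε) x) / ε ^ 2) s := fun x hx s => by
    have h := (HasDerivAt.fun_sum (u := Finset.range (K + 1)) fun j hj =>
      ((hq2 j (hmem hj) x hx (s / ε)).comp s (hdivε s)).const_mul (ε ^ j)).div_const ε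
    refine h.congr_deriv ?_
    simp only [hQ, hF]
    rw [← Finset.sum_sub_distrib, Finset.sum_div, Finset.sum_div]
    exact Finset.sum_congr rfl fun j _ => by field_simp
  set g₁ : Space n → ℝ → ℝ := fun x s =>
    χ' s * Q (s / ε) x + χ s * (Q' (s / ε) x / ε) + -χ' s * Real.sign s with hg₁
  have hG1 : ∀ x ∈ tube Ω E δ, ∀ s, HasDerivAt (fun s => G (s, x)) (g₁ x s) s := fun x hx s =>
    ((hχ1 s).mul (hQ1 x hx s)).add (hσ s)
  have hG2 : ∀ x ∈ tube Ω E δ, ∀ s, HasDerivAt (g₁ x)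
      (χ'' s * Q (s / ε) x + χ' s * (Q' (s / ε) x / ε) + (χ' s * (Q' (s / ε) x / ε)
        + χ s * ((Q (s / ε) x - F (s / ε) x) / ε ^ 2)) + -χ'' s * Real.sign s) s := fun x hx s =>
    (((hχ2 s).mul (hQ1 x hx s)).add ((hχ1 s).mul (hQ2 x hx s))).add (hσ2 s)
  have hqz : ∀ j ≤ K, ∀ z, ContDiffOn ℝ 2 (q j z) (tube Ω E δ) := fun j hj z =>
    contDiffOn_joint_right (hq j hj) z
  have hGx : ∀ x ∈ tube Ω E δ, ∀ s, (Δ fun y => G (s, y)) x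
      = χ s * ∑ j ∈ Finset.range (K + 1), ε ^ j * (Δ (q j (s / ε))) x := by
    intro x hx s
    have hnhds := hE.isOpen_tube.mem_nhds hx
    have hsum : ContDiffAt ℝ 2 (fun y => Q (s / ε) y) x :=
      ContDiffAt.sum fun j hj => contDiffAt_const.mul ((hqz j (hmem hj) _).contDiffAt hnhds)
    have e : (fun y => G (s, y)) = fun y => χ s * Q (s / ε) y - -((1 - χ s) * Real.sign s) := by
      ext y; simp only [hG]; ring
    rw [e, laplacian_sub_const]
    refine (InnerProductSpace.laplacian_smul (χ s) hsum).trans ?_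
    rw [smul_eq_mul, hQ, laplacian_sum fun j hj => contDiffAt_const.mul
      ((hqz j (hmem hj) _).contDiffAt hnhds)]
    congr 1
    exact Finset.sum_congr rfl fun j hj => InnerProductSpace.laplacian_smul (ε ^ j)
      ((hqz j (hmem hj) _).contDiffAt hnhds)
  -- the comparison function
  obtain ⟨hAC2, hAin, hAout⟩ := hE.isInteriorC2_ite (U := fun x => G (sdist Ω E x, x))
    (hE.contDiffOn_comp_sdist hGc) (a := 1) (b := -1)
    (fun x _ hx => by
      have h0 : χ (sdist Ω E x) = 0 := hη.eq_zero_of_le_abs (by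
        rw [abs_div, abs_of_pos hδ, le_div_iff₀ hδ]; exact hx.le.trans (le_abs_self _))
      simp only [hG, h0]
      rw [Real.sign_of_pos (by linarith)]; ring)
    (fun x _ hx => by
      have h0 : χ (sdist Ω E x) = 0 := hη.eq_zero_of_le_abs (by
        rw [abs_div, abs_of_pos hδ, le_div_iff₀ hδ]; exact (lt_neg.1 hx).le.trans (neg_le_abs _))
      simp only [hG, h0]
      rw [Real.sign_of_neg (by linarith)]; ring)
  set A : Space n → ℝ := fun x => if x ∈ Ω then G (sdist Ω E x, x) else -1 with hA
  have hAcomp : ∀ x ∈ Ω, A x = composite Ω E δ η₁ K q ε x := fun x hx => by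
    rw [composite_eq hη hδ hqc ε hx]; exact if_pos hx
  refine ⟨A, hAC2, hAcomp, ?_⟩
  filter_upwards [huR, hR, ae_restrict_mem hΩm] with x hux hRx hx
  have hRx' : |R x| ≤ |Λ| * m x := by
    rw [abs_mul, abs_of_pos (Real.exp_pos _)] at hRx
    simp only [hm]
    rw [Real.exp_neg, ← div_eq_mul_inv, le_div_iff₀ (Real.exp_pos _), mul_comm]
    exact hRx.trans (le_abs_self Λ)
  have hεK : 0 < ε ^ (K + 1) := pow_pos hε0 _
  have hRε : |ε ^ (K + 1) * R x| ≤ |Λ| * ε ^ (K + 1) * m x := by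
    rw [abs_mul, abs_of_pos hεK]
    calc _ ≤ ε ^ (K + 1) * (|Λ| * m x) := by gcongr
      _ = _ := by ring
  rw [hux, composite_eq hη hδ hpc ε hx]
  have hAx : A x = G (sdist Ω E x, x) := if_pos hx
  by_cases hd : 4 * δ < |sdist Ω E x|
  · have h0 : η₁ (sdist Ω E x / δ) = 0 := hη.eq_zero_of_le_abs (by
      rw [abs_div, abs_of_pos hδ, le_div_iff₀ hδ]; exact hd.le)
    rw [hAout x hx hd, hAx]
    simp only [hG, hχ, h0]
    have e : 0 * ∑ j ∈ Finset.range (K + 1), ε ^ j * p j (sdist Ω E x / ε) x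
        + (1 - 0) * Real.sign (sdist Ω E x) + ε ^ (K + 1) * R x
        - (-ε ^ 2 * 0 + (0 * Q (sdist Ω E x / ε) x + (1 - 0) * Real.sign (sdist Ω E x)))
        = ε ^ (K + 1) * R x := by ring
    rw [e]
    refine hRε.trans ?_
    have := hm0 x
    gcongr
    rw [hZ]; linarith [mul_nonneg hY0 hC₂]
  · have hxt : x ∈ tube Ω E δ := ⟨hx, by linarith⟩
    set s := sdist Ω E x with hs
    set z := s / ε with hz
    have hsz : s = ε * z := by rw [hz]; field_simp
    have hzs : |z| = |s| / ε := by rw [hz, abs_div, abs_of_pos hε0]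
    have hsign : Real.sign z = Real.sign s := by
      rcases lt_trichotomy s 0 with h | h | h
      · rw [Real.sign_of_neg h, Real.sign_of_neg (div_neg_of_neg_of_pos h hε0)]
      · rw [hz, h, zero_div]
      · rw [Real.sign_of_pos h, Real.sign_of_pos (div_pos h hε0)]
    obtain ⟨hb0, hb1⟩ := hqb ε hε z x hxt
    have hr := hres ε hε z x hxt hsz
    have hl := (hL x hxt).1
    have hΔ := hE.laplacian_comp_sdist hGc hGconst hxt (hG1 x hxt) (hG2 x hxt _)
    rw [hAin x hxt, hΔ, hAx, hGx x hxt, ← hs, ← hz]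
    have hsum : ∑ j ∈ Finset.range (K + 1), ε ^ j * (p j z x - f j z x
        + ε * ((Δ (sdist Ω E)) x * q' j z x) + ε ^ 2 * (Δ (q j z)) x)
        = P z x - F z x + ε * ((Δ (sdist Ω E)) x * Q' z x)
          + ε ^ 2 * ∑ j ∈ Finset.range (K + 1), ε ^ j * (Δ (q j z)) x := by
      simp only [hP, hF, hQ', Finset.mul_sum]
      rw [← Finset.sum_sub_distrib, ← Finset.sum_add_distrib, ← Finset.sum_add_distrib]
      exact Finset.sum_congr rfl fun j _ => by ring
    rw [hsum] at hr
    rw [hsign] at hb0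
    change |Q z x - Real.sign s| ≤ _ at hb0
    change |Q' z x| ≤ _ at hb1
    have e : η₁ (s / δ) * (∑ j ∈ Finset.range (K + 1), ε ^ j * p j z x)
        + (1 - η₁ (s / δ)) * Real.sign s + ε ^ (K + 1) * R x
        - (-ε ^ 2 * (χ'' s * Q z x + χ' s * (Q' z x / ε) + (χ' s * (Q' z x / ε)
          + χ s * ((Q z x - F z x) / ε ^ 2)) + -χ'' s * Real.sign s
          + (Δ (sdist Ω E)) x * g₁ x s
          + χ s * ∑ j ∈ Finset.range (K + 1), ε ^ j * (Δ (q j z)) x) + G (s, x))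
        = ε ^ (K + 1) * R x + χ s * (P z x - F z x + ε * ((Δ (sdist Ω E)) x * Q' z x)
          + ε ^ 2 * ∑ j ∈ Finset.range (K + 1), ε ^ j * (Δ (q j z)) x)
          + ε * (ε * (χ'' s * (Q z x - Real.sign s)) + 2 * (χ' s * Q' z x)
            + ε * ((Δ (sdist Ω E)) x * (χ' s * (Q z x - Real.sign s)))) := by
      have hPz : ∑ j ∈ Finset.range (K + 1), ε ^ j * p j z x = P z x := rfl
      simp only [hG, hg₁, ← hz, hPz]
      have hχs : η₁ (s / δ) = χ s := rfl
      rw [hχs]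
      field_simp
      ring
    rw [e]
    set W := Real.exp (-(9 / 10 * μ * |z|)) with hW
    have hW0 : 0 < W := Real.exp_pos _
    have hχ01 : |χ s| ≤ 1 := by
      rw [abs_of_nonneg (hη.mem _).1]; exact (hη.mem _).2
    -- the inner residual decays like `W ≤ m`
    have hWm : W ≤ m x := by
      refine Real.exp_le_exp.2 (neg_le_neg ?_)
      have h1 := hφ.abs_le_mul (s / δ)
      rw [abs_div, abs_of_pos hδ] at h1
      have h2 : |modDist Ω E δ φ₁ x| ≤ 9 / 10 * |s| := by
        rw [modDist, abs_mul, abs_of_pos hδ]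
        calc δ * |φ₁ (s / δ)| ≤ δ * (9 / 10 * (|s| / δ)) := by gcongr
          _ = _ := by field_simp
      calc μ / ε * |modDist Ω E δ φ₁ x| ≤ μ / ε * (9 / 10 * |s|) := by gcongr
        _ = _ := by rw [hzs]; ring
    have k1 : |χ s * (P z x - F z x + ε * ((Δ (sdist Ω E)) x * Q' z x)
          + ε ^ 2 * ∑ j ∈ Finset.range (K + 1), ε ^ j * (Δ (q j z)) x)|
        ≤ C₁ * ε ^ (K + 1) * m x := by
      rw [abs_mul]
      refine (mul_le_of_le_one_left (abs_nonneg _) hχ01).trans (hr.trans ?_)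
      gcongr
    -- the cut-off errors
    have k2 : |ε * (ε * (χ'' s * (Q z x - Real.sign s)) + 2 * (χ' s * Q' z x)
            + ε * ((Δ (sdist Ω E)) x * (χ' s * (Q z x - Real.sign s))))|
        ≤ Y * C₂ * ε ^ (K + 1) * m x := by
      by_cases h3 : |s| < 3 * δ
      · have z1 : χ' s = 0 := by
          simp only [hχ']; rw [hη.deriv_eq_zero (Or.inl (hlt s h3)), zero_div]
        have z2 : χ'' s = 0 := by
          simp only [hχ'']; rw [hη.deriv_deriv_eq_zero (Or.inl (hlt s h3)), zero_div]
        rw [z1, z2]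
        simp only [zero_mul, mul_zero, add_zero, abs_zero]
        have := hm0 x
        positivity
      · -- here `9|d|/10 - |d_δ| ≥ 27δ/10 - 2δ = 7δ/10`, which gains any power of `ε`
        have hW2 : W ≤ C₂ * ε ^ K * m x := by
          have h1 : W ≤ Real.exp (-(7 / 10 * μ * δ / ε)) * Real.exp (-(μ / ε * (2 * δ))) := by
            rw [← Real.exp_add]
            refine Real.exp_le_exp.2 ?_
            rw [hzs]
            have : 9 / 10 * μ * (3 * δ / ε) ≤ 9 / 10 * μ * (|s| / ε) := by
              gcongr; exact not_lt.1 h3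
            have e : 9 / 10 * μ * (3 * δ / ε) = 7 / 10 * μ * δ / ε + μ / ε * (2 * δ) := by ring
            linarith
          have h2 : Real.exp (-(μ / ε * (2 * δ))) ≤ m x := by
            refine Real.exp_le_exp.2 (neg_le_neg ?_)
            gcongr
            rw [modDist, abs_mul, abs_of_pos hδ, mul_comm]
            gcongr
            exact hφ.abs_le_two _
          exact h1.trans (mul_le_mul (hexp ε hε0) h2 (Real.exp_pos _).le (by positivity))
        have b1 : |χ' s| ≤ 2 / δ := by
          simp only [hχ']
          rw [abs_div, abs_of_pos hδ]
          gcongr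
          exact hη.abs_deriv_le _
        have b2 : |χ'' s| ≤ X / δ ^ 2 := by
          simp only [hχ'']
          rw [abs_div, abs_of_pos (pow_pos hδ 2)]
          gcongr
          exact hX _
        have t1 : |ε * (χ'' s * (Q z x - Real.sign s))| ≤ ε₀ * (X / δ ^ 2 * (C₀ * W)) := by
          rw [abs_mul, abs_mul, abs_of_pos hε0]
          gcongr
          exact hε.2.le
        have t2 : |2 * (χ' s * Q' z x)| ≤ 2 * (2 / δ * (C₀ * W)) := by
          rw [abs_mul, abs_mul, abs_two]
          gcongr
        have t3 : |ε * ((Δ (sdist Ω E)) x * (χ' s * (Q z x - Real.sign s)))|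
            ≤ ε₀ * (L * (2 / δ * (C₀ * W))) := by
          rw [abs_mul, abs_mul, abs_mul, abs_of_pos hε0]
          gcongr
          exact hε.2.le
        have t4 := (abs_add_three (ε * (χ'' s * (Q z x - Real.sign s))) (2 * (χ' s * Q' z x))
          (ε * ((Δ (sdist Ω E)) x * (χ' s * (Q z x - Real.sign s))))).trans
          (add_le_add (add_le_add t1 t2) t3)
        rw [abs_mul, abs_of_pos hε0]
        calc _ ≤ ε * (Y * W) := by
              refine mul_le_mul_of_nonneg_left (t4.trans (le_of_eq ?_)) hε0.le
              rw [hY]; ring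
          _ ≤ ε * (Y * (C₂ * ε ^ K * m x)) := by gcongr
          _ = _ := by ring
    refine (abs_add_three _ _ _).trans ((add_le_add (add_le_add hRε k1) k2).trans
      (le_of_eq ?_))
    rw [hZ]; ring

/-- If the residual of the ansatz is small in the inner variable, then the ansatz represents the
solution: a multiple of the barrier dominates the residual, and the comparison principle applies. -/
lemma isRepresented_of_residual (hE : IsInterface Ω E δ) (hφ : IsDistModifier φ₁)
    (hη : IsCutoff η₁) (hμ₀ : 0 < μ) (hμ₁ : μ < 1) (hε₀ : 0 < ε₀)
    {u v : ℝ → Space n → ℝ} (hu : IsRepresented Ω E δ φ₁ η₁ K ε₀ μ Λ p u)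
    (hv : ∀ ε ∈ Ioo 0 ε₀, IsNeumannSolution Ω ε (u ε) (v ε))
    (hp : ∀ j ≤ K, ContinuousOn (fun r : ℝ × Space n => p j r.1 r.2) (univ ×ˢ tube Ω E δ))
    (hpc : ∀ j ≤ K, NormalConst Ω E δ (p j))
    (hpb : ∃ C, ∀ j ≤ K, ∀ z, ∀ x ∈ tube Ω E δ, |p j z x| ≤ C)
    (hq : ∀ j ≤ K, ContDiffOn ℝ 2 (fun r : ℝ × Space n => q j r.1 r.2) (univ ×ˢ tube Ω E δ))
    (hqc : ∀ j ≤ K, NormalConst Ω E δ (q j)) {q' f : ℕ → ℝ → Space n → ℝ}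
    (hq1 : ∀ j ≤ K, ∀ x ∈ tube Ω E δ, ∀ z, HasDerivAt (fun z => q j z x) (q' j z x) z)
    (hq2 : ∀ j ≤ K, ∀ x ∈ tube Ω E δ, ∀ z,
      HasDerivAt (fun z => q' j z x) (q j z x - f j z x) z)
    (hqb : ∃ C, 0 ≤ C ∧ ∀ ε ∈ Ioo 0 ε₀, ∀ z, ∀ x ∈ tube Ω E δ,
      |∑ j ∈ Finset.range (K + 1), ε ^ j * q j z x - Real.sign z|
        ≤ C * Real.exp (-(9 / 10 * μ * |z|)) ∧
      |∑ j ∈ Finset.range (K + 1), ε ^ j * q' j z x| ≤ C * Real.exp (-(9 / 10 * μ * |z|)))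
    (hres : ∃ C, 0 ≤ C ∧ ∀ ε ∈ Ioo 0 ε₀, ∀ z, ∀ x ∈ tube Ω E δ, sdist Ω E x = ε * z →
      |∑ j ∈ Finset.range (K + 1), ε ^ j * (p j z x - f j z x
        + ε * ((Δ (sdist Ω E)) x * q' j z x) + ε ^ 2 * (Δ (q j z)) x)|
        ≤ C * ε ^ (K + 1) * Real.exp (-(9 / 10 * μ * |z|))) :
    ∃ Λ' > 0, IsRepresented Ω E δ φ₁ η₁ K ε₀ μ Λ' q v := by
  obtain ⟨Cp, hCp⟩ := hpb
  obtain ⟨Z, hZ0, hZ⟩ := exists_residual_bound hE hφ hη hμ₀ hε₀ hu hpc hq hqc hq1 hq2 hqb hres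
  obtain ⟨c, hc, D, hB⟩ := hE.exists_barrier hφ hμ₀ hμ₁
  refine ⟨Z / c * |D| + 1, by positivity, fun ε hε => ?_⟩
  have hε0 : 0 < ε := hε.1
  obtain ⟨R, ⟨hRm, hR⟩, huR⟩ := hu ε hε
  obtain ⟨B, hBC2, hBb⟩ := hB ε hε0
  obtain ⟨A, hAC2, hAcomp, hmain⟩ := hZ ε hε
  have hΩm := hE.isOpen_domain.measurableSet
  set m : Space n → ℝ := fun x => Real.exp (-(μ / ε * |modDist Ω E δ φ₁ x|)) with hm
  have hm0 : ∀ x, 0 < m x := fun x => Real.exp_pos _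
  set κ := Z * ε ^ (K + 1) / c with hκ
  have hκ0 : 0 ≤ κ := by positivity
  have hle : ∀ᵐ x ∂(volume.restrict Ω), |u ε x - (-ε ^ 2 * (Δ A) x + A x)|
      ≤ -ε ^ 2 * (Δ fun x => κ * B x) x + κ * B x := by
    filter_upwards [hmain, ae_restrict_mem hΩm] with x h1 hx
    have e : (Δ fun x => κ * B x) x = κ * (Δ B) x :=
      InnerProductSpace.laplacian_smul κ hBC2.contDiff.contDiffAt
    rw [e]
    have h2 := mul_le_mul_of_nonneg_left (hBb x hx).1 hκ0
    refine h1.trans ?_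
    have e2 : κ * (c * Real.exp (-(μ / ε * |modDist Ω E δ φ₁ x|))) = Z * ε ^ (K + 1) * m x := by
      change κ * (c * m x) = _
      rw [hκ]; field_simp
    rw [e2] at h2
    linarith
  have huL : MemLp (u ε) 2 (volume.restrict Ω) := by
    have : IsFiniteMeasure (volume.restrict Ω) :=
      ⟨by simpa using hE.isBounded_domain.measure_lt_top⟩
    have hRL : MemLp R 2 (volume.restrict Ω) := by
      refine MemLp.of_bound hRm Λ (hR.mono fun x hx => ?_)
      rw [abs_mul, abs_of_pos (Real.exp_pos _)] at hx
      exact (le_mul_of_one_le_left (abs_nonneg _) (Real.one_le_exp (by positivity))).trans hx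
    exact MemLp.ae_eq (huR.mono fun x hx => hx.symm)
      ((memLp_composite hE hη hp hpc hCp ε).add (hRL.const_mul (ε ^ (K + 1))))
  have hvol : volume Ω ≠ ⊤ := hE.isBounded_domain.measure_lt_top.ne
  have hvA := (hv ε hε).abs_sub_le hE.isOpen_domain hvol huL hAC2 (hBC2.const_mul κ) hle
  have hvm : AEStronglyMeasurable (v ε) (volume.restrict Ω) := by
    obtain ⟨_, hS, -⟩ := hv ε hε
    exact hS.1.1
  have hεK : 0 < ε ^ (K + 1) := pow_pos hε0 _
  refine ⟨fun x => (v ε x - A x) / ε ^ (K + 1), ⟨?_, ?_⟩, ?_⟩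
  · have := (hvm.sub hAC2.contDiff.continuous.aestronglyMeasurable).mul_const (ε ^ (K + 1))⁻¹
    simpa [div_eq_mul_inv] using this
  · filter_upwards [hvA, ae_restrict_mem hΩm] with x h1 hx
    have h2 := (hBb x hx).2
    have hm' := hm0 x
    rw [abs_mul, abs_of_pos (Real.exp_pos _), abs_div, abs_of_pos hεK]
    have h3 : |v ε x - A x| ≤ κ * (|D| * m x) := by
      refine h1.trans (mul_le_mul_of_nonneg_left ((le_abs_self _).trans (h2.trans ?_)) hκ0)
      exact mul_le_mul_of_nonneg_right (le_abs_self D) hm'.le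
    have h4 : Real.exp (μ / ε * |modDist Ω E δ φ₁ x|) * m x = 1 := by
      simp only [hm]; rw [← Real.exp_add]; simp
    calc Real.exp (μ / ε * |modDist Ω E δ φ₁ x|) * (|v ε x - A x| / ε ^ (K + 1))
        ≤ Real.exp (μ / ε * |modDist Ω E δ φ₁ x|) * (κ * (|D| * m x) / ε ^ (K + 1)) := by gcongr
      _ = (Real.exp (μ / ε * |modDist Ω E δ φ₁ x|) * m x) * (Z / c * |D|) := by
          rw [hκ]; field_simp
      _ ≤ Z / c * |D| + 1 := by rw [h4]; linarith
  · filter_upwards [ae_restrict_mem hΩm] with x hx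
    rw [← hAcomp x hx]
    field_simp
    ring

end expansion

/-! ### Convolution of the sign function -/

lemma abs_sign_sub_sign_mul_exp_le (z ζ : ℝ) :
    Real.exp (-|z - ζ|) * |Real.sign ζ - Real.sign z|
      ≤ 2 * Real.exp (-|z|) * Real.exp (-(1 * |ζ|)) := by
  have h2 : |Real.sign ζ - Real.sign z| ≤ 2 :=
    (abs_sub _ _).trans (by linarith [abs_sign_le ζ, abs_sign_le z])
  by_cases h : z * ζ ≤ 0
  · have e : |z - ζ| = |z| + |ζ| := by
      rw [sub_eq_add_neg, ← abs_neg ζ, abs_add_eq_add_abs_iff]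
      rcases mul_nonpos_iff.1 h with h | h
      · exact Or.inl ⟨h.1, by linarith [h.2]⟩
      · exact Or.inr ⟨h.1, by linarith [h.2]⟩
    rw [e, one_mul, neg_add, Real.exp_add, mul_comm, ← mul_assoc]
    gcongr
  · have e : Real.sign ζ = Real.sign z := by
      rcases pos_and_pos_or_neg_and_neg_of_mul_pos (not_le.1 h) with h | h
      · rw [Real.sign_of_pos h.1, Real.sign_of_pos h.2]
      · rw [Real.sign_of_neg h.1, Real.sign_of_neg h.2]
    rw [e, sub_self, abs_zero, mul_zero]
    positivity

/-- The convolution of the sign function with a kernel of total mass `m` is exponentially close to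
`m` times the sign function. -/
lemma IsKernel.abs_cv_sign_sub_le {κ : ℝ → ℝ} (hκ : IsKernel κ) (z : ℝ) :
    |cv κ Real.sign z - (∫ t, κ t) * Real.sign z|
      ≤ 2 * (∫ t : ℝ, Real.exp (-(1 * |t|))) * Real.exp (-|z|) := by
  have hs : ∀ᵐ ζ : ℝ, ‖Real.sign ζ‖ ≤ 1 * Real.exp (-(0 * |ζ|)) :=
    Eventually.of_forall fun ζ => by simpa using abs_sign_le ζ
  have hc : ∀ᵐ ζ : ℝ, ‖Real.sign z‖ ≤ 1 * Real.exp (-(0 * |ζ|)) :=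
    Eventually.of_forall fun ζ => by simpa using abs_sign_le z
  have h1 := hκ.integrable_smul measurable_sign.aestronglyMeasurable (by simp) hs z
  have h2 := hκ.integrable_smul (f := fun _ => Real.sign z) aestronglyMeasurable_const
    (by simp) hc z
  have e : (∫ t, κ t) * Real.sign z = ∫ ζ, κ (z - ζ) • Real.sign z := by
    simp only [smul_eq_mul]
    rw [integral_mul_const, integral_sub_left_eq_self]
  rw [e, cv, ← integral_sub h1 h2, ← Real.norm_eq_abs]
  have hb := (integrable_exp_neg_abs one_pos).const_mul (2 * Real.exp (-|z|))
  refine (norm_integral_le_of_norm_le hb (Eventually.of_forall fun ζ => ?_)).trans (le_of_eq ?_)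
  · rw [← smul_sub, norm_smul]
    exact (mul_le_mul_of_nonneg_right (hκ.abs_le _) (norm_nonneg _)).trans
      (abs_sign_sub_sign_mul_exp_le z ζ)
  · rw [integral_const_mul]; ring

lemma integral_kerJ : ∫ t, kerJ t = 1 := by
  have h := integral_comp_abs (f := fun t : ℝ => 1 / 2 * Real.exp (-t))
  have e : (∫ t, kerJ t) = 2 * ∫ t in Ioi (0 : ℝ), 1 / 2 * Real.exp (-t) := h
  rw [e, integral_const_mul, integral_exp_neg_Ioi_zero]
  norm_num

lemma integral_kerJ' : ∫ t, kerJ' t = 0 := by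
  have h := integral_neg_eq_self kerJ' volume
  have e : ∀ t, kerJ' (-t) = - kerJ' t := fun t => by
    simp [kerJ', Left.sign_neg]
  simp only [e, integral_neg] at h
  linarith

lemma exp_neg_abs_le_rate {μ : ℝ} (hμ : μ ≤ 1) (z : ℝ) :
    Real.exp (-|z|) ≤ Real.exp (-(μ * |z|)) := by
  simpa using exp_rate_le hμ z

section zero
variable {f : ℝ → ℝ} {μ C : ℝ}

/-- Decomposition of the convolution of a function with the limits of the sign function. -/
lemma IsKernel.abs_cv_sub_sign_le {κ : ℝ → ℝ} (hκ : IsKernel κ) (hμ₀ : 0 ≤ μ) (hμ₁ : μ < 1)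
    (hf : AEStronglyMeasurable f)
    (hC : ∀ᵐ ζ, |f ζ - Real.sign ζ| ≤ C * Real.exp (-(μ * |ζ|))) (z : ℝ) :
    |cv κ f z - (∫ t, κ t) * Real.sign z|
      ≤ (C * cvConst μ + 2 * ∫ t : ℝ, Real.exp (-(1 * |t|))) * Real.exp (-(μ * |z|)) := by
  have hμ : |μ| < 1 := by rwa [abs_of_nonneg hμ₀]
  have hs : ∀ᵐ ζ : ℝ, ‖Real.sign ζ‖ ≤ 1 * Real.exp (-(0 * |ζ|)) :=
    Eventually.of_forall fun ζ => by simpa using abs_sign_le ζ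
  have h1 := hκ.integrable_smul measurable_sign.aestronglyMeasurable (by simp) hs z
  have h2 := hκ.integrable_smul (f := fun ζ => f ζ - Real.sign ζ)
    (hf.sub measurable_sign.aestronglyMeasurable) hμ hC z
  have e : cv κ f z = cv κ (fun ζ => f ζ - Real.sign ζ) z + cv κ Real.sign z := by
    rw [cv, cv, cv, ← integral_add h2 h1]
    exact integral_congr_ae (Eventually.of_forall fun ζ => by simp only [smul_eq_mul]; ring)
  have h3 := hκ.norm_cv_le (f := fun ζ => f ζ - Real.sign ζ) hμ hC z
  have h4 := hκ.abs_cv_sign_sub_le z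
  have h5 := exp_neg_abs_le_rate hμ₁.le z
  have h6 : 0 ≤ ∫ t : ℝ, Real.exp (-(1 * |t|)) := integral_nonneg fun _ => (Real.exp_pos _).le
  rw [e, add_sub_assoc]
  refine (abs_add_le _ _).trans ?_
  rw [add_mul]
  refine add_le_add h3 (h4.trans ?_)
  gcongr

end zero

/-! ### The given profiles as sources -/

lemma norm_gradient (f : Space n → ℝ) (x : Space n) : ‖gradient f x‖ = ‖fderiv ℝ f x‖ :=
  (InnerProductSpace.toDual ℝ (Space n)).symm.norm_map _

lemma continuousOn_laplacian {S : Set (Space n)} (hS : IsOpen S) {f : Space n → ℝ}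
    (hf : ContDiffOn ℝ 2 f S) : ContinuousOn (Δ f) S := by
  rw [laplacian_eq_traceForm]
  exact (traceForm n).continuous.comp_continuousOn (continuousOn_fderiv_fderiv hS hf)

lemma IsProfile.with_value {S : Set (Space n)} {a a' b c : ℝ} {f : ℝ → Space n → ℝ}
    (h : IsProfile S a b c f) {C : ℝ} (hC : ∀ z, ∀ x ∈ S, |f z x| ≤ C * Real.exp (-(a' * |z|))) :
    IsProfile S a' b c f := by
  obtain ⟨D, hD⟩ := h.bound
  refine ⟨h.smooth, h.continuousOn, h.continuousOn_fderiv, h.continuousOn_fderiv_fderiv,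
    max C D, fun z x hx => ⟨(hC z x hx).trans ?_, (hD z x hx).2.1.trans ?_,
      (hD z x hx).2.2.1.trans ?_, (hD z x hx).2.2.2.trans ?_⟩⟩
  · gcongr; exact le_max_left _ _
  all_goals gcongr; exact le_max_right _ _

/-- A continuous function bounded almost everywhere is bounded everywhere. -/
lemma abs_le_of_ae_of_continuous {f : ℝ → ℝ} (hf : Continuous f) {C : ℝ} (h : ∀ᵐ z, |f z| ≤ C)
    (z : ℝ) : |f z| ≤ C := by
  by_contra! hz
  have ho : IsOpen {z | C < |f z|} := isOpen_lt continuous_const hf.abs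
  have h0 : volume {z | C < |f z|} = 0 := by
    rw [ae_iff] at h
    simpa using h
  have := (ho.measure_eq_zero_iff volume).1 h0
  exact (this ▸ hz : z ∈ (∅ : Set ℝ))

namespace HasExpansion
variable {K : ℕ} {ε₀ μ Λ : ℝ} {φ₁ η₁ : ℝ → ℝ} {p : ℕ → ℝ → Space n → ℝ} {u : ℝ → Space n → ℝ}

lemma contDiffOn_two (hu : HasExpansion Ω E δ φ₁ η₁ K ε₀ μ Λ p u) {j : ℕ} (hj : j ≤ K) (z : ℝ) :
    ContDiffOn ℝ 2 (p j z) (tube Ω E δ) := (hu.contDiffOn j hj z).of_le (by norm_num)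

lemma normalConst (hu : HasExpansion Ω E δ φ₁ η₁ K ε₀ μ Λ p u) {j : ℕ} (hj : j ≤ K) :
    NormalConst Ω E δ (p j) := by
  rcases Nat.eq_zero_or_pos j with rfl | h
  · intro z x hx
    have := hu.decay_zero.2 z x hx
    simpa using this
  · exact (hu.decay j hj h).2

lemma ae_abs_sub_sign_le (hE : IsInterface Ω E δ) (hu : HasExpansion Ω E δ φ₁ η₁ K ε₀ μ Λ p u) :
    ∀ᵐ z, ∀ x ∈ tube Ω E δ, |p 0 z x - Real.sign z| ≤ Λ * Real.exp (-(μ * |z|)) :=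
  hu.decay_zero.1.ae_forall hE.isOpen_tube fun z =>
    (hu.contDiffOn_two (Nat.zero_le _) z).continuousOn.sub continuousOn_const

/-- A given profile is a source, once the decay of its values is known. -/
lemma isSource (hE : IsInterface Ω E δ) (hu : HasExpansion Ω E δ φ₁ η₁ K ε₀ μ Λ p u) {j : ℕ}
    (hj : j ≤ K) {a C : ℝ}
    (hC : ∀ᵐ z, ∀ x ∈ tube Ω E δ, |p j z x| ≤ C * Real.exp (-(a * |z|))) :
    IsSource (tube Ω E δ) a μ 0 (p j) := by
  have hS := hE.isOpen_tube
  refine ⟨fun x hx => (continuous_of_continuousOn_prod (hu.continuousOn j hj)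
    hx).aestronglyMeasurable, Eventually.of_forall fun z => hu.contDiffOn_two hj z,
    max C Λ, ?_⟩
  have h1 := (hu.decay_grad j hj).ae_forall hS fun z => by
    simp only [norm_gradient]
    exact (contDiffOn_fderiv hS (hu.contDiffOn_two hj z)).continuousOn.norm
  have h2 := (hu.decay_laplacian j hj).ae_forall hS fun z =>
    continuousOn_laplacian hS (hu.contDiffOn_two hj z)
  filter_upwards [hC, h1, h2] with z k1 k2 k3 x hx
  refine ⟨(k1 x hx).trans ?_, ?_, (k3 x hx).trans ?_, ?_⟩
  · gcongr; exact le_max_left _ _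
  · have := k2 x hx
    rw [abs_norm, norm_gradient] at this
    refine this.trans ?_
    gcongr; exact le_max_right _ _
  · gcongr; exact le_max_right _ _
  · rw [norm_fderiv_fderiv_eq_iterated, zero_mul, neg_zero, Real.exp_zero, mul_one]
    exact (hu.hessian_le j hj z x hx).trans (le_max_right _ _)

lemma isSource_zero (hE : IsInterface Ω E δ) (hμ₀ : 0 < μ) (hΛ : 0 < Λ)
    (hu : HasExpansion Ω E δ φ₁ η₁ K ε₀ μ Λ p u) : IsSource (tube Ω E δ) 0 μ 0 (p 0) := by
  refine hu.isSource hE (Nat.zero_le _) (C := Λ + 1) ?_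
  filter_upwards [hu.ae_abs_sub_sign_le hE] with z hz x hx
  have h1 : Real.exp (-(μ * |z|)) ≤ 1 := Real.exp_le_one_iff.2 (by
    rw [Left.neg_nonpos_iff]; positivity)
  have h2 := abs_add_le (p 0 z x - Real.sign z) (Real.sign z)
  rw [sub_add_cancel] at h2
  rw [zero_mul, neg_zero, Real.exp_zero, mul_one]
  nlinarith [hz x hx, abs_sign_le z]

lemma isSource_pos (hE : IsInterface Ω E δ)
    (hu : HasExpansion Ω E δ φ₁ η₁ K ε₀ μ Λ p u) {j : ℕ} (hj : j ≤ K) (h : 1 ≤ j) :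
    IsSource (tube Ω E δ) μ μ 0 (p j) :=
  hu.isSource hE hj ((hu.decay j hj h).1.ae_forall hE.isOpen_tube fun z =>
    (hu.contDiffOn_two hj z).continuousOn)

lemma exists_bound (hE : IsInterface Ω E δ) (hμ₀ : 0 < μ) (hΛ : 0 < Λ)
    (hu : HasExpansion Ω E δ φ₁ η₁ K ε₀ μ Λ p u) :
    ∃ C, ∀ j ≤ K, ∀ z, ∀ x ∈ tube Ω E δ, |p j z x| ≤ C := by
  have key : ∀ j ≤ K, ∃ C, 0 ≤ C ∧ ∀ z, ∀ x ∈ tube Ω E δ, |p j z x| ≤ C := by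
    intro j hj
    have hs : ∃ a, 0 ≤ a ∧ IsSource (tube Ω E δ) a μ 0 (p j) := by
      rcases Nat.eq_zero_or_pos j with rfl | h
      · exact ⟨0, le_rfl, hu.isSource_zero hE hμ₀ hΛ⟩
      · exact ⟨μ, hμ₀.le, hu.isSource_pos hE hj h⟩
    obtain ⟨a, ha, hs⟩ := hs
    obtain ⟨C, hC0, hC⟩ := hs.exists_pos_bound
    refine ⟨C, hC0.le, fun z x hx => abs_le_of_ae_of_continuous
      (continuous_of_continuousOn_prod (hu.continuousOn j hj) hx) (hC.mono fun z hz => ?_) z⟩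
    refine (hz x hx).1.trans (mul_le_of_le_one_right hC0.le (Real.exp_le_one_iff.2 ?_))
    rw [Left.neg_nonpos_iff]; positivity
  choose! C hC0 hC using key
  refine ⟨∑ j ∈ Finset.range (K + 1), C j, fun j hj z x hx => (hC j hj z x hx).trans ?_⟩
  exact Finset.single_le_sum (f := C)
    (fun i hi => hC0 i (Nat.lt_succ_iff.1 (Finset.mem_range.1 hi)))
    (Finset.mem_range.2 (Nat.lt_succ_iff.2 hj))

set_option maxSynthPendingDepth 3 in
/-- The Laplacian of the leading profile is a source. -/
lemma isSource_laplacian (hE : IsInterface Ω E δ) (hμ₀ : 0 < μ) (hΛ : 0 < Λ) (hK : K = 2)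
    (hu : HasExpansion Ω E δ φ₁ η₁ K ε₀ μ Λ p u) :
    IsSource (tube Ω E δ) μ μ μ fun z => Δ (p 0 z) := by
  have hS := hE.isOpen_tube
  have h4 : ∀ z, ContDiffOn ℝ 4 (p 0 z) (tube Ω E δ) := hu.contDiffOn 0 (Nat.zero_le _)
  have hdec : ∀ k ∈ Finset.Icc 1 4, ∀ᵐ z, ∀ x ∈ tube Ω E δ,
      ‖iteratedFDeriv ℝ k (p 0 z) x‖ ≤ Λ * Real.exp (-(μ * |z|)) := fun k hk => by
    have := (hu.decay_higher hK k hk).ae_forall hS fun z => by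
      refine ContinuousOn.norm ?_
      refine (((h4 z).continuousOn_iteratedFDerivWithin (m := k) ?_ hS.uniqueDiffOn)).congr
        fun x hx => (iteratedFDerivWithin_of_isOpen k hS hx).symm
      exact_mod_cast (Finset.mem_Icc.1 hk).2
    simpa only [abs_norm] using this
  refine ⟨fun x hx => ?_, Eventually.of_forall fun z => ?_,
    (1 + n) * (‖traceForm n‖ * Λ), ?_⟩
  · simp only [laplacian_eq_traceForm]
    exact (traceForm n).continuous.comp_aestronglyMeasurable
      ((hu.isSource_zero hE hμ₀ hΛ).meas_fderiv_fderiv hS hx)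
  · rw [laplacian_eq_traceForm]
    exact (traceForm n).contDiff.comp_contDiffOn (contDiffOn_fderiv_fderiv_of_four hS (h4 z))
  · filter_upwards [hdec 2 (by simp), hdec 3 (by simp), hdec 4 (by simp)] with z k2 k3 k4 x hx
    have l0 := norm_iteratedFDeriv_laplacian_le hS (h4 z) hx (k := 0) (by norm_num)
    have l1 := norm_iteratedFDeriv_laplacian_le hS (h4 z) hx (k := 1) (by norm_num)
    have l2 := norm_iteratedFDeriv_laplacian_le hS (h4 z) hx (k := 2) (by norm_num)
    rw [norm_iteratedFDeriv_zero, Real.norm_eq_abs] at l0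
    rw [← norm_fderiv_eq_iterated] at l1
    rw [← norm_fderiv_fderiv_eq_iterated] at l2
    have l3 := abs_laplacian_le (Δ (p 0 z)) x
    have hT : 0 ≤ ‖traceForm n‖ := norm_nonneg _
    set W := Real.exp (-(μ * |z|))
    have hW : 0 < W := Real.exp_pos _
    have b0 := mul_le_mul_of_nonneg_left (k2 x hx) hT
    have b1 := mul_le_mul_of_nonneg_left (k3 x hx) hT
    have b2 := mul_le_mul_of_nonneg_left (k4 x hx) hT
    have hn : (0 : ℝ) ≤ n := Nat.cast_nonneg n
    have hX : 0 ≤ ‖traceForm n‖ * (Λ * W) := by positivity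
    have hXn : 0 ≤ n * (‖traceForm n‖ * (Λ * W)) := by positivity
    have e : (1 + (n : ℝ)) * (‖traceForm n‖ * Λ) * W
        = ‖traceForm n‖ * (Λ * W) + n * (‖traceForm n‖ * (Λ * W)) := by ring
    rw [e]
    refine ⟨by linarith, by linarith, ?_, by linarith⟩
    have := mul_le_mul_of_nonneg_left (l2.trans b2) hn
    linarith

end HasExpansion

/-! ### The sources of the profiles -/

/-- The source of the first order profile. -/
noncomputable def source₁ (Ω E : Set (Space n)) (p : ℕ → ℝ → Space n → ℝ) (z : ℝ) (x : Space n) :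
    ℝ :=
  p 1 z x + meanCurv Ω E (proj E x) * cv kerJ' (fun ζ => p 0 ζ x) z

/-- The source of the second order profile. -/
noncomputable def source₂ (Ω E : Set (Space n)) (p : ℕ → ℝ → Space n → ℝ) (z : ℝ) (x : Space n) :
    ℝ :=
  p 2 z x + meanCurv Ω E (proj E x) * cv kerJ' (fun ζ => source₁ Ω E p ζ x) z
    + (cv kerJ (fun ζ => (Δ (p 0 ζ)) (proj E x)) z
      + -1 * (z * (sqSecondFF Ω E (proj E x) * cv kerJ' (fun ζ => p 0 ζ x) z)))

/-- The source of the profile of order `j`: the profile itself is `J ∗ source`. -/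
noncomputable def source (Ω E : Set (Space n)) (p : ℕ → ℝ → Space n → ℝ) :
    ℕ → ℝ → Space n → ℝ
  | 0 => p 0
  | 1 => source₁ Ω E p
  | 2 => source₂ Ω E p
  | _ => fun _ _ => 0

lemma isBddC2_const (S : Set (Space n)) (c : ℝ) : IsBddC2 S fun _ : Space n => c :=
  ⟨contDiffOn_const, |c|, fun x _ => by
    have h : fderiv ℝ (fun _ : Space n => c) = fun _ => 0 := by ext1 y; simp
    rw [h]
    refine ⟨le_rfl, by simp, ?_⟩
    rw [fderiv_const_apply]
    exact (norm_zero (E := Space n →L[ℝ] Space n →L[ℝ] ℝ)).trans_le (abs_nonneg c)⟩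

section profile
variable {K : ℕ} {ε₀ μ Λ : ℝ} {φ₁ η₁ : ℝ → ℝ} {p : ℕ → ℝ → Space n → ℝ} {u : ℝ → Space n → ℝ}

lemma NormalConst.cv {f : ℝ → Space n → ℝ} (hf : NormalConst Ω E δ f) (κ : ℝ → ℝ) :
    NormalConst Ω E δ fun z x => cv κ (fun ζ => f ζ x) z := fun z x hx => by
  have : (fun ζ => f ζ x) = fun ζ => f ζ (proj E x) := funext fun ζ => hf ζ x hx
  simp only [this]

/-- The derivative of the leading profile decays, since the limits of `u₀` are constants. -/
lemma isProfile_cv_kerJ'_zero (hE : IsInterface Ω E δ) (hμ₀ : 0 < μ) (hμ₁ : μ < 1) (hΛ : 0 < Λ)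
    (hu : HasExpansion Ω E δ φ₁ η₁ K ε₀ μ Λ p u) :
    IsProfile (tube Ω E δ) μ μ 0 fun z x => cv kerJ' (fun ζ => p 0 ζ x) z := by
  have hs := hu.isSource_zero hE hμ₀ hΛ
  have hμ : |μ| < 1 := by rwa [abs_of_pos hμ₀]
  refine (hs.isProfile_cv hE.isOpen_tube isKernel_kerJ' (by simp) hμ (by simp)).with_value
    (C := Λ * cvConst μ + 2 * ∫ t : ℝ, Real.exp (-(1 * |t|))) fun z x hx => ?_
  have := isKernel_kerJ'.abs_cv_sub_sign_le (f := fun ζ => p 0 ζ x) hμ₀.le hμ₁ (hs.meas x hx)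
    ((hu.ae_abs_sub_sign_le hE).mono fun z hz => hz x hx) z
  simpa [integral_kerJ'] using this

lemma exists_cv_kerJ_sub_sign_bound (hE : IsInterface Ω E δ) (hμ₀ : 0 < μ) (hμ₁ : μ < 1)
    (hΛ : 0 < Λ) (hu : HasExpansion Ω E δ φ₁ η₁ K ε₀ μ Λ p u) :
    ∃ C, ∀ z, ∀ x ∈ tube Ω E δ,
      |cv kerJ (fun ζ => p 0 ζ x) z - Real.sign z| ≤ C * Real.exp (-(μ * |z|)) :=
  ⟨_, fun z x hx => by
    have := isKernel_kerJ.abs_cv_sub_sign_le (f := fun ζ => p 0 ζ x) hμ₀.le hμ₁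
      ((hu.isSource_zero hE hμ₀ hΛ).meas x hx)
      ((hu.ae_abs_sub_sign_le hE).mono fun z hz => hz x hx) z
    rwa [integral_kerJ, one_mul] at this⟩

lemma isSource_source₁ (hE : IsInterface Ω E δ) (hμ₀ : 0 < μ) (hμ₁ : μ < 1) (hΛ : 0 < Λ)
    (hu : HasExpansion Ω E δ φ₁ η₁ K ε₀ μ Λ p u) (hK : 1 ≤ K) :
    IsSource (tube Ω E δ) μ μ 0 (source₁ Ω E p) :=
  (hu.isSource_pos hE hK le_rfl).add hE.isOpen_tube
    (IsSource.mul hE.isOpen_tube (hE.isBddC2_comp_proj hE.contDiffOn_meanCurv)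
      (isProfile_cv_kerJ'_zero hE hμ₀ hμ₁ hΛ hu).isSource le_rfl hμ₀.le)

/-- The Laplacian of the leading profile. -/
lemma isProfile_cv_laplacian (hE : IsInterface Ω E δ) (hμ₀ : 0 < μ) (hμ₁ : μ < 1) (hΛ : 0 < Λ)
    (hu : HasExpansion Ω E δ φ₁ η₁ K ε₀ μ Λ p u) (hK : K = 2) :
    IsProfile (tube Ω E δ) μ μ μ fun z x => cv kerJ (fun ζ => (Δ (p 0 ζ)) x) z := by
  have hμ : |μ| < 1 := by rwa [abs_of_pos hμ₀]
  exact (hu.isSource_laplacian hE hμ₀ hΛ hK).isProfile_cv hE.isOpen_tube isKernel_kerJ hμ hμ hμ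

/-- The Hessian of `v₀'` is only used as a bounded function, so that for the term with the factor
`z` it is estimated by a growing weight; the gradient and the Laplacian decay. -/
lemma isSource_source₂ (hE : IsInterface Ω E δ) (hμ₀ : 0 < μ) (hμ₁ : μ < 1) (hΛ : 0 < Λ)
    (hu : HasExpansion Ω E δ φ₁ η₁ K ε₀ μ Λ p u) (hK : K = 2) {τ : ℝ} (hτ : 0 < τ) :
    IsSource (tube Ω E δ) (μ - τ) (μ - τ) (0 - τ) (source₂ Ω E p) := by
  have hS := hE.isOpen_tube
  have hμ : |μ| < 1 := by rwa [abs_of_pos hμ₀]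
  obtain ⟨C, hC1, hC2⟩ := hE.exists_proj_bound
  have hle : μ - τ ≤ μ := by linarith
  have hle0 : 0 - τ ≤ μ := by linarith
  have h0 : 0 - τ ≤ 0 := by linarith
  have h1 := (hu.isSource_pos hE (j := 2) hK.ge (by norm_num)).mono hle hle h0
  have h2 := (IsSource.mul hS (hE.isBddC2_comp_proj hE.contDiffOn_meanCurv)
    ((isSource_source₁ hE hμ₀ hμ₁ hΛ hu (by lia)).isProfile_cv hS isKernel_kerJ' hμ hμ
      (by simp)).isSource le_rfl hμ₀.le).mono hle hle h0
  have h3 := ((isProfile_cv_laplacian hE hμ₀ hμ₁ hΛ hu hK).comp_map hS hE.contDiffOn_two_proj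
    hE.mapsTo_proj hC1 hC2).mono hle hle hle0
  have h4 := IsSource.mul hS (isBddC2_const _ (-1)) (IsSource.mul_id hS
    (IsSource.mul hS (hE.isBddC2_comp_proj hE.contDiffOn_sqSecondFF)
      (isProfile_cv_kerJ'_zero hE hμ₀ hμ₁ hΛ hu).isSource le_rfl hμ₀.le) hτ) le_rfl (by linarith)
  exact (h1.add hS h2).add hS (h3.add hS h4)

/-- The source of order `0` is only bounded; the others decay. The loss `τ` in the rates comes from
the factor `z` in the second order source, and makes the bound on its Hessian a growing one. -/
lemma isSource_source (hE : IsInterface Ω E δ) (hμ₀ : 0 < μ) (hμ₁ : μ < 1) (hΛ : 0 < Λ)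
    (hu : HasExpansion Ω E δ φ₁ η₁ K ε₀ μ Λ p u) (hK : K ≤ 2) {τ : ℝ} (hτ : 0 < τ) {j : ℕ}
    (hj : j ≤ K) :
    IsSource (tube Ω E δ) (if j = 0 then 0 else μ - τ) (μ - τ) (0 - τ) (source Ω E p j) := by
  have hle : μ - τ ≤ μ := by linarith
  have h0 : 0 - τ ≤ 0 := by linarith
  match j, hj with
  | 0, _ => exact (hu.isSource_zero hE hμ₀ hΛ).mono (by simp) hle h0
  | 1, hj => exact (isSource_source₁ hE hμ₀ hμ₁ hΛ hu hj).mono (by simpa using hτ.le) hle h0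
  | 2, hj => exact (isSource_source₂ hE hμ₀ hμ₁ hΛ hu (by lia) hτ).mono (by simp) le_rfl le_rfl
  | j + 3, hj => lia

lemma continuousOn_comp_proj (hE : IsInterface Ω E δ) {f : ℝ → Space n → ℝ}
    (hf : ContinuousOn (fun q : ℝ × Space n => f q.1 q.2) (univ ×ˢ tube Ω E δ)) :
    ContinuousOn (fun q : ℝ × Space n => f q.1 (proj E q.2)) (univ ×ˢ tube Ω E δ) :=
  hf.comp (f := fun q : ℝ × Space n => (q.1, proj E q.2)) (continuousOn_fst.prodMk
    (hE.contDiffOn_proj.continuousOn.comp continuousOn_snd fun _ hq => hq.2))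
    fun _ hq => ⟨trivial, hE.mapsTo_proj hq.2⟩

lemma continuousOn_source₁ (hE : IsInterface Ω E δ) (hμ₀ : 0 < μ) (hμ₁ : μ < 1) (hΛ : 0 < Λ)
    (hu : HasExpansion Ω E δ φ₁ η₁ K ε₀ μ Λ p u) (hK : 1 ≤ K) :
    ContinuousOn (fun q : ℝ × Space n => source₁ Ω E p q.1 q.2) (univ ×ˢ tube Ω E δ) :=
  (hu.continuousOn 1 hK).add ((continuousOn_comp_proj hE (f := fun _ x => meanCurv Ω E x)
    (hE.contDiffOn_meanCurv.continuousOn.comp continuousOn_snd fun _ hq => hq.2)).mul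
    (isProfile_cv_kerJ'_zero hE hμ₀ hμ₁ hΛ hu).continuousOn)

lemma continuousOn_source₂ (hE : IsInterface Ω E δ) (hμ₀ : 0 < μ) (hμ₁ : μ < 1) (hΛ : 0 < Λ)
    (hu : HasExpansion Ω E δ φ₁ η₁ K ε₀ μ Λ p u) (hK : K = 2) :
    ContinuousOn (fun q : ℝ × Space n => source₂ Ω E p q.1 q.2) (univ ×ˢ tube Ω E δ) := by
  have hμ : |μ| < 1 := by rwa [abs_of_pos hμ₀]
  have h1 := (continuousOn_comp_proj hE (f := fun _ x => meanCurv Ω E x)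
    (hE.contDiffOn_meanCurv.continuousOn.comp continuousOn_snd fun _ hq => hq.2)).mul
    ((isSource_source₁ hE hμ₀ hμ₁ hΛ hu (by lia)).isProfile_cv hE.isOpen_tube isKernel_kerJ'
      hμ hμ (by simp)).continuousOn
  have h2 := continuousOn_comp_proj hE
    (f := fun z x => cv kerJ (fun ζ => (Δ (p 0 ζ)) x) z)
    (isProfile_cv_laplacian hE hμ₀ hμ₁ hΛ hu hK).continuousOn
  have h3 := (continuousOn_comp_proj hE (f := fun _ x => sqSecondFF Ω E x)
    (hE.contDiffOn_sqSecondFF.continuousOn.comp continuousOn_snd fun _ hq => hq.2)).mul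
    (isProfile_cv_kerJ'_zero hE hμ₀ hμ₁ hΛ hu).continuousOn
  exact ((hu.continuousOn 2 hK.ge).add h1).add
    (h2.add (continuousOn_const.mul (continuousOn_fst.mul h3)))

lemma continuousOn_source (hE : IsInterface Ω E δ) (hμ₀ : 0 < μ) (hμ₁ : μ < 1) (hΛ : 0 < Λ)
    (hu : HasExpansion Ω E δ φ₁ η₁ K ε₀ μ Λ p u) (hK : K ≤ 2) {j : ℕ} (hj : j ≤ K) :
    ContinuousOn (fun q : ℝ × Space n => source Ω E p j q.1 q.2) (univ ×ˢ tube Ω E δ) := by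
  match j, hj with
  | 0, _ => exact hu.continuousOn 0 (Nat.zero_le _)
  | 1, hj => exact continuousOn_source₁ hE hμ₀ hμ₁ hΛ hu hj
  | 2, hj => exact continuousOn_source₂ hE hμ₀ hμ₁ hΛ hu (by lia)
  | j + 3, hj => lia

lemma normalConst_source₁ (hE : IsInterface Ω E δ)
    (hu : HasExpansion Ω E δ φ₁ η₁ K ε₀ μ Λ p u) (hK : 1 ≤ K) :
    NormalConst Ω E δ (source₁ Ω E p) := fun z x hx => by
  have h0 := ((hu.normalConst (Nat.zero_le K)).cv kerJ') z x hx
  simp only [source₁, hu.normalConst hK z x hx, hE.proj_proj hx, h0]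

lemma normalConst_source (hE : IsInterface Ω E δ)
    (hu : HasExpansion Ω E δ φ₁ η₁ K ε₀ μ Λ p u) (hK : K ≤ 2) {j : ℕ} (hj : j ≤ K) :
    NormalConst Ω E δ (source Ω E p j) := by
  match j, hj with
  | 0, hj => exact hu.normalConst hj
  | 1, hj => exact normalConst_source₁ hE hu hj
  | 2, hj =>
    intro z x hx
    have h0 := ((hu.normalConst (Nat.zero_le K)).cv kerJ') z x hx
    have h1 := ((normalConst_source₁ hE hu (by lia)).cv kerJ') z x hx
    simp only [source, source₂, hu.normalConst hj z x hx, hE.proj_proj hx, h0, h1]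
  | j + 3, hj => lia

/-- A function with small gradient varies little between a point and its projection. -/
lemma IsInterface.abs_sub_proj_le (hE : IsInterface Ω E δ) {g : Space n → ℝ}
    (hg : ContDiffOn ℝ 2 g (tube Ω E δ)) {M : ℝ} (hM : ∀ y ∈ tube Ω E δ, ‖fderiv ℝ g y‖ ≤ M)
    {x : Space n} (hx : x ∈ tube Ω E δ) : |g x - g (proj E x)| ≤ M * |sdist Ω E x| := by
  have hsub : segment ℝ (proj E x) x ⊆ tube Ω E δ := by
    rw [segment_eq_image']
    rintro _ ⟨t, ht, rfl⟩
    exact (hE.segment_spec hx ht).1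
  have := (convex_segment (proj E x) x).norm_image_sub_le_of_norm_hasFDerivWithin_le
    (fun y hy => (hasFDerivAt_of_contDiffOn_two hE.isOpen_tube hg (hsub hy)).hasFDerivWithinAt)
    (fun y hy => hM y (hsub hy)) (left_mem_segment ℝ _ _) (right_mem_segment ℝ _ _)
  rwa [← dist_eq_norm x, hE.dist_proj hx] at this

lemma abs_mul_exp_le_exp {r s : ℝ} (h : r < s) (z : ℝ) :
    |z| * Real.exp (-(s * |z|)) ≤ 1 / (s - r) * Real.exp (-(r * |z|)) := by
  have := abs_mul_exp_le (r := s) (sub_pos.2 h) z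
  rwa [sub_sub_cancel] at this

lemma sq_mul_exp_le_exp {r s : ℝ} (h : r < s) (z : ℝ) :
    z ^ 2 * Real.exp (-(s * |z|)) ≤ (1 / ((s - r) / 2)) ^ 2 * Real.exp (-(r * |z|)) := by
  set t := (r + s) / 2 with ht
  have h1 := abs_mul_exp_le_exp (r := t) (s := s) (by rw [ht]; linarith) z
  have h2 := abs_mul_exp_le_exp (r := r) (s := t) (by rw [ht]; linarith) z
  have e1 : s - t = (s - r) / 2 := by rw [ht]; ring
  have e2 : t - r = (s - r) / 2 := by rw [ht]; ring
  rw [e1] at h1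
  rw [e2] at h2
  have hd : 0 < 1 / ((s - r) / 2) := by have := sub_pos.2 h; positivity
  calc z ^ 2 * Real.exp (-(s * |z|)) = |z| * (|z| * Real.exp (-(s * |z|))) := by
        rw [← sq_abs]; ring
    _ ≤ |z| * (1 / ((s - r) / 2) * Real.exp (-(t * |z|))) := by gcongr
    _ = 1 / ((s - r) / 2) * (|z| * Real.exp (-(t * |z|))) := by ring
    _ ≤ 1 / ((s - r) / 2) * (1 / ((s - r) / 2) * Real.exp (-(r * |z|))) := by gcongr
    _ = _ := by ring

end profile

/-! ### The profiles of the solution -/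

/-- The profile `v_j = J ∗ source j` of the solution. -/
noncomputable def profile (Ω E : Set (Space n)) (p : ℕ → ℝ → Space n → ℝ) (j : ℕ) (z : ℝ)
    (x : Space n) : ℝ := cv kerJ (fun ζ => source Ω E p j ζ x) z

/-- The `z`-derivative of `profile`. -/
noncomputable def profile' (Ω E : Set (Space n)) (p : ℕ → ℝ → Space n → ℝ) (j : ℕ) (z : ℝ)
    (x : Space n) : ℝ := cv kerJ' (fun ζ => source Ω E p j ζ x) z

section profile
variable {K : ℕ} {ε₀ μ Λ : ℝ} {φ₁ η₁ : ℝ → ℝ} {p : ℕ → ℝ → Space n → ℝ} {u : ℝ → Space n → ℝ}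

/-- The rates of `isSource_source` for `τ = μ / 20` are admissible for the convolution. -/
lemma abs_source_rate_lt (hμ₀ : 0 < μ) (hμ₁ : μ < 1) (j : ℕ) :
    |if j = 0 then 0 else μ - μ / 20| < 1 ∧ |μ - μ / 20| < 1 ∧ |0 - μ / 20| < 1 := by
  have h1 : |μ - μ / 20| < 1 := by rw [abs_lt]; constructor <;> linarith
  refine ⟨?_, h1, by rw [abs_lt]; constructor <;> linarith⟩
  split_ifs
  · simp
  · exact h1

lemma isProfile_profile (hE : IsInterface Ω E δ) (hμ₀ : 0 < μ) (hμ₁ : μ < 1) (hΛ : 0 < Λ)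
    (hu : HasExpansion Ω E δ φ₁ η₁ K ε₀ μ Λ p u) (hK : K ≤ 2) {j : ℕ} (hj : j ≤ K) :
    IsProfile (tube Ω E δ) (if j = 0 then 0 else μ - μ / 20) (μ - μ / 20) (0 - μ / 20)
      (profile Ω E p j) := by
  obtain ⟨h1, h2, h3⟩ := abs_source_rate_lt hμ₀ hμ₁ j
  exact (isSource_source hE hμ₀ hμ₁ hΛ hu hK (by positivity) hj).isProfile_cv hE.isOpen_tube
    isKernel_kerJ h1 h2 h3

lemma isProfile_profile' (hE : IsInterface Ω E δ) (hμ₀ : 0 < μ) (hμ₁ : μ < 1) (hΛ : 0 < Λ)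
    (hu : HasExpansion Ω E δ φ₁ η₁ K ε₀ μ Λ p u) (hK : K ≤ 2) {j : ℕ} (hj : j ≤ K) :
    IsProfile (tube Ω E δ) (if j = 0 then 0 else μ - μ / 20) (μ - μ / 20) (0 - μ / 20)
      (profile' Ω E p j) := by
  obtain ⟨h1, h2, h3⟩ := abs_source_rate_lt hμ₀ hμ₁ j
  exact (isSource_source hE hμ₀ hμ₁ hΛ hu hK (by positivity) hj).isProfile_cv hE.isOpen_tube
    isKernel_kerJ' h1 h2 h3

lemma contDiffOn_profile (hE : IsInterface Ω E δ) (hμ₀ : 0 < μ) (hμ₁ : μ < 1) (hΛ : 0 < Λ)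
    (hu : HasExpansion Ω E δ φ₁ η₁ K ε₀ μ Λ p u) (hK : K ≤ 2) {j : ℕ} (hj : j ≤ K) :
    ContDiffOn ℝ 2 (fun r : ℝ × Space n => profile Ω E p j r.1 r.2) (univ ×ˢ tube Ω E δ) := by
  obtain ⟨h1, h2, h3⟩ := abs_source_rate_lt hμ₀ hμ₁ j
  exact (isSource_source hE hμ₀ hμ₁ hΛ hu hK (by positivity) hj).contDiffOn_cv_kerJ hE.isOpen_tube
    h1 h2 h3 (continuousOn_source hE hμ₀ hμ₁ hΛ hu hK hj)

lemma hasDerivAt_profile (hE : IsInterface Ω E δ) (hμ₀ : 0 < μ) (hμ₁ : μ < 1) (hΛ : 0 < Λ)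
    (hu : HasExpansion Ω E δ φ₁ η₁ K ε₀ μ Λ p u) (hK : K ≤ 2) {j : ℕ} (hj : j ≤ K) {x : Space n}
    (hx : x ∈ tube Ω E δ) (z : ℝ) :
    HasDerivAt (fun z => profile Ω E p j z x) (profile' Ω E p j z x) z := by
  have hs := isSource_source hE hμ₀ hμ₁ hΛ hu hK (show 0 < μ / 20 by positivity) hj
  obtain ⟨C, hC⟩ := hs.bound
  exact hasDerivAt_cv_kerJ (hs.meas x hx) (abs_source_rate_lt hμ₀ hμ₁ j).1
    (hC.mono fun _ hz => (hz x hx).1) z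

lemma hasDerivAt_profile' (hE : IsInterface Ω E δ) (hμ₀ : 0 < μ) (hμ₁ : μ < 1) (hΛ : 0 < Λ)
    (hu : HasExpansion Ω E δ φ₁ η₁ K ε₀ μ Λ p u) (hK : K ≤ 2) {j : ℕ} (hj : j ≤ K) {x : Space n}
    (hx : x ∈ tube Ω E δ) (z : ℝ) : HasDerivAt (fun z => profile' Ω E p j z x)
      (profile Ω E p j z x - source Ω E p j z x) z := by
  obtain ⟨C, hC⟩ := (isSource_source hE hμ₀ hμ₁ hΛ hu hK (show 0 < μ / 20 by positivity) hj).bound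
  exact hasDerivAt_cv_kerJ' (continuous_of_continuousOn_prod
    (continuousOn_source hE hμ₀ hμ₁ hΛ hu hK hj) hx) (abs_source_rate_lt hμ₀ hμ₁ j).1
    (hC.mono fun _ hz => (hz x hx).1) z

lemma normalConst_profile (hE : IsInterface Ω E δ) (hu : HasExpansion Ω E δ φ₁ η₁ K ε₀ μ Λ p u)
    (hK : K ≤ 2) {j : ℕ} (hj : j ≤ K) : NormalConst Ω E δ (profile Ω E p j) :=
  (normalConst_source hE hu hK hj).cv kerJ

lemma dz_profile (hE : IsInterface Ω E δ) (hμ₀ : 0 < μ) (hμ₁ : μ < 1) (hΛ : 0 < Λ)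
    (hu : HasExpansion Ω E δ φ₁ η₁ K ε₀ μ Λ p u) (hK : K ≤ 2) {j : ℕ} (hj : j ≤ K) {x : Space n}
    (hx : x ∈ tube Ω E δ) (z : ℝ) : dz (profile Ω E p j) z x = profile' Ω E p j z x :=
  (hasDerivAt_profile hE hμ₀ hμ₁ hΛ hu hK hj hx z).deriv

lemma laplacian_profile_zero (hE : IsInterface Ω E δ) (hμ₀ : 0 < μ) (hμ₁ : μ < 1) (hΛ : 0 < Λ)
    (hu : HasExpansion Ω E δ φ₁ η₁ K ε₀ μ Λ p u) {x : Space n} (hx : x ∈ tube Ω E δ) (z : ℝ) :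
    (Δ (profile Ω E p 0 z)) x = cv kerJ (fun ζ => (Δ (p 0 ζ)) x) z :=
  (hu.isSource_zero hE hμ₀ hΛ).laplacian_cv hE.isOpen_tube isKernel_kerJ (by simp)
    (by rwa [abs_of_pos hμ₀]) (by simp) z hx

/-- Decay of the profiles and of their derivatives, with a common constant. -/
lemma exists_profile_bound (hE : IsInterface Ω E δ) (hμ₀ : 0 < μ) (hμ₁ : μ < 1) (hΛ : 0 < Λ)
    (hu : HasExpansion Ω E δ φ₁ η₁ K ε₀ μ Λ p u) (hK : K ≤ 2) :
    ∃ C, 0 < C ∧ ∀ j ≤ K, ∀ z, ∀ x ∈ tube Ω E δ,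
      |profile Ω E p j z x - if j = 0 then Real.sign z else 0|
        ≤ C * Real.exp (-((μ - μ / 20) * |z|)) ∧
      |profile' Ω E p j z x| ≤ C * Real.exp (-((μ - μ / 20) * |z|)) ∧
      ‖fderiv ℝ (profile Ω E p j z) x‖ ≤ C * Real.exp (-((μ - μ / 20) * |z|)) ∧
      |(Δ (profile Ω E p j z)) x| ≤ C * Real.exp (-((μ - μ / 20) * |z|)) := by
  have hrate : μ - μ / 20 ≤ μ := by linarith
  have key : ∀ j ≤ K, ∃ C, 0 ≤ C ∧ ∀ z, ∀ x ∈ tube Ω E δ,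
      |profile Ω E p j z x - if j = 0 then Real.sign z else 0|
        ≤ C * Real.exp (-((μ - μ / 20) * |z|)) ∧
      |profile' Ω E p j z x| ≤ C * Real.exp (-((μ - μ / 20) * |z|)) ∧
      ‖fderiv ℝ (profile Ω E p j z) x‖ ≤ C * Real.exp (-((μ - μ / 20) * |z|)) ∧
      |(Δ (profile Ω E p j z)) x| ≤ C * Real.exp (-((μ - μ / 20) * |z|)) := by
    intro j hj
    obtain ⟨C, hC⟩ := (isProfile_profile hE hμ₀ hμ₁ hΛ hu hK hj).bound
    have hv : ∃ D, ∀ z, ∀ x ∈ tube Ω E δ,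
        |profile Ω E p j z x - if j = 0 then Real.sign z else 0|
          ≤ D * Real.exp (-((μ - μ / 20) * |z|)) ∧
        |profile' Ω E p j z x| ≤ D * Real.exp (-((μ - μ / 20) * |z|)) := by
      obtain ⟨C', hC'⟩ := (isProfile_profile' hE hμ₀ hμ₁ hΛ hu hK hj).bound
      rcases Nat.eq_zero_or_pos j with rfl | h
      · obtain ⟨D₁, hD₁⟩ := exists_cv_kerJ_sub_sign_bound hE hμ₀ hμ₁ hΛ hu
        obtain ⟨D₂, hD₂⟩ := (isProfile_cv_kerJ'_zero hE hμ₀ hμ₁ hΛ hu).bound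
        refine ⟨max (max D₁ D₂) 0, fun z x hx => ⟨?_, ?_⟩⟩
        · rw [if_pos rfl]
          refine (hD₁ z x hx).trans (mul_le_mul ((le_max_left D₁ D₂).trans (le_max_left _ _))
            (exp_rate_le hrate z) (Real.exp_pos _).le (le_max_right _ _))
        · exact (hD₂ z x hx).1.trans (mul_le_mul ((le_max_right D₁ D₂).trans (le_max_left _ _))
            (exp_rate_le hrate z) (Real.exp_pos _).le (le_max_right _ _))
      · refine ⟨max C C', fun z x hx => ⟨?_, ?_⟩⟩
        · have := (hC z x hx).1
          rw [if_neg h.ne'] at this ⊢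
          rw [sub_zero]
          refine this.trans ?_
          gcongr; exact le_max_left _ _
        · have := (hC' z x hx).1
          rw [if_neg h.ne'] at this
          refine this.trans ?_
          gcongr; exact le_max_right _ _
    obtain ⟨D, hD⟩ := hv
    refine ⟨max (max C D) 0, le_max_right _ _, fun z x hx => ⟨(hD z x hx).1.trans ?_,
      (hD z x hx).2.trans ?_, (hC z x hx).2.1.trans ?_, (hC z x hx).2.2.1.trans ?_⟩⟩
    · gcongr; exact (le_max_right C D).trans (le_max_left _ _)
    · gcongr; exact (le_max_right C D).trans (le_max_left _ _)
    · gcongr; exact (le_max_left C D).trans (le_max_left _ _)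
    · gcongr; exact (le_max_left C D).trans (le_max_left _ _)
  choose! C hC0 hC using key
  refine ⟨∑ j ∈ Finset.range (K + 1), C j + 1, ?_, fun j hj z x hx => ?_⟩
  · have : 0 ≤ ∑ j ∈ Finset.range (K + 1), C j := Finset.sum_nonneg fun j hj =>
      hC0 j (Nat.lt_succ_iff.1 (Finset.mem_range.1 hj))
    linarith
  have hle : C j ≤ ∑ j ∈ Finset.range (K + 1), C j + 1 := by
    have := Finset.single_le_sum (f := C)
      (fun i hi => hC0 i (Nat.lt_succ_iff.1 (Finset.mem_range.1 hi)))
      (Finset.mem_range.2 (Nat.lt_succ_iff.2 hj))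
    linarith
  obtain ⟨h1, h2, h3, h4⟩ := hC j hj z x hx
  exact ⟨h1.trans (by gcongr), h2.trans (by gcongr), h3.trans (by gcongr), h4.trans (by gcongr)⟩

/-- The summed profile and its derivative approach their limits exponentially. -/
lemma exists_sum_profile_bound (hE : IsInterface Ω E δ) (hμ₀ : 0 < μ) (hμ₁ : μ < 1) (hΛ : 0 < Λ)
    (hu : HasExpansion Ω E δ φ₁ η₁ K ε₀ μ Λ p u) (hK : K ≤ 2) (hε₀ : 0 < ε₀) :
    ∃ C, 0 ≤ C ∧ ∀ ε ∈ Ioo 0 ε₀, ∀ z, ∀ x ∈ tube Ω E δ,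
      |∑ j ∈ Finset.range (K + 1), ε ^ j * profile Ω E p j z x - Real.sign z|
        ≤ C * Real.exp (-(9 / 10 * μ * |z|)) ∧
      |∑ j ∈ Finset.range (K + 1), ε ^ j * profile' Ω E p j z x|
        ≤ C * Real.exp (-(9 / 10 * μ * |z|)) := by
  obtain ⟨C, hC0, hC⟩ := exists_profile_bound hE hμ₀ hμ₁ hΛ hu hK
  refine ⟨∑ j ∈ Finset.range (K + 1), ε₀ ^ j * C, by positivity, fun ε hε z x hx => ?_⟩
  have hexp : Real.exp (-((μ - μ / 20) * |z|)) ≤ Real.exp (-(9 / 10 * μ * |z|)) :=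
    exp_rate_le (by linarith) z
  have hmem : ∀ {j}, j ∈ Finset.range (K + 1) → j ≤ K := fun hj =>
    Nat.lt_succ_iff.1 (Finset.mem_range.1 hj)
  have hsum : ∀ g : ℕ → ℝ, (∀ j ≤ K, |g j| ≤ C * Real.exp (-((μ - μ / 20) * |z|))) →
      |∑ j ∈ Finset.range (K + 1), ε ^ j * g j|
        ≤ (∑ j ∈ Finset.range (K + 1), ε₀ ^ j * C) * Real.exp (-(9 / 10 * μ * |z|)) := by
    intro g hg
    rw [Finset.sum_mul]
    refine (Finset.abs_sum_le_sum_abs _ _).trans (Finset.sum_le_sum fun j hj => ?_)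
    rw [abs_mul, abs_of_pos (pow_pos hε.1 j), mul_assoc]
    have := hε.1.le
    exact mul_le_mul (pow_le_pow_left₀ this hε.2.le j)
      ((hg j (hmem hj)).trans (by gcongr)) (abs_nonneg _) (by positivity)
  refine ⟨?_, hsum _ fun j hj => (hC j hj z x hx).2.1⟩
  have e : ∑ j ∈ Finset.range (K + 1), ε ^ j * profile Ω E p j z x - Real.sign z
      = ∑ j ∈ Finset.range (K + 1), ε ^ j *
        (profile Ω E p j z x - if j = 0 then Real.sign z else 0) := by
    simp only [mul_sub, Finset.sum_sub_distrib, mul_ite, mul_zero]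
    rw [Finset.sum_ite_eq' (Finset.range (K + 1)) 0]
    simp
  rw [e]
  exact hsum _ fun j hj => (hC j hj z x hx).1

/-! ### The residual -/

/-- Since `v₀` solves the leading order equation, only `ε Δd v₀'` and `ε² Δ v₀` are left. -/
lemma exists_residual_zero (hE : IsInterface Ω E δ) (hμ₀ : 0 < μ) (hμ₁ : μ < 1) (hΛ : 0 < Λ)
    (hu : HasExpansion Ω E δ φ₁ η₁ 0 ε₀ μ Λ p u) (hε₀ : 0 < ε₀) :
    ∃ C, 0 ≤ C ∧ ∀ ε ∈ Ioo 0 ε₀, ∀ z, ∀ x ∈ tube Ω E δ, sdist Ω E x = ε * z →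
      |∑ j ∈ Finset.range (0 + 1), ε ^ j * (p j z x - source Ω E p j z x
        + ε * ((Δ (sdist Ω E)) x * profile' Ω E p j z x) + ε ^ 2 * (Δ (profile Ω E p j z)) x)|
        ≤ C * ε ^ (0 + 1) * Real.exp (-(9 / 10 * μ * |z|)) := by
  obtain ⟨C, hC0, hC⟩ := exists_profile_bound hE hμ₀ hμ₁ hΛ hu (Nat.zero_le 2)
  obtain ⟨L, hL0, hL⟩ := hE.exists_laplacian_sdist_expansion
  refine ⟨L * C + ε₀ * C, by positivity, fun ε hε z x hx _ => ?_⟩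
  obtain ⟨-, h1, -, h2⟩ := hC 0 le_rfl z x hx
  have h3 := (hL x hx).1
  have hexp : Real.exp (-((μ - μ / 20) * |z|)) ≤ Real.exp (-(9 / 10 * μ * |z|)) :=
    exp_rate_le (by linarith) z
  set e := Real.exp (-((μ - μ / 20) * |z|))
  set e' := Real.exp (-(9 / 10 * μ * |z|))
  have he : 0 < e := Real.exp_pos _
  have hε0 := hε.1
  simp only [zero_add, Finset.sum_range_one, pow_zero, one_mul, source, sub_self, pow_one]
  have t1 : |(Δ (sdist Ω E)) x * profile' Ω E p 0 z x| ≤ L * (C * e') := by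
    rw [abs_mul]
    exact mul_le_mul h3 (h1.trans (by gcongr)) (abs_nonneg _) hL0
  have t2 : |ε * (Δ (profile Ω E p 0 z)) x| ≤ ε₀ * (C * e') := by
    rw [abs_mul, abs_of_pos hε0]
    exact mul_le_mul hε.2.le (h2.trans (by gcongr)) (abs_nonneg _) hε₀.le
  have e1 : ε * ((Δ (sdist Ω E)) x * profile' Ω E p 0 z x) + ε ^ 2 * (Δ (profile Ω E p 0 z)) x
      = ε * ((Δ (sdist Ω E)) x * profile' Ω E p 0 z x + ε * (Δ (profile Ω E p 0 z)) x) := by ring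
  rw [e1, abs_mul, abs_of_pos hε0]
  calc _ ≤ ε * (L * (C * e') + ε₀ * (C * e')) := by
        gcongr; exact (abs_add_le _ _).trans (add_le_add t1 t2)
    _ = _ := by ring

/-- The term of order `ε` is `(Δd - H) v₀'`, where `Δd - H = O(εz)`. -/
lemma exists_residual_one (hE : IsInterface Ω E δ) (hμ₀ : 0 < μ) (hμ₁ : μ < 1) (hΛ : 0 < Λ)
    (hu : HasExpansion Ω E δ φ₁ η₁ 1 ε₀ μ Λ p u) (hε₀ : 0 < ε₀) :
    ∃ C, 0 ≤ C ∧ ∀ ε ∈ Ioo 0 ε₀, ∀ z, ∀ x ∈ tube Ω E δ, sdist Ω E x = ε * z →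
      |∑ j ∈ Finset.range (1 + 1), ε ^ j * (p j z x - source Ω E p j z x
        + ε * ((Δ (sdist Ω E)) x * profile' Ω E p j z x) + ε ^ 2 * (Δ (profile Ω E p j z)) x)|
        ≤ C * ε ^ (1 + 1) * Real.exp (-(9 / 10 * μ * |z|)) := by
  obtain ⟨C, hC0, hC⟩ := exists_profile_bound hE hμ₀ hμ₁ hΛ hu (by norm_num)
  obtain ⟨L, hL0, hL⟩ := hE.exists_laplacian_sdist_expansion
  have hlt : 9 / 10 * μ < μ - μ / 20 := by linarith
  set A := 1 / (μ - μ / 20 - 9 / 10 * μ) with hA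
  have hA0 : 0 ≤ A := by have := sub_pos.2 hlt; positivity
  refine ⟨L * (C * A) + C + L * C + ε₀ * C, by positivity, fun ε hε z x hx hz => ?_⟩
  obtain ⟨-, h1, -, h2⟩ := hC 0 (by norm_num) z x hx
  obtain ⟨-, k1, -, k2⟩ := hC 1 le_rfl z x hx
  obtain ⟨h3, h4, -⟩ := hL x hx
  have hexp : Real.exp (-((μ - μ / 20) * |z|)) ≤ Real.exp (-(9 / 10 * μ * |z|)) :=
    exp_rate_le hlt.le z
  have hze := abs_mul_exp_le_exp hlt z
  rw [← hA] at hze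
  set e := Real.exp (-((μ - μ / 20) * |z|))
  set e' := Real.exp (-(9 / 10 * μ * |z|))
  have he : 0 < e := Real.exp_pos _
  have hε0 := hε.1
  rw [hz, abs_mul, abs_of_pos hε0] at h4
  have hs1 : source Ω E p 1 z x = p 1 z x + meanCurv Ω E (proj E x) * profile' Ω E p 0 z x := rfl
  have hs0 : source Ω E p 0 z x = p 0 z x := rfl
  simp only [Finset.sum_range_succ, Finset.sum_range_zero, zero_add, pow_zero, one_mul, pow_one,
    hs0, hs1, sub_self]
  set l := (Δ (sdist Ω E)) x
  set H := meanCurv Ω E (proj E x)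
  set a := profile' Ω E p 0 z x
  set b := profile' Ω E p 1 z x
  set α := (Δ (profile Ω E p 0 z)) x
  set β := (Δ (profile Ω E p 1 z)) x
  have t1 : |(l - H) * a| ≤ ε * (L * (C * A) * e') := by
    rw [abs_mul]
    calc _ ≤ L * (ε * |z|) * (C * e) := mul_le_mul h4 h1 (abs_nonneg _) (by positivity)
      _ = ε * (L * C * (|z| * e)) := by ring
      _ ≤ ε * (L * C * (A * e')) := by gcongr
      _ = _ := by ring
  have t2 : |α| ≤ C * e' := h2.trans (by gcongr)
  have t3 : |l * b| ≤ L * (C * e') := by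
    rw [abs_mul]; exact mul_le_mul h3 (k1.trans (by gcongr)) (abs_nonneg _) hL0
  have t4 : |ε * β| ≤ ε₀ * (C * e') := by
    rw [abs_mul, abs_of_pos hε0]
    exact mul_le_mul hε.2.le (k2.trans (by gcongr)) (abs_nonneg _) hε₀.le
  have e1 : ε * (l * a) + ε ^ 2 * α + ε * (p 1 z x - (p 1 z x + H * a) + ε * (l * b) + ε ^ 2 * β)
      = ε * ((l - H) * a) + ε ^ 2 * (α + l * b + ε * β) := by ring
  rw [e1]
  refine (abs_add_le _ _).trans ?_
  rw [abs_mul ε, abs_mul (ε ^ 2), abs_of_pos hε0, abs_of_pos (pow_pos hε0 2)]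
  calc _ ≤ ε * (ε * (L * (C * A) * e')) + ε ^ 2 * (C * e' + L * (C * e') + ε₀ * (C * e')) := by
        gcongr
        exact (abs_add_three _ _ _).trans (by gcongr)
    _ = _ := by ring

/-- The terms of order `ε²` are `(Δd - H + εz|II|²) v₀' / ε`, `(Δd - H) v₁'` and the difference of
`Δ v₀` at a point and at its projection; all of them are of order `ε`, up to powers of `z`. -/
lemma exists_residual_two (hE : IsInterface Ω E δ) (hμ₀ : 0 < μ) (hμ₁ : μ < 1) (hΛ : 0 < Λ)
    (hu : HasExpansion Ω E δ φ₁ η₁ 2 ε₀ μ Λ p u) (hε₀ : 0 < ε₀) :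
    ∃ C, 0 ≤ C ∧ ∀ ε ∈ Ioo 0 ε₀, ∀ z, ∀ x ∈ tube Ω E δ, sdist Ω E x = ε * z →
      |∑ j ∈ Finset.range (2 + 1), ε ^ j * (p j z x - source Ω E p j z x
        + ε * ((Δ (sdist Ω E)) x * profile' Ω E p j z x) + ε ^ 2 * (Δ (profile Ω E p j z)) x)|
        ≤ C * ε ^ (2 + 1) * Real.exp (-(9 / 10 * μ * |z|)) := by
  obtain ⟨C, hC0, hC⟩ := exists_profile_bound hE hμ₀ hμ₁ hΛ hu le_rfl
  obtain ⟨L, hL0, hL⟩ := hE.exists_laplacian_sdist_expansion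
  have hW := isProfile_cv_laplacian hE hμ₀ hμ₁ hΛ hu rfl
  obtain ⟨D₀, hD₀⟩ := hW.bound
  set D := max D₀ 0 with hD
  have hlt : 9 / 10 * μ < μ - μ / 20 := by linarith
  set A := 1 / (μ - μ / 20 - 9 / 10 * μ) with hA
  have hA0 : 0 ≤ A := by have := sub_pos.2 hlt; positivity
  set A₂ := (1 / ((μ - μ / 20 - 9 / 10 * μ) / 2)) ^ 2 with hA₂
  have hA₂0 : 0 ≤ A₂ := sq_nonneg _
  have hD0 : 0 ≤ D := le_max_right _ _
  refine ⟨L * (C * A₂) + L * (C * A) + D * A + L * C + C + ε₀ * C, by positivity,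
    fun ε hε z x hx hz => ?_⟩
  obtain ⟨-, h1, -, -⟩ := hC 0 (by norm_num) z x hx
  obtain ⟨-, k1, -, k2⟩ := hC 1 (by norm_num) z x hx
  obtain ⟨-, m1, -, m2⟩ := hC 2 le_rfl z x hx
  obtain ⟨h3, h4, h5⟩ := hL x hx
  have hexp : Real.exp (-((μ - μ / 20) * |z|)) ≤ Real.exp (-(9 / 10 * μ * |z|)) :=
    exp_rate_le hlt.le z
  have hze := abs_mul_exp_le_exp hlt z
  have hzze := sq_mul_exp_le_exp hlt z
  rw [← hA] at hze
  rw [← hA₂] at hzze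
  have hdiff := hE.abs_sub_proj_le (hW.smooth z) (M := D * Real.exp (-((μ - μ / 20) * |z|)))
    (fun y hy => (hD₀ z y hy).2.1.trans (mul_le_mul (le_max_left _ _)
      (exp_rate_le (by linarith) z) (Real.exp_pos _).le hD0)) hx
  have hε0 := hε.1
  rw [hz, abs_mul, abs_of_pos hε0] at h4 hdiff
  rw [hz, mul_pow] at h5
  set e := Real.exp (-((μ - μ / 20) * |z|))
  set e' := Real.exp (-(9 / 10 * μ * |z|))
  have he : 0 < e := Real.exp_pos _
  have hs1 : source Ω E p 1 z x = p 1 z x + meanCurv Ω E (proj E x) * profile' Ω E p 0 z x := rfl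
  have hs2 : source Ω E p 2 z x = p 2 z x + meanCurv Ω E (proj E x) * profile' Ω E p 1 z x
      + (cv kerJ (fun ζ => (Δ (p 0 ζ)) (proj E x)) z
        + -1 * (z * (sqSecondFF Ω E (proj E x) * profile' Ω E p 0 z x))) := rfl
  have hs0 : source Ω E p 0 z x = p 0 z x := rfl
  simp only [Finset.sum_range_succ, Finset.sum_range_zero, zero_add, pow_zero, one_mul, pow_one,
    hs0, hs1, hs2, sub_self]
  rw [laplacian_profile_zero hE hμ₀ hμ₁ hΛ hu hx]
  set l := (Δ (sdist Ω E)) x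
  set H := meanCurv Ω E (proj E x)
  set S₂ := sqSecondFF Ω E (proj E x)
  set a := profile' Ω E p 0 z x
  set b := profile' Ω E p 1 z x
  set c := profile' Ω E p 2 z x
  set β := (Δ (profile Ω E p 1 z)) x
  set γ := (Δ (profile Ω E p 2 z)) x
  set w := cv kerJ (fun ζ => (Δ (p 0 ζ)) x) z
  set w₀ := cv kerJ (fun ζ => (Δ (p 0 ζ)) (proj E x)) z
  have t1 : |(l - (H - ε * z * S₂)) * a| ≤ ε ^ 2 * (L * (C * A₂) * e') := by
    rw [abs_mul]
    calc _ ≤ L * (ε ^ 2 * z ^ 2) * (C * e) := mul_le_mul h5 h1 (abs_nonneg _) (by positivity)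
      _ = ε ^ 2 * (L * C * (z ^ 2 * e)) := by ring
      _ ≤ ε ^ 2 * (L * C * (A₂ * e')) := by gcongr
      _ = _ := by ring
  have t2 : |(l - H) * b| ≤ ε * (L * (C * A) * e') := by
    rw [abs_mul]
    calc _ ≤ L * (ε * |z|) * (C * e) := mul_le_mul h4 k1 (abs_nonneg _) (by positivity)
      _ = ε * (L * C * (|z| * e)) := by ring
      _ ≤ ε * (L * C * (A * e')) := by gcongr
      _ = _ := by ring
  have t3 : |w - w₀| ≤ ε * (D * A * e') := by
    calc _ ≤ D * e * (ε * |z|) := hdiff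
      _ = ε * (D * (|z| * e)) := by ring
      _ ≤ ε * (D * (A * e')) := by gcongr
      _ = _ := by ring
  have t4 : |l * c| ≤ L * (C * e') := by
    rw [abs_mul]; exact mul_le_mul h3 (m1.trans (by gcongr)) (abs_nonneg _) hL0
  have t5 : |β| ≤ C * e' := k2.trans (by gcongr)
  have t6 : |ε * γ| ≤ ε₀ * (C * e') := by
    rw [abs_mul, abs_of_pos hε0]
    exact mul_le_mul hε.2.le (m2.trans (by gcongr)) (abs_nonneg _) hε₀.le
  have e1 : ε * (l * a) + ε ^ 2 * w + ε * (p 1 z x - (p 1 z x + H * a) + ε * (l * b) + ε ^ 2 * β)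
      + ε ^ 2 * (p 2 z x - (p 2 z x + H * b + (w₀ + -1 * (z * (S₂ * a)))) + ε * (l * c)
        + ε ^ 2 * γ)
      = ε * ((l - (H - ε * z * S₂)) * a) + ε ^ 2 * ((l - H) * b + (w - w₀))
        + ε ^ 3 * (l * c + β + ε * γ) := by ring
  rw [e1]
  refine (abs_add_three _ _ _).trans ?_
  rw [abs_mul ε, abs_mul (ε ^ 2), abs_mul (ε ^ 3), abs_of_pos hε0, abs_of_pos (pow_pos hε0 2),
    abs_of_pos (pow_pos hε0 3)]
  calc _ ≤ ε * (ε ^ 2 * (L * (C * A₂) * e'))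
        + ε ^ 2 * (ε * (L * (C * A) * e') + ε * (D * A * e'))
        + ε ^ 3 * (L * (C * e') + C * e' + ε₀ * (C * e')) := by
        gcongr
        · exact (abs_add_le _ _).trans (by gcongr)
        · exact (abs_add_three _ _ _).trans (by gcongr)
    _ = _ := by ring

/-- The residual of the ansatz in the inner variable. The rate `9/10 μ` is smaller than
`μ - μ / 20`, which leaves room for the factors `z` of the curvature expansion. -/
lemma exists_residual (hE : IsInterface Ω E δ) (hμ₀ : 0 < μ) (hμ₁ : μ < 1) (hΛ : 0 < Λ)
    (hu : HasExpansion Ω E δ φ₁ η₁ K ε₀ μ Λ p u) (hK : K ≤ 2) (hε₀ : 0 < ε₀) :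
    ∃ C, 0 ≤ C ∧ ∀ ε ∈ Ioo 0 ε₀, ∀ z, ∀ x ∈ tube Ω E δ, sdist Ω E x = ε * z →
      |∑ j ∈ Finset.range (K + 1), ε ^ j * (p j z x - source Ω E p j z x
        + ε * ((Δ (sdist Ω E)) x * profile' Ω E p j z x) + ε ^ 2 * (Δ (profile Ω E p j z)) x)|
        ≤ C * ε ^ (K + 1) * Real.exp (-(9 / 10 * μ * |z|)) := by
  match K, hK with
  | 0, _ => exact exists_residual_zero hE hμ₀ hμ₁ hΛ hu hε₀
  | 1, _ => exact exists_residual_one hE hμ₀ hμ₁ hΛ hu hε₀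
  | 2, _ => exact exists_residual_two hE hμ₀ hμ₁ hΛ hu hε₀
  | K + 3, hK => lia

end profile

/-! ### Representation formulas and decay of the profiles -/

section inner
variable {K : ℕ} {ε₀ μ Λ : ℝ} {φ₁ η₁ : ℝ → ℝ} {p : ℕ → ℝ → Space n → ℝ} {u : ℝ → Space n → ℝ}

lemma profile_zero_eq (z : ℝ) (x : Space n) :
    profile Ω E p 0 z x = opA₀ (fun ζ => p 0 ζ x) z := rfl

lemma profile_one_eq (hE : IsInterface Ω E δ) (hμ₀ : 0 < μ) (hμ₁ : μ < 1) (hΛ : 0 < Λ)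
    (hu : HasExpansion Ω E δ φ₁ η₁ K ε₀ μ Λ p u) (hK : K ≤ 2) (z : ℝ) {x : Space n}
    (hx : x ∈ tube Ω E δ) :
    profile Ω E p 1 z x = opA₀ (fun ζ =>
      p 1 ζ x + meanCurv Ω E (proj E x) * dz (profile Ω E p 0) ζ x) z := by
  simp only [dz_profile hE hμ₀ hμ₁ hΛ hu hK (Nat.zero_le K) hx]
  rfl

lemma profile_two_eq (hE : IsInterface Ω E δ) (hμ₀ : 0 < μ) (hμ₁ : μ < 1) (hΛ : 0 < Λ)
    (hu : HasExpansion Ω E δ φ₁ η₁ K ε₀ μ Λ p u) (hK : K ≤ 2) (h1 : 1 ≤ K) (z : ℝ) {x : Space n}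
    (hx : x ∈ tube Ω E δ) :
    profile Ω E p 2 z x = opA₀ (fun ζ =>
      p 2 ζ x + meanCurv Ω E (proj E x) * dz (profile Ω E p 1) ζ x
        + ((Δ (profile Ω E p 0 ζ)) (proj E x)
          - ζ * sqSecondFF Ω E (proj E x) * dz (profile Ω E p 0) ζ x)) z := by
  simp only [dz_profile hE hμ₀ hμ₁ hΛ hu hK (Nat.zero_le K) hx,
    dz_profile hE hμ₀ hμ₁ hΛ hu hK h1 hx,
    laplacian_profile_zero hE hμ₀ hμ₁ hΛ hu (hE.mapsTo_proj hx), profile, cv, opA₀]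
  refine integral_congr_ae (Eventually.of_forall fun ζ => ?_)
  simp only [source, source₂, profile', kerJ, cv, smul_eq_mul]
  ring

lemma normalConst_dz {w : ℝ → Space n → ℝ} (hw : NormalConst Ω E δ w) :
    NormalConst Ω E δ (dz w) := fun z x hx => by
  have : (fun s => w s x) = fun s => w s (proj E x) := funext fun s => hw s x hx
  simp only [dz, this]

lemma exists_memXInner_profile_zero (hE : IsInterface Ω E δ) (hμ₀ : 0 < μ) (hμ₁ : μ < 1)
    (hΛ : 0 < Λ) (hu : HasExpansion Ω E δ φ₁ η₁ K ε₀ μ Λ p u) (hK : K ≤ 2) :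
    ∃ μ' > 0, ∃ Λ' > 0, MemXInner Ω E δ μ' Λ' fun z x => profile Ω E p 0 z x - Real.sign z := by
  obtain ⟨C, hC0, hC⟩ := exists_profile_bound hE hμ₀ hμ₁ hΛ hu hK
  have hc := (isProfile_profile hE hμ₀ hμ₁ hΛ hu hK (Nat.zero_le K)).continuousOn
  refine ⟨μ - μ / 20, by linarith, C, hC0, expDecay_of_forall hE.isOpen_tube
    ((hc.aestronglyMeasurable (isOpen_univ.prod hE.isOpen_tube).measurableSet).sub
      (measurable_sign.comp measurable_fst).aestronglyMeasurable)
    fun z x hx => ?_, fun z x hx => ?_⟩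
  · simpa using (hC 0 (Nat.zero_le K) z x hx).1
  · simp only [normalConst_profile hE hu hK (Nat.zero_le K) z x hx]

lemma exists_memXInner_profile (hE : IsInterface Ω E δ) (hμ₀ : 0 < μ) (hμ₁ : μ < 1)
    (hΛ : 0 < Λ) (hu : HasExpansion Ω E δ φ₁ η₁ K ε₀ μ Λ p u) (hK : K ≤ 2) {j : ℕ} (hj : j ≤ K)
    (h1 : 1 ≤ j) : ∃ μ' > 0, ∃ Λ' > 0, MemXInner Ω E δ μ' Λ' (profile Ω E p j) := by
  obtain ⟨C, hC0, hC⟩ := exists_profile_bound hE hμ₀ hμ₁ hΛ hu hK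
  refine ⟨μ - μ / 20, by linarith, C, hC0, expDecay_of_continuousOn hE.isOpen_tube
    (isProfile_profile hE hμ₀ hμ₁ hΛ hu hK hj).continuousOn fun z x hx => ?_,
    normalConst_profile hE hu hK hj⟩
  simpa [Nat.one_le_iff_ne_zero.1 h1] using (hC j hj z x hx).1

lemma exists_expDecay_derivatives_profile (hE : IsInterface Ω E δ) (hμ₀ : 0 < μ) (hμ₁ : μ < 1)
    (hΛ : 0 < Λ) (hu : HasExpansion Ω E δ φ₁ η₁ K ε₀ μ Λ p u) (hK : K ≤ 2) {j : ℕ} (hj : j ≤ K) :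
    ∃ μ' > 0, ∃ Λ' > 0, MemXInner Ω E δ μ' Λ' (dz (profile Ω E p j)) ∧
      ExpDecay (tube Ω E δ) μ' Λ' (fun z x => ‖gradient (profile Ω E p j z) x‖) ∧
      ExpDecay (tube Ω E δ) μ' Λ' (fun z x => (Δ (profile Ω E p j z)) x) := by
  obtain ⟨C, hC0, hC⟩ := exists_profile_bound hE hμ₀ hμ₁ hΛ hu hK
  have hp := isProfile_profile hE hμ₀ hμ₁ hΛ hu hK hj
  have hd := fun (x : Space n) (hx : x ∈ tube Ω E δ) => dz_profile hE hμ₀ hμ₁ hΛ hu hK hj hx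
  refine ⟨μ - μ / 20, by linarith, C, hC0, ⟨expDecay_of_continuousOn hE.isOpen_tube
      ((isProfile_profile' hE hμ₀ hμ₁ hΛ hu hK hj).continuousOn.congr fun q hq => hd _ hq.2 q.1)
      fun z x hx => ?_, normalConst_dz (normalConst_profile hE hu hK hj)⟩,
    expDecay_of_continuousOn hE.isOpen_tube ?_ fun z x hx => ?_,
    expDecay_of_continuousOn hE.isOpen_tube ?_ fun z x hx => (hC j hj z x hx).2.2.2⟩
  · rw [hd x hx]
    exact (hC j hj z x hx).2.1
  · simp only [norm_gradient]
    exact hp.continuousOn_fderiv.norm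
  · rw [abs_norm, norm_gradient]
    exact (hC j hj z x hx).2.2.1
  · simp only [laplacian_eq_traceForm]
    exact (traceForm n).continuous.comp_continuousOn hp.continuousOn_fderiv_fderiv

end inner

end PhaseField

theorem mainTheorem7 {n : ℕ} (Ω E : Set (PhaseField.Space n)) (δ : ℝ)
    (hE : PhaseField.IsInterface Ω E δ)
    (φ₁ η₁ : ℝ → ℝ) (hφ : PhaseField.IsDistModifier φ₁) (hη : PhaseField.IsCutoff η₁)
    (K : ℕ) (hK : K ≤ 2) (ε₀ μ Λ : ℝ) (hε₀ : 0 < ε₀) (hμ₀ : 0 < μ) (hμ₁ : μ < 1) (hΛ : 0 < Λ)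
    (u : ℝ → PhaseField.Space n → ℝ) (p : ℕ → ℝ → PhaseField.Space n → ℝ)
    (hu : PhaseField.HasExpansion Ω E δ φ₁ η₁ K ε₀ μ Λ p u)
    (v : ℝ → PhaseField.Space n → ℝ)
    (hv : ∀ ε ∈ Set.Ioo 0 ε₀, PhaseField.IsNeumannSolution Ω ε (u ε) (v ε)) :
    ∃ q : ℕ → ℝ → PhaseField.Space n → ℝ,
      (∀ j ≤ K, ContDiffOn ℝ 2 (fun r : ℝ × PhaseField.Space n => q j r.1 r.2)
        (Set.univ ×ˢ PhaseField.tube Ω E δ)) ∧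
      (∃ Λ' > 0, PhaseField.IsRepresented Ω E δ φ₁ η₁ K ε₀ μ Λ' q v) ∧
      (∀ z : ℝ, ∀ x ∈ PhaseField.tube Ω E δ,
        q 0 z x = PhaseField.opA₀ (fun ζ => p 0 ζ x) z) ∧
      (1 ≤ K → ∀ z : ℝ, ∀ x ∈ PhaseField.tube Ω E δ,
        q 1 z x = PhaseField.opA₀ (fun ζ =>
          p 1 ζ x + PhaseField.meanCurv Ω E (PhaseField.proj E x) * PhaseField.dz (q 0) ζ x) z) ∧
      (2 ≤ K → ∀ z : ℝ, ∀ x ∈ PhaseField.tube Ω E δ,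
        q 2 z x = PhaseField.opA₀ (fun ζ =>
          p 2 ζ x + PhaseField.meanCurv Ω E (PhaseField.proj E x) * PhaseField.dz (q 1) ζ x
            + ((Δ (q 0 ζ)) (PhaseField.proj E x)
              - ζ * PhaseField.sqSecondFF Ω E (PhaseField.proj E x)
                * PhaseField.dz (q 0) ζ x)) z) ∧
      (∃ μ' > 0, ∃ Λ' > 0,
        PhaseField.MemXInner Ω E δ μ' Λ' (fun z x => q 0 z x - Real.sign z)) ∧
      (∀ j ≤ K, 1 ≤ j → ∃ μ' > 0, ∃ Λ' > 0, PhaseField.MemXInner Ω E δ μ' Λ' (q j)) ∧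
      (∀ j ≤ K, ∃ μ' > 0, ∃ Λ' > 0,
        PhaseField.MemXInner Ω E δ μ' Λ' (PhaseField.dz (q j)) ∧
        PhaseField.ExpDecay (PhaseField.tube Ω E δ) μ' Λ'
          (fun z x => ‖gradient (q j z) x‖) ∧
        PhaseField.ExpDecay (PhaseField.tube Ω E δ) μ' Λ'
          (fun z x => (Δ (q j z)) x)) := by
  refine ⟨PhaseField.profile Ω E p,
    fun j hj => PhaseField.contDiffOn_profile hE hμ₀ hμ₁ hΛ hu hK hj, ?_,
    fun z x _ => PhaseField.profile_zero_eq z x,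
    fun _ z x hx => PhaseField.profile_one_eq hE hμ₀ hμ₁ hΛ hu hK z hx,
    fun h2 z x hx => PhaseField.profile_two_eq hE hμ₀ hμ₁ hΛ hu hK (by lia) z hx,
    PhaseField.exists_memXInner_profile_zero hE hμ₀ hμ₁ hΛ hu hK,
    fun j hj h1 => PhaseField.exists_memXInner_profile hE hμ₀ hμ₁ hΛ hu hK hj h1,
    fun j hj => PhaseField.exists_expDecay_derivatives_profile hE hμ₀ hμ₁ hΛ hu hK hj⟩
  exact PhaseField.isRepresented_of_residual hE hφ hη hμ₀ hμ₁ hε₀ hu.represented hv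
    hu.continuousOn (fun j hj => hu.normalConst hj) (hu.exists_bound hE hμ₀ hΛ)
    (fun j hj => PhaseField.contDiffOn_profile hE hμ₀ hμ₁ hΛ hu hK hj)
    (fun j hj => PhaseField.normalConst_profile hE hu hK hj)
    (fun j hj x hx z => PhaseField.hasDerivAt_profile hE hμ₀ hμ₁ hΛ hu hK hj hx z)
    (fun j hj x hx z => PhaseField.hasDerivAt_profile' hE hμ₀ hμ₁ hΛ hu hK hj hx z)
    (PhaseField.exists_sum_profile_bound hE hμ₀ hμ₁ hΛ hu hK hε₀)
    (PhaseField.exists_residual hE hμ₀ hμ₁ hΛ hu hK hε₀)
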